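/- Let $Q$ be a smooth (Hausdorff, second countable) manifold of dimension $n$ without boundary, with a smooth Riemannian metric $g$ and a smooth potential $V:Q\to\mathbb{R}$; put $L(q,v)=\tfrac12 g_q(v,v)-V(q)$. Let $\eta^1,\dots,\eta^m$ be smooth one-forms on $Q$ that are linearly independent at every point, and let $\mathcal{D}=\{(q,v)\in TQ:\eta^\alpha_q(v)=0,\ \alpha=1,\dots,m\}$. Let $h:Q\to\mathbb{R}$ be smooth, such that $dh_q\notin\operatorname{span}(\eta^1_q,\dots,\eta^m_q)$ whenever $h(q)=0$. Consider the nonholonomic impact system with elastic impacts $(\mathcal{D},\hat S_{\mathcal D},X,\Delta)$ on $\mathcal{D}$. Its continuous dynamics $X$ is given by the Lagrange–d'Alembert equations $$\frac{d}{dt}\frac{\partial L}{\partial \dot q}-\frac{\partial L}{\partial q}=\lambda_\alpha\eta^\alpha,\qquad \eta^\alpha(\dot q)=0,$$ impacts take place on $\hat S_{\mathcal D}=\{(q,v)\in\mathcal{D}: h(q)=0,\ dh(v)<0\}$, and the impact map is $\Delta(q,v)=(q,\,v+\lambda_kW^k+\varepsilon\nabla h)$ with $$\varepsilon=\frac{-2\,dh(v)}{dh(\nabla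 h)-m_{\alpha\beta}\,dh(W^\alpha)dh(W^\beta)},\qquad \lambda_k=\frac{2\,m_{k\ell}\,dh(W^\ell)\,dh(v)}{dh(\nabla h)-m_{\alpha\beta}\,dh(W^\alpha)dh(W^\beta)},$$ where $g(W^\alpha,\cdot)=\eta^\alpha$, $g(\nabla h,\cdot)=dh$, and $(m_{\alpha\beta})$ is the inverse of the matrix $m^{\alpha\beta}=\eta^\alpha(W^\beta)$; repeated indices are summed. A hybrid trajectory follows $X$, is continuous from the left, and restarts at $\Delta(x)$ right after each time at which its value $x$ lies in $\hat S_{\mathcal D}$. A state $x\in\mathcal{D}$ is a Zeno state if there are impact times $0\le t_0<t_1<\cdots$ of its trajectory that converge to a finite time; it is a steady Zeno state if, for some such sequence, the states at the times $t_i$ do not escape every compact set as $i\to\infty$. Then the set of steady Zeno states has measure zero in the manifold $\mathcal{D}$, that is, with respect to every smooth volume form on $\mathcal{D}$ (in particular the nonholonomic volume, carried over from $\mathcal{D}^*$ by the Legendre transform). If $Q$ is compact, then the set of all Zeno states has measure zero in $\mathcal{D}$. -/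

import Mathlib

open Set Filter Topology MeasureTheory
open scoped Manifold ContDiff

noncomputable section

namespace Nonholonomic

/-- A nonholonomic mechanical system with an impact surface, on an `n`-dimensional configuration
manifold `Q`: a Riemannian metric (the kinetic energy), a potential, `m` pointwise linearly
independent constraint one-forms, and a function whose zero level is the location of impacts. -/
structure ImpactSystem (n m : ℕ) (Q : Type*) [TopologicalSpace Q]
    [ChartedSpace (EuclideanSpace ℝ (Fin n)) Q] [IsManifold (𝓡 n) ∞ Q] where
  /-- the Riemannian metric defining the kinetic energy -/
  metric : Bundle.ContMDiffRiemannianMetric (𝓡 n) ∞ (EuclideanSpace ℝ (Fin n))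
    (fun q : Q => TangentSpace (𝓡 n) q)
  /-- the potential energy -/
  V : Q → ℝ
  V_smooth : ContMDiff (𝓡 n) 𝓘(ℝ, ℝ) ∞ V
  /-- the constraint one-forms -/
  η : Fin m → (q : Q) → TangentSpace (𝓡 n) q →L[ℝ] ℝ
  /-- A one-form is smooth iff it is smooth as a function on the tangent bundle. -/
  η_smooth : ∀ α, ContMDiff (𝓡 n).tangent 𝓘(ℝ, ℝ) ∞
    (fun v : TangentBundle (𝓡 n) Q => η α v.proj v.snd)
  η_linearIndependent : ∀ q, LinearIndependent ℝ (fun α => η α q)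
  /-- the function whose zero set is the location of impacts -/
  h : Q → ℝ
  h_smooth : ContMDiff (𝓡 n) 𝓘(ℝ, ℝ) ∞ h
  /-- the nontrivial impact condition: along `h = 0`, the differential of `h` does not belong to
  the annihilator of the constraint distribution (so that `0` is also a regular value of `h`) -/
  nontrivial_impact : ∀ q, h q = 0 →
    (mfderiv (𝓡 n) 𝓘(ℝ, ℝ) h q : TangentSpace (𝓡 n) q →L[ℝ] ℝ) ∉
      Submodule.span ℝ (Set.range fun α => η α q)

/-- Existence of the metric dual of a covector. -/
theorem exists_metric_dual {n : ℕ} {Q : Type*} [TopologicalSpace Q]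
    [ChartedSpace (EuclideanSpace ℝ (Fin n)) Q] [IsManifold (𝓡 n) ∞ Q]
    (g : Bundle.ContMDiffRiemannianMetric (𝓡 n) ∞ (EuclideanSpace ℝ (Fin n))
      (fun q : Q => TangentSpace (𝓡 n) q))
    (q : Q) (ξ : TangentSpace (𝓡 n) q →L[ℝ] ℝ) :
    ∃ w : TangentSpace (𝓡 n) q, ∀ v, g.inner q w v = ξ v := by
  let B : EuclideanSpace ℝ (Fin n) →ₗ[ℝ] (EuclideanSpace ℝ (Fin n) →L[ℝ] ℝ) :=
    (g.inner q).toLinearMap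
  have hinj : Function.Injective B := by
    rw [injective_iff_map_eq_zero]
    intro w hw
    by_contra hne
    have h1 := g.pos q w hne
    have h2 : g.inner q w w = 0 := congrArg (fun f => f w) hw
    exact absurd h2 h1.ne'
  have hfin : Module.finrank ℝ (EuclideanSpace ℝ (Fin n)) =
      Module.finrank ℝ (EuclideanSpace ℝ (Fin n) →L[ℝ] ℝ) := by
    rw [← (LinearMap.toContinuousLinearMap (𝕜 := ℝ) (E := EuclideanSpace ℝ (Fin n))
      (F' := ℝ)).finrank_eq]
    exact (Subspace.dual_finrank_eq (K := ℝ)).symm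
  obtain ⟨w, hw⟩ := (LinearMap.injective_iff_surjective_of_finrank_eq_finrank hfin).1 hinj ξ
  exact ⟨w, fun v => congrArg (fun f => f v) hw⟩

namespace ImpactSystem

variable {n m : ℕ} {Q : Type*} [TopologicalSpace Q]
  [ChartedSpace (EuclideanSpace ℝ (Fin n)) Q] [IsManifold (𝓡 n) ∞ Q]

/-- The natural Lagrangian `L(q, v) = g_q(v, v) / 2 - V(q)`. -/
def lagrangian (M : ImpactSystem n m Q) (q : Q) (v : TangentSpace (𝓡 n) q) : ℝ :=
  M.metric.inner q v v / 2 - M.V q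

/-- The constraint distribution, as a subset of the tangent bundle. -/
def D (M : ImpactSystem n m Q) : Set (TangentBundle (𝓡 n) Q) :=
  {v | ∀ α, M.η α v.proj v.snd = 0}

/-- The differential of `h`. -/
def dh (M : ImpactSystem n m Q) (q : Q) : TangentSpace (𝓡 n) q →L[ℝ] ℝ :=
  mfderiv (𝓡 n) 𝓘(ℝ, ℝ) M.h q

/-- The impact surface in the state space `D`: states at `h = 0` with `dh(v) < 0`. -/
def impactSurface (M : ImpactSystem n m Q) : Set (TangentBundle (𝓡 n) Q) :=
  {v | v ∈ M.D ∧ M.h v.proj = 0 ∧ M.dh v.proj v.snd < 0}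

/-! ### The elastic impact map -/

/-- The tangent vector `ξ♯` with `g(ξ♯, ·) = ξ`. -/
def sharp (M : ImpactSystem n m Q) (q : Q) (ξ : TangentSpace (𝓡 n) q →L[ℝ] ℝ) :
    TangentSpace (𝓡 n) q :=
  Classical.choose (exists_metric_dual M.metric q ξ)

theorem sharp_spec (M : ImpactSystem n m Q) (q : Q) (ξ : TangentSpace (𝓡 n) q →L[ℝ] ℝ)
    (v : TangentSpace (𝓡 n) q) : M.metric.inner q (M.sharp q ξ) v = ξ v :=
  Classical.choose_spec (exists_metric_dual M.metric q ξ) v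

/-- The gradient of `h`. -/
def gradh (M : ImpactSystem n m Q) (q : Q) : TangentSpace (𝓡 n) q := M.sharp q (M.dh q)

/-- The dual vector fields `W^α` of the constraint one-forms. -/
def W (M : ImpactSystem n m Q) (α : Fin m) (q : Q) : TangentSpace (𝓡 n) q := M.sharp q (M.η α q)

/-- The constraint mass matrix `m^{αβ} = η^α(W^β)`. -/
def massMatrix (M : ImpactSystem n m Q) (q : Q) : Matrix (Fin m) (Fin m) ℝ :=
  Matrix.of fun α β => M.η α q (M.W β q)

/-- The denominator `dh(∇h) - m_{αβ} dh(W^α) dh(W^β)`, where `m_{αβ}` is the inverse matrix. -/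
def impactDenom (M : ImpactSystem n m Q) (q : Q) : ℝ :=
  M.dh q (M.gradh q) -
    ∑ α, ∑ β, (M.massMatrix q)⁻¹ α β * M.dh q (M.W α q) * M.dh q (M.W β q)

/-- The multiplier `ε` of `dh` at an impact. -/
def impactEps (M : ImpactSystem n m Q) (v : TangentBundle (𝓡 n) Q) : ℝ :=
  -2 * M.dh v.proj v.snd / M.impactDenom v.proj

/-- The multipliers `λ_k` of the constraint one-forms at an impact. -/
def impactLam (M : ImpactSystem n m Q) (v : TangentBundle (𝓡 n) Q) (k : Fin m) : ℝ :=
  2 * (∑ l, (M.massMatrix v.proj)⁻¹ k l * M.dh v.proj (M.W l v.proj)) * M.dh v.proj v.snd /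
    M.impactDenom v.proj

/-- The elastic nonholonomic impact map `(q, v) ↦ (q, v + λ_k W^k + ε ∇h)`. -/
def impactMap (M : ImpactSystem n m Q) (v : TangentBundle (𝓡 n) Q) : TangentBundle (𝓡 n) Q :=
  ⟨v.proj, v.snd + ∑ k, M.impactLam v k • M.W k v.proj + M.impactEps v • M.gradh v.proj⟩

/-! ### The motion between impacts -/

/-- The Lagrangian in the chart around `q₀`, as a function of the coordinates `y` of the position
and of the coordinates `w` of the velocity. -/
def coordLagrangian (M : ImpactSystem n m Q) (q₀ : Q) (y w : EuclideanSpace ℝ (Fin n)) : ℝ :=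
  M.lagrangian ((extChartAt (𝓡 n) q₀).symm y)
    (mfderiv 𝓘(ℝ, EuclideanSpace ℝ (Fin n)) (𝓡 n) (extChartAt (𝓡 n) q₀).symm y w)

/-- The constraint one-forms in the chart around `q₀`. -/
def coordη (M : ImpactSystem n m Q) (q₀ : Q) (α : Fin m) (y : EuclideanSpace ℝ (Fin n)) :
    EuclideanSpace ℝ (Fin n) →L[ℝ] ℝ :=
  (M.η α ((extChartAt (𝓡 n) q₀).symm y)).comp
    (mfderiv 𝓘(ℝ, EuclideanSpace ℝ (Fin n)) (𝓡 n) (extChartAt (𝓡 n) q₀).symm y)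

/-- `c` is a solution, on the open set of times `J`, of the Lagrange-d'Alembert equations
`d/dt (∂L/∂v) - ∂L/∂q = λ_α η^α`, `η^α(q') = 0`, where the state `c t` consists of the position
`q t` and of the velocity `q' t`. The first equation is written in every chart around `q t`. -/
def IsFreeMotionOn (M : ImpactSystem n m Q) (c : ℝ → TangentBundle (𝓡 n) Q) (J : Set ℝ) : Prop :=
  ∀ t ∈ J, c t ∈ M.D ∧
    HasMFDerivAt 𝓘(ℝ, ℝ) (𝓡 n) (fun s => (c s).proj) t
      (ContinuousLinearMap.toSpanSingleton ℝ (c t).snd) ∧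
    ∀ q₀ : Q, (c t).proj ∈ (extChartAt (𝓡 n) q₀).source →
      let x : ℝ → EuclideanSpace ℝ (Fin n) := fun s => extChartAt (𝓡 n) q₀ (c s).proj
      ∃ mult : Fin m → ℝ,
        HasDerivAt (fun s => fderiv ℝ (fun w => M.coordLagrangian q₀ (x s) w) (deriv x s))
          (fderiv ℝ (fun y => M.coordLagrangian q₀ y (deriv x t)) (x t) +
            ∑ α, mult α • M.coordη q₀ α (x t)) t

/-! ### The hybrid flow and Zeno states -/

open Classical in
/-- The state from which the continuous motion proceeds: the image under the impact map
on the impact surface, and the state itself elsewhere. -/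
def reset (M : ImpactSystem n m Q) (v : TangentBundle (𝓡 n) Q) : TangentBundle (𝓡 n) Q :=
  if v ∈ M.impactSurface then M.impactMap v else v

/-- `γ`, restricted to `[0, T)`, is the trajectory of `x` under the hybrid flow: right after each
time `t` it follows the continuous dynamics started at `γ t`, or at the image of `γ t` under the
impact map if `γ t` is on the impact surface; and it is continuous from the left (at an impact
time, `γ` takes the value before the impact). -/
structure IsHybridTrajectory (M : ImpactSystem n m Q) (γ : ℝ → TangentBundle (𝓡 n) Q) (T : ℝ)
    (x : TangentBundle (𝓡 n) Q) : Prop where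
  init : γ 0 = x
  left_continuous : ∀ t ∈ Ioo 0 T, ContinuousWithinAt γ (Iio t) t
  right_motion : ∀ t ∈ Ico 0 T, ∃ ε > 0, ∃ c : ℝ → TangentBundle (𝓡 n) Q,
    M.IsFreeMotionOn c (Ioo (t - ε) (t + ε)) ∧ c t = M.reset (γ t) ∧ ∀ s ∈ Ioo t (t + ε), s < T →
      γ s = c s

/-- `γ` is the trajectory of `x`, and `t` is an increasing sequence of impact times of `γ` that
converges to the finite time `T`. -/
structure IsZenoTrajectory (M : ImpactSystem n m Q) (γ : ℝ → TangentBundle (𝓡 n) Q) (T : ℝ)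
    (t : ℕ → ℝ) (x : TangentBundle (𝓡 n) Q) : Prop where
  trajectory : M.IsHybridTrajectory γ T x
  nonneg : ∀ i, 0 ≤ t i
  strictMono : StrictMono t
  tendsto : Tendsto t atTop (𝓝 T)
  impact : ∀ i, γ (t i) ∈ M.impactSurface

/-- The Zeno states: the states whose trajectory has infinitely many impacts in finite time. -/
def zenoStates (M : ImpactSystem n m Q) : Set (TangentBundle (𝓡 n) Q) :=
  {x | ∃ γ T t, M.IsZenoTrajectory γ T t x}

/-- The steady Zeno states: those for which the states at the impact times do not
escape every compact set. -/
def steadyZenoStates (M : ImpactSystem n m Q) : Set (TangentBundle (𝓡 n) Q) :=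
  {x | ∃ γ T t, M.IsZenoTrajectory γ T t x ∧ ¬ Tendsto (fun i => γ (t i)) atTop (cocompact _)}

/-! ### Sets of measure zero in the state space -/

/-- `A ∩ D` has measure zero in the manifold `D` (of dimension `2 n - m`): its preimage in every
bundle chart `(y, a) ↦ ∑ a_j e_j(y)` of the vector bundle `D` is a Lebesgue null set, where `y`
is in an open set `U` of coordinates on `Q` and `e` is a smooth frame of `D` over `U`. As for any
manifold, these are the null sets of every smooth volume form on `D`. -/
def IsNull (M : ImpactSystem n m Q) (A : Set (TangentBundle (𝓡 n) Q)) : Prop :=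
  ∀ (q₀ : Q) (U : Set (EuclideanSpace ℝ (Fin n))), IsOpen U → U ⊆ (extChartAt (𝓡 n) q₀).target →
    ∀ e : Fin (n - m) → EuclideanSpace ℝ (Fin n) → EuclideanSpace ℝ (Fin n),
      (∀ j, ContDiffOn ℝ ∞ (e j) U) →
      (∀ y ∈ U, LinearIndependent ℝ (fun j => e j y)) →
      (∀ y ∈ U, ∀ j α, M.coordη q₀ α y (e j y) = 0) →
      volume {p : EuclideanSpace ℝ (Fin n) × (Fin (n - m) → ℝ) | p.1 ∈ U ∧
        (⟨(extChartAt (𝓡 n) q₀).symm p.1,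
          mfderiv 𝓘(ℝ, EuclideanSpace ℝ (Fin n)) (𝓡 n) (extChartAt (𝓡 n) q₀).symm p.1
            (∑ j, p.2 j • e j p.1)⟩ : TangentBundle (𝓡 n) Q) ∈ A} = 0

end ImpactSystem

end Nonholonomic

end

noncomputable section

set_option linter.unusedSectionVars false

namespace Nonholonomic

open scoped NNReal ENNReal

/-! A Zeno trajectory ends in a singular state, where both the height `h` and the normal velocity
`dh(v)` vanish. Two scalar conditions alone would only put such endpoints in codimension two, and
flowing them back adds one dimension; the proof makes this count quantitative, for a flow with
reflections.

Near `h = 0` the distribution has coordinates `(h, u, z)` with `u = dh(v)`, in which an elastic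
impact is exactly `u ↦ -u` (`exists_adaptedCoords`, `StateChart.coord_impactMap`). The tangential
part of `z` consists of momenta `g(v, e_j)`, so pairing the Lagrange–d'Alembert equation with
sections of the distribution removes the multipliers and leaves a smooth field. Since `|u|` does not
jump, it is Lipschitz in time; if height and normal velocity come arbitrarily close to zero before
`T`, then `|u| ≤ M (T - t)` and `|h| ≤ M (T - t)^2`. Within time `τ` of the end the state is
therefore in a box of volume `O(τ^3)`. A grid of step `τ = 1/(N+1)` on `[0, 1]` needs `N + 1`
pullbacks of such a box, and the total volume tends to zero (`volume_reflectedSingular`).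

This requires that pullback by the reflected motion distorts volume boundedly
(`volume_reflectedPullback_le`), although infinitely many impacts may accumulate at the end and no
regular flow map is at hand. Unfolding the half-space by the reflection `(h, u) ↦ (-h, -u)` removes
the jumps but makes the field discontinuous across `h = 0`. A splitting scheme copes with this: a
volume-preserving shear of the position is followed by a kick of the velocity at frozen position,
where the unfolded field is still Lipschitz in the velocity variables. The scheme converges, up to
the reflection, to every reflected motion (`IsReflectedMotion.eulerStep_convergence`).

Globally, the end considered is either the accumulation time or the first grazing (`h = 0`, `dh(v) =
0`) after the first impact; before it the motion is free or regularly reflected, with `h ≥ 0`. Null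
sets are pulled back from the end to the initial state through countably many charts, bounds and
rational times (`mem_singularPullback`). Steadiness supplies a cluster point, and the speed bound
then keeps the trajectory in one chart up to its end (`StateChart.exists_confined_end`). On a
compact manifold conservation of energy makes every Zeno state steady. -/

theorem continuous_induction {P : ℝ → Prop} {a b : ℝ} (ha : P a)
    (hleft : ∀ s ∈ Ioc a b, (∀ t ∈ Ico a s, P t) → P s)
    (hright : ∀ s ∈ Ico a b, (∀ t ∈ Icc a s, P t) → ∃ ε > 0, ∀ t ∈ Ioo s (s + ε), t ≤ b → P t) :
    ∀ s ∈ Icc a b, P s := by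
  by_contra! hcon
  set B := {s | s ∈ Icc a b ∧ ¬ P s} with hB
  have hne : B.Nonempty := hcon
  have hbdd : BddBelow B := ⟨a, fun s hs => hs.1.1⟩
  have hσa : a ≤ sInf B := le_csInf hne fun s hs => hs.1.1
  obtain ⟨s₁, hs₁⟩ := hne
  have hσb : sInf B ≤ b := (csInf_le hbdd hs₁).trans hs₁.1.2
  have hlt : ∀ t ∈ Ico a (sInf B), P t := by
    intro t ht
    by_contra hPt
    exact absurd (csInf_le hbdd ⟨⟨ht.1, ht.2.le.trans hσb⟩, hPt⟩) (not_le.2 ht.2)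
  have hσ : P (sInf B) := by
    rcases hσa.eq_or_lt with h | h
    · rwa [← h]
    · exact hleft _ ⟨h, hσb⟩ hlt
  have hle : ∀ t ∈ Icc a (sInf B), P t := by
    intro t ht
    rcases ht.2.eq_or_lt with h | h
    · rwa [h]
    · exact hlt t ⟨ht.1, h⟩
  rcases hσb.eq_or_lt with h | h
  · have : s₁ = sInf B := le_antisymm (h ▸ hs₁.1.2) (csInf_le hbdd hs₁)
    exact hs₁.2 (this ▸ hσ)
  · obtain ⟨ε, hε, hP⟩ := hright _ ⟨hσa, h⟩ hle
    obtain ⟨s, hs, hslt⟩ := exists_lt_of_csInf_lt ⟨s₁, hs₁⟩ (lt_add_of_pos_right (sInf B) hε)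
    rcases (csInf_le hbdd hs).eq_or_lt with h' | h'
    · exact hs.2 (h' ▸ hσ)
    · exact hs.2 (hP s ⟨h', hslt⟩ hs.1.2)

/-! ### A measure-quasi-preserving scheme for reflected flows -/

section Scheme

variable {Z : Type*} [NormedAddCommGroup Z] [NormedSpace ℝ Z]

/-- Truncation to `[-U, U]`. -/
def clamp (U u : ℝ) : ℝ := max (-U) (min U u)

theorem clamp_neg (U u : ℝ) (hU : 0 ≤ U) : clamp U (-u) = -clamp U u := by
  unfold clamp
  rcases le_total U u with h | h <;> rcases le_total (-U) u with h' | h' <;>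
  rcases le_total U (-u) with h'' | h'' <;>
  simp only [max_def, min_def] <;> split_ifs <;> linarith

theorem abs_clamp_le {U : ℝ} (hU : 0 ≤ U) (u : ℝ) : |clamp U u| ≤ U := by
  rw [abs_le]
  exact ⟨le_max_left _ _, max_le (by linarith) (min_le_left _ _)⟩

theorem abs_clamp_sub_le (U u v : ℝ) : |clamp U u - clamp U v| ≤ |u - v| := by
  unfold clamp
  calc |max (-U) (min U u) - max (-U) (min U v)| ≤ |min U u - min U v| := by
        simpa using abs_max_sub_max_le_max (-U) (min U u) (-U) (min U v)
    _ ≤ |u - v| := by simpa using abs_min_sub_min_le_max U u U v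

theorem clamp_of_abs_le {U u : ℝ} (h : |u| ≤ U) : clamp U u = u := by
  rw [abs_le] at h
  unfold clamp
  rw [min_eq_right h.2, max_eq_right h.1]

theorem continuous_clamp (U : ℝ) : Continuous (clamp U) := by
  unfold clamp; fun_prop

/-- Reversal of the first component. -/
def flip (w : ℝ × Z) : ℝ × Z := (-w.1, w.2)

/-- The reflection which exchanges the two copies of the half-space. -/
def reflect (x : ℝ × ℝ × Z) : ℝ × ℝ × Z := (-x.1, flip x.2)

theorem flip_flip (w : ℝ × Z) : flip (flip w) = w := by simp [flip]

theorem reflect_reflect (x : ℝ × ℝ × Z) : reflect (reflect x) = x := by simp [reflect, flip_flip]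

theorem flip_add (w w' : ℝ × Z) : flip (w + w') = flip w + flip w' := by
  ext <;> simp [flip]; ring

theorem flip_smul (a : ℝ) (w : ℝ × Z) : flip (a • w) = a • flip w := by
  ext <;> simp [flip]

theorem flip_sub (w w' : ℝ × Z) : flip (w - w') = flip w - flip w' := by
  ext <;> simp [flip]; ring

theorem norm_flip (w : ℝ × Z) : ‖flip w‖ = ‖w‖ := by simp [flip, Prod.norm_def]

theorem norm_flip_sub (w w' : ℝ × Z) : ‖flip w - flip w'‖ = ‖w - w'‖ := by
  rw [← flip_sub, norm_flip]

theorem norm_reflect_sub (x y : ℝ × ℝ × Z) : ‖reflect x - reflect y‖ = ‖x - y‖ := by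
  have : (reflect x - reflect y) = (-(x.1 - y.1), flip x.2 - flip y.2) := by
    ext <;> simp [reflect]; ring
  rw [this]
  change max ‖-(x.1 - y.1)‖ ‖flip x.2 - flip y.2‖ = max ‖x.1 - y.1‖ ‖x.2 - y.2‖
  rw [norm_flip_sub, norm_neg]

theorem continuous_flip : Continuous (flip : ℝ × Z → ℝ × Z) := by unfold flip; fun_prop

theorem continuous_reflect : Continuous (reflect : ℝ × ℝ × Z → ℝ × ℝ × Z) := by
  unfold reflect; exact continuous_fst.neg.prodMk (continuous_flip.comp continuous_snd)

/-- The field `F` on `h > 0`, extended by reflection. -/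
def foldField (F : ℝ × ℝ × Z → ℝ × Z) (x : ℝ × ℝ × Z) : ℝ × Z :=
  if 0 < x.1 then F x else if x.1 < 0 then flip (F (reflect x)) else 0

theorem foldField_reflect (F : ℝ × ℝ × Z → ℝ × Z) (x : ℝ × ℝ × Z) :
    foldField F (reflect x) = flip (foldField F x) := by
  have h0 : (flip 0 : ℝ × Z) = 0 := by simp [flip]
  rcases lt_trichotomy x.1 0 with h | h | h
  · have : 0 < (reflect x).1 := by simpa [reflect] using h
    simp [foldField, this, h, h.le.not_gt, flip_flip]
  · have : (reflect x).1 = 0 := by simpa [reflect] using h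
    simp [foldField, this, h, h0]
  · have : (reflect x).1 < 0 := by simpa [reflect] using h
    simp [foldField, this, h, this.le.not_gt, reflect_reflect]

theorem norm_foldField_le {F : ℝ × ℝ × Z → ℝ × Z} {B : ℝ} (hB : ∀ x, ‖F x‖ ≤ B)
    (x : ℝ × ℝ × Z) : ‖foldField F x‖ ≤ B := by
  unfold foldField
  split_ifs
  · exact hB _
  · rw [norm_flip]; exact hB _
  · simpa using (norm_nonneg _).trans (hB x)

/-- Only differences at equal height are controlled: the unfolded field jumps across `h = 0`. This
is enough, since the kick of the scheme compares velocities over a fixed position. -/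
theorem norm_foldField_sub_le {F : ℝ × ℝ × Z → ℝ × Z} {L : ℝ≥0} (hL : LipschitzWith L F)
    (h : ℝ) (w w' : ℝ × Z) : ‖foldField F (h, w) - foldField F (h, w')‖ ≤ L * ‖w - w'‖ := by
  unfold foldField
  dsimp only
  split_ifs
  · refine (hL.norm_sub_le _ _).trans (le_of_eq ?_)
    simp [Prod.norm_def (_ : ℝ × ℝ × Z)]
  · rw [norm_flip_sub]
    refine (hL.norm_sub_le _ _).trans (le_of_eq ?_)
    rw [norm_reflect_sub]
    simp [Prod.norm_def (_ : ℝ × ℝ × Z)]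
  · simp; positivity

/-- One step of the scheme: the position moves first, and then the velocity is updated with the
reflected field at the new position. -/
def eulerStep (F : ℝ × ℝ × Z → ℝ × Z) (U δ : ℝ) (x : ℝ × ℝ × Z) : ℝ × ℝ × Z :=
  (x.1 + δ * clamp U x.2.1, x.2 + δ • foldField F (x.1 + δ * clamp U x.2.1, x.2))

/-- The scheme descends to the quotient by the reflection, so a trajectory may be followed in
whichever of the two copies is convenient. -/
theorem eulerStep_reflect (F : ℝ × ℝ × Z → ℝ × Z) {U : ℝ} (hU : 0 ≤ U) (δ : ℝ) (x : ℝ × ℝ × Z) :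
    eulerStep F U δ (reflect x) = reflect (eulerStep F U δ x) := by
  have h1 : (reflect x).1 + δ * clamp U (reflect x).2.1 = -(x.1 + δ * clamp U x.2.1) := by
    simp only [reflect, flip, clamp_neg U _ hU]; ring
  have h2 : ((-(x.1 + δ * clamp U x.2.1), (reflect x).2) : ℝ × ℝ × Z) =
      reflect (x.1 + δ * clamp U x.2.1, x.2) := rfl
  unfold eulerStep
  rw [h1, h2, foldField_reflect]
  simp only [reflect, flip_add, flip_smul]

theorem iterate_eulerStep_reflect (F : ℝ × ℝ × Z → ℝ × Z) {U : ℝ} (hU : 0 ≤ U) (δ : ℝ) (k : ℕ)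
    (x : ℝ × ℝ × Z) :
    (eulerStep F U δ)^[k] (reflect x) = reflect ((eulerStep F U δ)^[k] x) :=
  ((Function.Semiconj.iterate_right (f := reflect) (fun x => (eulerStep_reflect F hU δ x).symm) k) x).symm

theorem norm_eulerStep_sub_le {F : ℝ × ℝ × Z → ℝ × Z} {B U δ : ℝ} (hB : ∀ x, ‖F x‖ ≤ B)
    (hU : 0 ≤ U) (hδ : 0 ≤ δ) (x : ℝ × ℝ × Z) : ‖eulerStep F U δ x - x‖ ≤ max U B * δ := by
  have : eulerStep F U δ x - x = δ • (clamp U x.2.1, foldField F (x.1 + δ * clamp U x.2.1, x.2)) := by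
    ext <;> simp [eulerStep]
  rw [this, norm_smul, Real.norm_of_nonneg hδ, mul_comm, Prod.norm_def]
  refine mul_le_mul_of_nonneg_right (max_le_max ?_ (norm_foldField_le hB _)) hδ
  exact abs_clamp_le hU _

theorem norm_iterate_eulerStep_sub_le {F : ℝ × ℝ × Z → ℝ × Z} {B U δ : ℝ} (hB : ∀ x, ‖F x‖ ≤ B)
    (hU : 0 ≤ U) (hδ : 0 ≤ δ) (k : ℕ) (x : ℝ × ℝ × Z) :
    ‖(eulerStep F U δ)^[k] x - x‖ ≤ max U B * (k * δ) := by
  induction k with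
  | zero => simp
  | succ k ih =>
    rw [Function.iterate_succ_apply']
    calc _ ≤ ‖eulerStep F U δ ((eulerStep F U δ)^[k] x) - (eulerStep F U δ)^[k] x‖ +
          ‖(eulerStep F U δ)^[k] x - x‖ := norm_sub_le_norm_sub_add_norm_sub _ _ _
      _ ≤ max U B * δ + max U B * (k * δ) := add_le_add (norm_eulerStep_sub_le hB hU hδ _) ih
      _ = _ := by push_cast; ring

/-! ### Volume distortion of the scheme. -/

section Measure

variable [FiniteDimensional ℝ Z] [MeasureSpace Z] [BorelSpace Z]
  [(volume : Measure Z).IsAddHaarMeasure]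

instance isAddHaarMeasure_volume_real_prod : (volume : Measure (ℝ × Z)).IsAddHaarMeasure :=
  inferInstanceAs ((volume : Measure ℝ).prod (volume : Measure Z)).IsAddHaarMeasure

/-- Haar measure is a multiple of the Hausdorff measure of full dimension, for which the bound holds
for every set and without surjectivity or continuity of the map. -/
theorem _root_.AntilipschitzWith.addHaar_preimage_le {E : Type*} [NormedAddCommGroup E]
    [NormedSpace ℝ E] [FiniteDimensional ℝ E] [MeasurableSpace E] [BorelSpace E] (μ : Measure E)
    [μ.IsAddHaarMeasure] {K : ℝ≥0} {f : E → E} (hf : AntilipschitzWith K f) (s : Set E) :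
    μ (f ⁻¹' s) ≤ (K : ℝ≥0∞) ^ Module.finrank ℝ E * μ s := by
  have h := Measure.isAddLeftInvariant_eq_smul μ (Measure.hausdorffMeasure (Module.finrank ℝ E) : Measure E)
  rw [h, Measure.smul_apply, Measure.smul_apply, mul_smul_comm]
  gcongr
  have := hf.hausdorffMeasure_preimage_le (d := Module.finrank ℝ E) (by positivity) s
  simpa using this

theorem measurable_foldField {F : ℝ × ℝ × Z → ℝ × Z} (hF : Continuous F) :
    Measurable (foldField F) := by
  unfold foldField
  refine Measurable.ite (measurableSet_lt measurable_const measurable_fst) hF.measurable ?_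
  refine Measurable.ite (measurableSet_lt measurable_fst measurable_const) ?_ measurable_const
  exact (continuous_flip.comp (hF.comp continuous_reflect)).measurable

theorem measurable_shear (U δ : ℝ) :
    Measurable fun x : ℝ × ℝ × Z => (x.1 + δ * clamp U x.2.1, x.2) := by
  have := continuous_clamp U
  have : Continuous fun x : ℝ × ℝ × Z => (x.1 + δ * clamp U x.2.1, x.2) := by fun_prop
  exact this.measurable

theorem measurable_kick {F : ℝ × ℝ × Z → ℝ × Z} (hF : Continuous F) (δ : ℝ) :
    Measurable fun x : ℝ × ℝ × Z => (x.1, x.2 + δ • foldField F x) :=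
  measurable_fst.prodMk (measurable_snd.add ((measurable_foldField hF).const_smul δ))

theorem eulerStep_eq (F : ℝ × ℝ × Z → ℝ × Z) (U δ : ℝ) :
    eulerStep F U δ = (fun x : ℝ × ℝ × Z => (x.1, x.2 + δ • foldField F x)) ∘
      fun x : ℝ × ℝ × Z => (x.1 + δ * clamp U x.2.1, x.2) := rfl

theorem measurable_eulerStep {F : ℝ × ℝ × Z → ℝ × Z} (hF : Continuous F) (U δ : ℝ) :
    Measurable (eulerStep F U δ) := by
  rw [eulerStep_eq]
  exact (measurable_kick hF δ).comp (measurable_shear U δ)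

/-- Over each fixed velocity the shear is a translation of the position. -/
theorem volume_shear_preimage (U δ : ℝ) {V : Set (ℝ × ℝ × Z)} (hV : MeasurableSet V) :
    volume ((fun x : ℝ × ℝ × Z => (x.1 + δ * clamp U x.2.1, x.2)) ⁻¹' V) = volume V := by
  rw [Measure.volume_eq_prod, Measure.prod_apply_symm (measurable_shear U δ hV),
    Measure.prod_apply_symm hV]
  congr 1
  ext w
  exact measure_preimage_add_right volume (δ * clamp U w.1) ((fun h => (h, w)) ⁻¹' V)

/-- Over each fixed position the kick is a perturbation of the identity by a `δ L`-Lipschitz map,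
hence expands distances by at least `1 - δ L`. Fubini then ignores the jump of the field in the
position. -/
theorem volume_kick_preimage_le {F : ℝ × ℝ × Z → ℝ × Z} {L : ℝ≥0} (hL : LipschitzWith L F)
    {δ : ℝ} (hδ : 0 ≤ δ) (hδL : δ * L < 1) {V : Set (ℝ × ℝ × Z)} (hV : MeasurableSet V) :
    volume ((fun x : ℝ × ℝ × Z => (x.1, x.2 + δ • foldField F x)) ⁻¹' V) ≤
      ENNReal.ofReal (1 - δ * L)⁻¹ ^ Module.finrank ℝ (ℝ × Z) * volume V := by
  rw [Measure.volume_eq_prod, Measure.prod_apply (measurable_kick hL.continuous δ hV),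
    Measure.prod_apply hV, ← lintegral_const_mul _ (measurable_measure_prodMk_left hV)]
  refine lintegral_mono fun h => ?_
  have hpos : 0 < 1 - δ * L := by linarith
  have hanti : AntilipschitzWith (Real.toNNReal (1 - δ * L)⁻¹)
      fun w : ℝ × Z => w + δ • foldField F (h, w) := by
    refine AntilipschitzWith.of_le_mul_dist fun w w' => ?_
    rw [Real.coe_toNNReal _ (inv_nonneg.2 hpos.le), inv_mul_eq_div, le_div_iff₀ hpos, dist_eq_norm,
      dist_eq_norm]
    have h1 : ‖w - w'‖ ≤ ‖w + δ • foldField F (h, w) - (w' + δ • foldField F (h, w'))‖ +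
        ‖δ • (foldField F (h, w) - foldField F (h, w'))‖ := by
      have : w - w' = (w + δ • foldField F (h, w) - (w' + δ • foldField F (h, w'))) -
        δ • (foldField F (h, w) - foldField F (h, w')) := by rw [smul_sub]; abel
      conv_lhs => rw [this]
      exact norm_sub_le _ _
    rw [norm_smul, Real.norm_of_nonneg hδ] at h1
    have h2 := mul_le_mul_of_nonneg_left (norm_foldField_sub_le hL h w w') hδ
    nlinarith
  exact hanti.addHaar_preimage_le volume (Prod.mk h ⁻¹' V)

theorem volume_eulerStep_preimage_le {F : ℝ × ℝ × Z → ℝ × Z} {L : ℝ≥0} (hL : LipschitzWith L F)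
    (U : ℝ) {δ : ℝ} (hδ : 0 ≤ δ) (hδL : δ * L < 1) {V : Set (ℝ × ℝ × Z)} (hV : MeasurableSet V) :
    volume (eulerStep F U δ ⁻¹' V) ≤
      ENNReal.ofReal (1 - δ * L)⁻¹ ^ Module.finrank ℝ (ℝ × Z) * volume V := by
  rw [eulerStep_eq, preimage_comp, volume_shear_preimage U δ (measurable_kick hL.continuous δ hV)]
  exact volume_kick_preimage_le hL hδ hδL hV

theorem volume_iterate_eulerStep_preimage_le {F : ℝ × ℝ × Z → ℝ × Z} {L : ℝ≥0}
    (hL : LipschitzWith L F) (U : ℝ) {δ : ℝ} (hδ : 0 ≤ δ) (hδL : δ * L < 1) (N : ℕ)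
    {V : Set (ℝ × ℝ × Z)} (hV : MeasurableSet V) :
    volume ((eulerStep F U δ)^[N] ⁻¹' V) ≤
      (ENNReal.ofReal (1 - δ * L)⁻¹ ^ Module.finrank ℝ (ℝ × Z)) ^ N * volume V := by
  induction N with
  | zero => simp
  | succ N ih =>
    rw [Function.iterate_succ, preimage_comp]
    refine (volume_eulerStep_preimage_le hL U hδ hδL
      ((measurable_eulerStep hL.continuous U δ).iterate N hV)).trans ?_
    rw [pow_succ', mul_assoc]
    gcongr

/-- The bound depends on the number of steps only through the elapsed time `N δ`, so it survives the
limit `δ → 0`. -/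
theorem volume_iterate_eulerStep_preimage_le_exp {F : ℝ × ℝ × Z → ℝ × Z} {L : ℝ≥0}
    (hL : LipschitzWith L F) (U : ℝ) {δ : ℝ} (hδ : 0 ≤ δ) (hδL : δ * L ≤ 1 / 2) (N : ℕ)
    {V : Set (ℝ × ℝ × Z)} (hV : MeasurableSet V) :
    volume ((eulerStep F U δ)^[N] ⁻¹' V) ≤
      ENNReal.ofReal (Real.exp (2 * Module.finrank ℝ (ℝ × Z) * L * (N * δ))) * volume V := by
  refine (volume_iterate_eulerStep_preimage_le hL U hδ (by linarith) N hV).trans ?_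
  gcongr
  have hpos : 0 < 1 - δ * L := by linarith
  have h1 : (1 - δ * L)⁻¹ ≤ Real.exp (2 * (δ * L)) := by
    have h2 : (1 - δ * L)⁻¹ ≤ 2 * (δ * L) + 1 := by
      rw [inv_le_iff_one_le_mul₀ hpos]
      have : 0 ≤ δ * L := by positivity
      nlinarith
    exact h2.trans (Real.add_one_le_exp _)
  rw [← pow_mul, ← ENNReal.ofReal_pow (inv_nonneg.2 hpos.le)]
  refine ENNReal.ofReal_le_ofReal ?_
  calc ((1 - δ * L)⁻¹) ^ (Module.finrank ℝ (ℝ × Z) * N)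
      ≤ Real.exp (2 * (δ * L)) ^ (Module.finrank ℝ (ℝ × Z) * N) := by
        gcongr
    _ = _ := by
        rw [← Real.exp_nat_mul]
        congr 1
        push_cast
        ring

end Measure

end Scheme

/-! ### Convergence of the scheme on one piece of motion between impacts. -/

section Convergence

variable {Z : Type*} [NormedAddCommGroup Z] [NormedSpace ℝ Z]

/-- The vector field whose position component is the (truncated) normal velocity. -/
def fullField (F : ℝ × ℝ × Z → ℝ × Z) (U : ℝ) (x : ℝ × ℝ × Z) : ℝ × ℝ × Z := (clamp U x.2.1, F x)

theorem norm_fullField_le {F : ℝ × ℝ × Z → ℝ × Z} {U B : ℝ} (hU : 0 ≤ U) (hB : ∀ x, ‖F x‖ ≤ B)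
    (x : ℝ × ℝ × Z) : ‖fullField F U x‖ ≤ max U B :=
  max_le_max (abs_clamp_le hU _) (hB _)

theorem norm_fullField_sub_le {F : ℝ × ℝ × Z → ℝ × Z} {L : ℝ≥0} (hL : LipschitzWith L F)
    (U : ℝ) (x y : ℝ × ℝ × Z) :
    ‖fullField F U x - fullField F U y‖ ≤ max 1 (L : ℝ) * ‖x - y‖ := by
  change max |clamp U x.2.1 - clamp U y.2.1| ‖F x - F y‖ ≤ _
  refine max_le ?_ ?_
  · calc _ ≤ |x.2.1 - y.2.1| := abs_clamp_sub_le _ _ _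
      _ ≤ ‖x.2 - y.2‖ := norm_fst_le (x.2 - y.2)
      _ ≤ ‖x - y‖ := norm_snd_le (x - y)
      _ ≤ _ := le_mul_of_one_le_left (norm_nonneg _) (le_max_left _ _)
  · exact (hL.norm_sub_le _ _).trans (by gcongr; exact le_max_right _ _)

theorem norm_sub_le_of_hasDerivAt_fullField {F : ℝ × ℝ × Z → ℝ × Z} {U B : ℝ} (hU : 0 ≤ U)
    (hB : ∀ x, ‖F x‖ ≤ B) {c : ℝ → ℝ × ℝ × Z} {t δ : ℝ}
    (hc : ∀ r ∈ Icc t (t + δ), HasDerivAt c (fullField F U (c r)) r) :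
    ∀ r ∈ Icc t (t + δ), ‖c r - c t‖ ≤ max U B * (r - t) :=
  norm_image_sub_le_of_norm_deriv_right_le_segment
    (fun r hr => (hc r hr).continuousAt.continuousWithinAt)
    (fun r hr => (hc r ⟨hr.1, hr.2.le⟩).hasDerivWithinAt)
    (fun _ _ => norm_fullField_le hU hB _)

/-- The one-step consistency error: the field varies by `O(δ)` along a solution of bounded speed. -/
theorem norm_sub_sub_smul_le {F : ℝ × ℝ × Z → ℝ × Z} {L : ℝ≥0} (hL : LipschitzWith L F)
    {U B : ℝ} (hU : 0 ≤ U) (hB : ∀ x, ‖F x‖ ≤ B) {c : ℝ → ℝ × ℝ × Z} {t δ : ℝ} (hδ : 0 ≤ δ)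
    (hc : ∀ r ∈ Icc t (t + δ), HasDerivAt c (fullField F U (c r)) r) :
    ‖c (t + δ) - c t - δ • fullField F U (c t)‖ ≤ max 1 (L : ℝ) * max U B * δ ^ 2 := by
  have hd : ∀ r ∈ Icc t (t + δ), HasDerivAt (fun r => c r - (r - t) • fullField F U (c t))
      (fullField F U (c r) - fullField F U (c t)) r := by
    intro r hr
    have h1 : HasDerivAt (fun r : ℝ => (r - t) • fullField F U (c t))
        ((1 : ℝ) • fullField F U (c t)) r :=
      ((hasDerivAt_id r).sub_const t).smul_const _
    rw [one_smul] at h1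
    exact (hc r hr).sub h1
  have h := norm_image_sub_le_of_norm_deriv_right_le_segment
    (C := max 1 (L : ℝ) * max U B * δ)
    (fun r hr => (hd r hr).continuousAt.continuousWithinAt)
    (fun r hr => (hd r ⟨hr.1, hr.2.le⟩).hasDerivWithinAt)
    (fun r hr => by
      refine (norm_fullField_sub_le hL U _ _).trans ?_
      rw [mul_assoc]
      gcongr
      refine (norm_sub_le_of_hasDerivAt_fullField hU hB hc r ⟨hr.1, hr.2.le⟩).trans ?_
      gcongr
      linarith [hr.2])
    (t + δ) ⟨by linarith, le_rfl⟩
  have e1 : c (t + δ) - (t + δ - t) • fullField F U (c t) - (c t - (t - t) • fullField F U (c t)) =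
      c (t + δ) - c t - δ • fullField F U (c t) := by
    simp only [sub_self, zero_smul, sub_zero, add_sub_cancel_left]; abel
  rw [e1] at h
  refine h.trans (le_of_eq ?_)
  ring

/-- One step of the scheme, compared with a solution of the unreflected equation. -/
theorem norm_eulerStep_sub_solution_le {F : ℝ × ℝ × Z → ℝ × Z} {L : ℝ≥0} (hL : LipschitzWith L F)
    {U B : ℝ} (hU : 0 ≤ U) (hB : ∀ x, ‖F x‖ ≤ B) {c : ℝ → ℝ × ℝ × Z} {t δ : ℝ} (hδ : 0 ≤ δ)
    (hc : ∀ r ∈ Icc t (t + δ), HasDerivAt c (fullField F U (c r)) r) (x : ℝ × ℝ × Z) :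
    ‖eulerStep F U δ x - c (t + δ)‖ ≤ (1 + max 1 (L : ℝ) * δ) * ‖x - c t‖ +
      2 * (max 1 (L : ℝ) * max U B) * δ ^ 2 +
      if 0 < (eulerStep F U δ x).1 then 0 else 2 * max U B * δ := by
  set y : ℝ × ℝ × Z := (x.1 + δ * clamp U x.2.1, x.2) with hy
  set e := ‖x - c t‖ with he
  set K := max 1 (L : ℝ) with hK
  set M := max U B with hM
  have hK0 : 0 ≤ K := zero_le_one.trans (le_max_left _ _)
  have hM0 : 0 ≤ M := hU.trans (le_max_left _ _)
  have hBM : B ≤ M := le_max_right _ _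
  have he0 : 0 ≤ e := norm_nonneg _
  have hyx : ‖y - x‖ ≤ δ * M := by
    have : y - x = (δ * clamp U x.2.1, (0 : ℝ × Z)) := by ext <;> simp [hy]
    rw [this, Prod.norm_mk, norm_zero, max_eq_left (norm_nonneg _), norm_mul,
      Real.norm_of_nonneg hδ]
    gcongr
    exact (abs_clamp_le hU _).trans (le_max_left _ _)
  -- On the positive side the unfolded field is `F`, and the error is Lipschitz. Elsewhere it may be
  -- the reflected field, and only the trivial bound `2 M` is available; this is the `if` term of
  -- the statement.
  have hfield : ‖foldField F y - F (c t)‖ ≤ K * (e + δ * M) +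
      if 0 < (eulerStep F U δ x).1 then 0 else 2 * M := by
    have hpos : 0 ≤ K * (e + δ * M) := by positivity
    split_ifs with h
    · have h' : 0 < y.1 := h
      have : foldField F y = F y := by simp [foldField, h']
      rw [this, add_zero]
      refine (hL.norm_sub_le _ _).trans ?_
      gcongr
      · exact le_max_right _ _
      · calc ‖y - c t‖ ≤ ‖y - x‖ + ‖x - c t‖ := norm_sub_le_norm_sub_add_norm_sub _ _ _
          _ ≤ _ := by linarith
    · calc _ ≤ ‖foldField F y‖ + ‖F (c t)‖ := norm_sub_le _ _
        _ ≤ B + B := add_le_add (norm_foldField_le hB _) (hB _)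
        _ ≤ _ := by linarith
  have hmain : ‖eulerStep F U δ x - c t - δ • fullField F U (c t)‖ ≤
      e + δ * (K * (e + δ * M) + if 0 < (eulerStep F U δ x).1 then 0 else 2 * M) := by
    have hi : 0 ≤ (if 0 < (eulerStep F U δ x).1 then 0 else 2 * M) := by split_ifs <;> positivity
    have : eulerStep F U δ x - c t - δ • fullField F U (c t) =
        (x - c t) + δ • (clamp U x.2.1 - clamp U (c t).2.1, foldField F y - F (c t)) := by
      refine Prod.ext ?_ (Prod.ext ?_ ?_) <;>
        simp only [eulerStep, fullField, hy, mul_sub, smul_sub, Prod.fst_sub, Prod.snd_sub,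
          Prod.fst_add, Prod.snd_add, Prod.smul_fst, Prod.smul_snd, smul_eq_mul] <;> abel
    rw [this]
    refine (norm_add_le _ _).trans ?_
    rw [norm_smul, Real.norm_of_nonneg hδ]
    gcongr
    refine max_le ?_ hfield
    have h1 : |clamp U x.2.1 - clamp U (c t).2.1| ≤ e :=
      (abs_clamp_sub_le _ _ _).trans
        ((norm_fst_le (x.2 - (c t).2)).trans (norm_snd_le (x - c t)))
    have h2 : e ≤ K * e := le_mul_of_one_le_left he0 (le_max_left _ _)
    have h3 : 0 ≤ K * (δ * M) := by positivity
    calc _ ≤ e := h1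
      _ ≤ _ := by linarith
  have hcons := norm_sub_sub_smul_le hL hU hB hδ hc
  have : eulerStep F U δ x - c (t + δ) = (eulerStep F U δ x - c t - δ • fullField F U (c t)) -
      (c (t + δ) - c t - δ • fullField F U (c t)) := by abel
  rw [this]
  refine (norm_sub_le _ _).trans ((add_le_add hmain hcons).trans (le_of_eq ?_))
  split_ifs <;> ring

/-- A discrete Gronwall inequality. -/
theorem le_geom_of_le_mul_add {Φ : ℕ → ℝ} {a b : ℝ} (ha : 0 ≤ a) (hb : 0 ≤ b) {N : ℕ}
    (h : ∀ k < N, Φ (k + 1) ≤ (1 + a) * Φ k + b) :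
    ∀ k ≤ N, Φ k ≤ (1 + a) ^ k * (Φ 0 + k * b) := by
  intro k
  induction k with
  | zero => intro _; simp
  | succ k ih =>
    intro hk
    have h1 : 1 ≤ (1 + a) ^ (k + 1) := one_le_pow₀ (by linarith)
    calc Φ (k + 1) ≤ (1 + a) * Φ k + b := h k (by omega)
      _ ≤ (1 + a) * ((1 + a) ^ k * (Φ 0 + k * b)) + (1 + a) ^ (k + 1) * b := by
          gcongr
          · exact ih (by omega)
          · exact le_mul_of_one_le_left hb h1
      _ = _ := by push_cast; ring

/-- A start at the boundary may be approximated by points with `h < 0`, where the scheme uses the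
wrong field. Because the normal velocity there is bounded below, the scheme soon crosses to `h > 0`.
The accumulated error is absorbed by adding to the distance the penalty `A max(0, -h)`. -/
theorem exists_eulerStep_convergence {F : ℝ × ℝ × Z → ℝ × Z} {L : ℝ≥0} (hL : LipschitzWith L F)
    {U B : ℝ} (hU : 0 < U) (hB : ∀ x, ‖F x‖ ≤ B) {c : ℝ → ℝ × ℝ × Z} {s η : ℝ} (hη : 0 < η)
    (hc : ∀ r ∈ Ico s (s + η), HasDerivAt c (fullField F U (c r)) r)
    (h0 : 0 < (c s).1 ∨ (c s).1 = 0 ∧ 0 < (c s).2.1) :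
    ∃ η' > 0, η' < η ∧ ∀ ε > 0, ∃ δ₀ > 0, ∃ ε' > 0, ∀ δ, 0 < δ → δ < δ₀ →
      ∀ x, ‖x - c s‖ < ε' → ∀ k : ℕ, k * δ ≤ η' →
        ‖(eulerStep F U δ)^[k] x - c (s + k * δ)‖ < ε := by
  set K := max 1 (L : ℝ) with hK
  set M := max U B with hM
  have hK0 : 0 < K := zero_lt_one.trans_le (le_max_left _ _)
  have hM0 : 0 < M := hU.trans_le (le_max_left _ _)
  obtain ⟨ν, hν, ρ, hρ, hgood⟩ : ∃ ν > 0, ∃ ρ > 0, (∀ y : ℝ × ℝ × Z, ‖y - c s‖ < ρ → 0 < y.1) ∨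
      (∀ y : ℝ × ℝ × Z, ‖y - c s‖ < ρ → ν ≤ clamp U y.2.1) := by
    rcases h0 with h | ⟨-, h⟩
    · refine ⟨1, one_pos, (c s).1, h, Or.inl fun y hy => ?_⟩
      have := (norm_fst_le (y - c s)).trans_lt hy
      rw [Prod.fst_sub, Real.norm_eq_abs, abs_lt] at this
      linarith
    · refine ⟨min U ((c s).2.1 / 2), by positivity, (c s).2.1 / 2, by positivity,
        Or.inr fun y hy => ?_⟩
      have := (norm_fst_le (y - c s).2).trans_lt ((norm_snd_le (y - c s)).trans_lt hy)
      rw [Prod.snd_sub, Prod.fst_sub, Real.norm_eq_abs, abs_lt] at this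
      exact (min_le_min_left U (by linarith)).trans (le_max_right _ _)
  have hh0 : 0 ≤ (c s).1 := by rcases h0 with h | ⟨h, -⟩ <;> linarith
  set A := 2 * M / ν with hA
  have hA0 : 0 < A := by positivity
  -- The bound `1` keeps the Gronwall factor below `exp K`; the bound `ρ / (2 M)` keeps the scheme,
  -- whose speed is at most `M`, in the ball where the alternative `hgood` holds. The two constants
  -- below each give half of `ε` after Gronwall.
  refine ⟨min (η / 2) (min 1 (ρ / (2 * M))), by positivity,
    (min_le_left _ _).trans_lt (by linarith), fun ε hε => ?_⟩
  refine ⟨ε / (2 * (Real.exp K * (2 * (K * M)))), by positivity,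
    min (ρ / 2) (ε / (2 * (Real.exp K * (1 + A)))), by positivity, ?_⟩
  intro δ hδ hδ₀ x hx k hk
  have hkη : k * δ ≤ η / 2 := hk.trans (min_le_left _ _)
  have hk1 : k * δ ≤ 1 := hk.trans ((min_le_right _ _).trans (min_le_left _ _))
  have hkρ : k * δ ≤ ρ / (2 * M) := hk.trans ((min_le_right _ _).trans (min_le_right _ _))
  have hxρ : ‖x - c s‖ < ρ / 2 := hx.trans_le (min_le_left _ _)
  have hxε : ‖x - c s‖ < ε / (2 * (Real.exp K * (1 + A))) := hx.trans_le (min_le_right _ _)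
  have hnear : ∀ j ≤ k, ‖(eulerStep F U δ)^[j] x - c s‖ < ρ := by
    intro j hj
    have h1 := norm_iterate_eulerStep_sub_le hB hU.le hδ.le j x
    have h2 : M * (j * δ) ≤ ρ / 2 := by
      have : (j : ℝ) * δ ≤ ρ / (2 * M) := le_trans (by gcongr) hkρ
      calc M * (j * δ) ≤ M * (ρ / (2 * M)) := by gcongr
        _ = ρ / 2 := by field_simp
    calc _ ≤ ‖(eulerStep F U δ)^[j] x - x‖ + ‖x - c s‖ := norm_sub_le_norm_sub_add_norm_sub _ _ _
      _ < ρ := by linarith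
  let Φ : ℕ → ℝ := fun j => ‖(eulerStep F U δ)^[j] x - c (s + j * δ)‖ +
    A * max 0 (-((eulerStep F U δ)^[j] x).1)
  have hrec : ∀ j < k, Φ (j + 1) ≤ (1 + K * δ) * Φ j + 2 * (K * M) * δ ^ 2 := by
    intro j hj
    have hjk : ((j : ℝ) + 1) * δ ≤ k * δ := by
      have : (j : ℝ) + 1 ≤ k := by exact_mod_cast hj
      gcongr
    have hstep := norm_eulerStep_sub_solution_le hL hU.le hB (c := c) (t := s + j * δ) hδ.le
      (fun r hr => hc r ⟨le_trans (by nlinarith [hr.1]) hr.1, by nlinarith [hr.2]⟩)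
      ((eulerStep F U δ)^[j] x)
    have e1 : s + j * δ + δ = s + ((j + 1 : ℕ) : ℝ) * δ := by push_cast; ring
    rw [e1, ← Function.iterate_succ_apply' (eulerStep F U δ) j x, ← hK, ← hM] at hstep
    have hfst : ((eulerStep F U δ)^[j + 1] x).1 = ((eulerStep F U δ)^[j] x).1 +
        δ * clamp U ((eulerStep F U δ)^[j] x).2.1 := by
      rw [Function.iterate_succ_apply']; rfl
    have hm0 : 0 ≤ A * max 0 (-((eulerStep F U δ)^[j] x).1) :=
      mul_nonneg hA0.le (le_max_left _ _)
    have hm1 : 0 ≤ K * δ * (A * max 0 (-((eulerStep F U δ)^[j] x).1)) := by positivity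
    change _ + A * max 0 (-((eulerStep F U δ)^[j + 1] x).1) ≤ (1 + K * δ) * (_ + _) + _
    by_cases hpos : 0 < ((eulerStep F U δ)^[j + 1] x).1
    · rw [if_pos hpos] at hstep
      rw [max_eq_left (by linarith)]
      linarith
    · rw [if_neg hpos] at hstep
      rcases hgood with hg | hg
      · exact absurd (hg _ (hnear (j + 1) hj)) hpos
      · have hcl := hg _ (hnear j hj.le)
        -- A step that still ends at `h ≤ 0` costs `2 M δ` in the distance, but raises `h` by at
        -- least `ν δ`; `A` is chosen so that the penalty decreases by exactly that cost.
        have hAν : A * ν = 2 * M := by rw [hA]; field_simp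
        push Not at hpos
        rw [max_eq_right (by linarith)]
        have h3 : -((eulerStep F U δ)^[j] x).1 ≤ max 0 (-((eulerStep F U δ)^[j] x).1) :=
          le_max_right _ _
        have h4 : A * -((eulerStep F U δ)^[j + 1] x).1 ≤
            A * max 0 (-((eulerStep F U δ)^[j] x).1) - 2 * M * δ := by
          rw [← hAν, hfst]
          nlinarith [mul_le_mul_of_nonneg_left hcl (mul_nonneg hA0.le hδ.le),
            mul_le_mul_of_nonneg_left h3 hA0.le]
        linarith
  have hΦ0 : Φ 0 ≤ (1 + A) * ‖x - c s‖ := by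
    have h5 : max 0 (-x.1) ≤ ‖x - c s‖ := by
      refine max_le (norm_nonneg _) ?_
      have := norm_fst_le (x - c s)
      rw [Prod.fst_sub, Real.norm_eq_abs, abs_le] at this
      linarith [this.1]
    have : Φ 0 = ‖x - c s‖ + A * max 0 (-x.1) := by simp [Φ]
    rw [this]
    nlinarith [mul_le_mul_of_nonneg_left h5 hA0.le]
  have hfin := le_geom_of_le_mul_add (Φ := Φ) (a := K * δ) (b := 2 * (K * M) * δ ^ 2)
    (by positivity) (by positivity) hrec k le_rfl
  have hexp : (1 + K * δ) ^ k ≤ Real.exp K := by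
    calc (1 + K * δ) ^ k ≤ Real.exp (K * δ) ^ k := by
          gcongr
          linarith [Real.add_one_le_exp (K * δ)]
      _ = Real.exp (K * (k * δ)) := by rw [← Real.exp_nat_mul]; congr 1; ring
      _ ≤ Real.exp K := by
          gcongr
          exact mul_le_of_le_one_right hK0.le hk1
  have hle : ‖(eulerStep F U δ)^[k] x - c (s + k * δ)‖ ≤ Φ k :=
    le_add_of_nonneg_right (mul_nonneg hA0.le (le_max_left _ _))
  have hΦnn : 0 ≤ Φ 0 := add_nonneg (norm_nonneg _) (mul_nonneg hA0.le (le_max_left _ _))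
  have hsmall : (k : ℝ) * (2 * (K * M) * δ ^ 2) ≤ 2 * (K * M) * δ := by
    have : (k : ℝ) * (2 * (K * M) * δ ^ 2) = (k * δ) * (2 * (K * M) * δ) := by ring
    rw [this]
    exact mul_le_of_le_one_left (by positivity) hk1
  have hE : 0 < Real.exp K := Real.exp_pos _
  calc _ ≤ Φ k := hle
    _ ≤ (1 + K * δ) ^ k * (Φ 0 + k * (2 * (K * M) * δ ^ 2)) := hfin
    _ ≤ Real.exp K * ((1 + A) * ‖x - c s‖ + 2 * (K * M) * δ) := by gcongr
    _ = Real.exp K * (1 + A) * ‖x - c s‖ + Real.exp K * (2 * (K * M)) * δ := by ring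
    _ < ε / 2 + ε / 2 := by
        refine add_lt_add ?_ ?_
        · rw [lt_div_iff₀ (by positivity)] at hxε
          linarith
        · rw [lt_div_iff₀ (by positivity)] at hδ₀
          linarith
    _ = ε := by ring

end Convergence

/-! ### Reflected motions: approximation by the scheme and a priori bounds. -/

section Motion

variable {Z : Type*} [NormedAddCommGroup Z] [NormedSpace ℝ Z]

open Classical in
/-- The elastic impact map in adapted coordinates. -/
def resetCoord (x : ℝ × ℝ × Z) : ℝ × ℝ × Z :=
  if x.1 = 0 ∧ x.2.1 < 0 then (x.1, flip x.2) else x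

theorem resetCoord_eq_or (x : ℝ × ℝ × Z) : resetCoord x = x ∨ resetCoord x = reflect x := by
  unfold resetCoord
  split_ifs with h
  · right; simp [reflect, h.1]
  · left; rfl

theorem resetCoord_fst (x : ℝ × ℝ × Z) : (resetCoord x).1 = x.1 := by
  unfold resetCoord; split_ifs <;> rfl

theorem resetCoord_abs (x : ℝ × ℝ × Z) : |(resetCoord x).2.1| = |x.2.1| := by
  unfold resetCoord; split_ifs <;> simp [flip]

theorem resetCoord_snd_snd (x : ℝ × ℝ × Z) : (resetCoord x).2.2 = x.2.2 := by
  unfold resetCoord; split_ifs <;> simp [flip]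

/-- A motion on `[0, T)` which follows the field, is reflected at `x.1 = 0`, stays in the
half-space `0 ≤ x.1`, and has no grazing. -/
structure IsReflectedMotion (F : ℝ × ℝ × Z → ℝ × Z) (U : ℝ) (x : ℝ → ℝ × ℝ × Z) (T : ℝ) :
    Prop where
  left : ∀ s ∈ Ioo 0 T, ContinuousWithinAt x (Iio s) s
  right : ∀ s ∈ Ico 0 T, ∃ ε > 0, ∃ c : ℝ → ℝ × ℝ × Z,
    (∀ t ∈ Ico s (s + ε), HasDerivAt c (fullField F U (c t)) t) ∧ c s = resetCoord (x s) ∧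
      ∀ t ∈ Ioo s (s + ε), t < T → x t = c t
  nonneg : ∀ s ∈ Ico 0 T, 0 ≤ (x s).1
  regular : ∀ s ∈ Ico 0 T, (x s).1 = 0 → (x s).2.1 ≠ 0

/-- After the reset the motion starts inside the half-space or points into it, which is the
hypothesis of `exists_eulerStep_convergence`. -/
theorem IsReflectedMotion.reset_pos {F : ℝ × ℝ × Z → ℝ × Z} {U : ℝ} {x : ℝ → ℝ × ℝ × Z} {T s : ℝ}
    (hx : IsReflectedMotion F U x T) (hs : s ∈ Ico 0 T) :
    0 < (resetCoord (x s)).1 ∨ (resetCoord (x s)).1 = 0 ∧ 0 < (resetCoord (x s)).2.1 := by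
  rw [resetCoord_fst]
  rcases (hx.nonneg s hs).eq_or_lt with h | h
  · right
    refine ⟨h.symm, ?_⟩
    have h1 := hx.regular s hs h.symm
    unfold resetCoord
    rcases h1.lt_or_gt with h2 | h2
    · rw [if_pos ⟨h.symm, h2⟩]; simpa [flip] using h2
    · rw [if_neg (by simp [h2.le])]; exact h2
  · exact Or.inl h

/-- The scheme converges, up to the reflection, to every reflected motion. -/
theorem IsReflectedMotion.eulerStep_convergence {F : ℝ × ℝ × Z → ℝ × Z} {L : ℝ≥0}
    (hL : LipschitzWith L F) {U B : ℝ} (hU : 0 < U) (hB : ∀ x, ‖F x‖ ≤ B) {x : ℝ → ℝ × ℝ × Z}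
    {T r : ℝ} (hx : IsReflectedMotion F U x T) (hrT : r < T) :
    ∀ s ∈ Icc 0 r, ∀ ε > 0, ∃ δ₀ > 0, ∃ ρ > 0, ∀ δ, 0 < δ → δ < δ₀ → ∀ k : ℕ, |k * δ - s| < ρ →
      ‖(eulerStep F U δ)^[k] (x 0) - x s‖ < ε ∨
        ‖reflect ((eulerStep F U δ)^[k] (x 0)) - x s‖ < ε := by
  have hM0 : 0 < max U B := hU.trans_le (le_max_left _ _)
  have hMle : ∀ (δ : ℝ), 0 < δ → ∀ (k : ℕ) (y : ℝ × ℝ × Z),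
      ‖(eulerStep F U δ)^[k] y - y‖ ≤ max U B * (k * δ) := fun δ hδ k y =>
    norm_iterate_eulerStep_sub_le hB hU.le hδ.le k y
  generalize hM : max U B = M at hM0 hMle
  have hfloor : ∀ (δ : ℝ), 0 < δ → ∀ t, 0 ≤ t → ∃ j : ℕ, j * δ ≤ t ∧ t < j * δ + δ := by
    intro δ hδ t ht
    refine ⟨⌊t / δ⌋₊, ?_, ?_⟩
    · rw [← le_div_iff₀ hδ]; exact Nat.floor_le (by positivity)
    · have := Nat.lt_floor_add_one (t / δ)
      rw [div_lt_iff₀ hδ] at this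
      linarith
  have hle : ∀ (δ : ℝ), 0 < δ → ∀ j k : ℕ, (j : ℝ) * δ ≤ k * δ → j ≤ k := by
    intro δ hδ j k h
    exact_mod_cast le_of_mul_le_mul_right h hδ
  refine continuous_induction ?_ ?_ ?_
  · intro ε hε
    refine ⟨1, one_pos, ε / M, by positivity, fun δ hδ _ k hk => Or.inl ?_⟩
    rw [sub_zero, abs_of_nonneg (by positivity), lt_div_iff₀ hM0] at hk
    exact (hMle δ hδ k _).trans_lt (by linarith)
  · intro s hs ih ε hε
    obtain ⟨η, hη, hcont⟩ := Metric.continuousWithinAt_iff.1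
      (hx.left s ⟨hs.1, hs.2.trans_lt hrT⟩) (ε / 3) (by positivity)
    -- The approximation at time `s` is inherited from the earlier time `s - κ`: left continuity
    -- moves `x` by less than `ε / 3`, and the scheme moves by at most `2 κ M ≤ ε / 6`.
    set κ := min (η / 2) (min (s / 2) (ε / (12 * M))) with hκ
    have hs0 : 0 < s := hs.1
    have hκ0 : 0 < κ := by positivity
    have hκη : κ ≤ η / 2 := min_le_left _ _
    have hκs : κ ≤ s / 2 := (min_le_right _ _).trans (min_le_left _ _)
    have hκε : κ ≤ ε / (12 * M) := (min_le_right _ _).trans (min_le_right _ _)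
    have hxt : ‖x (s - κ) - x s‖ < ε / 3 := by
      rw [← dist_eq_norm]
      refine hcont (by simpa using hκ0) ?_
      rw [Real.dist_eq, abs_lt]; constructor <;> linarith
    obtain ⟨δ₁, hδ₁, ρ₁, hρ₁, h⟩ := ih (s - κ) ⟨by linarith, by linarith⟩ (ε / 3) (by positivity)
    refine ⟨min δ₁ (min ρ₁ (κ / 4)), by positivity, κ / 4, by positivity, fun δ hδ hδ₀ k hk => ?_⟩
    obtain ⟨hd1, hd2, hd3⟩ : δ < δ₁ ∧ δ < ρ₁ ∧ δ < κ / 4 := by simpa using hδ₀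
    obtain ⟨j, hj1, hj2⟩ := hfloor δ hδ (s - κ) (by linarith)
    rw [abs_lt] at hk
    have hjk : j ≤ k := hle δ hδ j k (by linarith)
    obtain ⟨i, rfl⟩ := Nat.exists_eq_add_of_le' hjk
    have hmove : ‖(eulerStep F U δ)^[i + j] (x 0) - (eulerStep F U δ)^[j] (x 0)‖ < ε / 3 := by
      rw [Function.iterate_add_apply]
      refine (hMle δ hδ i _).trans_lt ?_
      push_cast at hk
      have h1 : (i : ℝ) * δ ≤ 2 * κ := by linarith
      have h2 : M * (2 * κ) ≤ M * (2 * (ε / (12 * M))) := by gcongr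
      have h3 : M * (2 * (ε / (12 * M))) = ε / 6 := by field_simp; norm_num
      have h4 : M * (i * δ) ≤ M * (2 * κ) := by gcongr
      linarith
    rcases h δ hδ hd1 j (by rw [abs_lt]; constructor <;> linarith) with h | h
    · left
      calc _ ≤ ‖(eulerStep F U δ)^[i + j] (x 0) - (eulerStep F U δ)^[j] (x 0)‖ +
            ‖(eulerStep F U δ)^[j] (x 0) - x (s - κ)‖ + ‖x (s - κ) - x s‖ := by
              refine (norm_sub_le_norm_sub_add_norm_sub _ (x (s - κ)) _).trans ?_
              gcongr
              exact norm_sub_le_norm_sub_add_norm_sub _ _ _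
        _ < ε := by linarith
    · right
      rw [← norm_reflect_sub] at hmove
      calc _ ≤ ‖reflect ((eulerStep F U δ)^[i + j] (x 0)) - reflect ((eulerStep F U δ)^[j] (x 0))‖ +
            ‖reflect ((eulerStep F U δ)^[j] (x 0)) - x (s - κ)‖ + ‖x (s - κ) - x s‖ := by
              refine (norm_sub_le_norm_sub_add_norm_sub _ (x (s - κ)) _).trans ?_
              gcongr
              exact norm_sub_le_norm_sub_add_norm_sub _ _ _
        _ < ε := by linarith
  · intro s hs ih
    have hsT : s ∈ Ico 0 T := ⟨hs.1, hs.2.trans hrT⟩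
    obtain ⟨η, hη, c, hc, hcs, hcx⟩ := hx.right s hsT
    obtain ⟨η', hη', hηη, hconv⟩ := exists_eulerStep_convergence hL hU hB hη hc
      (hcs ▸ hx.reset_pos hsT)
    refine ⟨η', hη', fun t ht htr ε hε => ?_⟩
    obtain ⟨δ₁, hδ₁, ε₁, hε₁, h1⟩ := hconv (ε / 2) (by positivity)
    obtain ⟨δ₂, hδ₂, ρ₂, hρ₂, h2⟩ := ih s ⟨hs.1, le_rfl⟩ ε₁ hε₁
    have ht1 := ht.1
    have ht2 := ht.2
    set κ := min (t - s) (min (s + η' - t) (ε / M)) with hκ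
    have hκ0 : 0 < κ := lt_min (by linarith) (lt_min (by linarith) (by positivity))
    have hκ1 : κ ≤ t - s := min_le_left _ _
    have hκ2 : κ ≤ s + η' - t := (min_le_right _ _).trans (min_le_left _ _)
    have hκ3 : κ ≤ ε / M := (min_le_right _ _).trans (min_le_right _ _)
    refine ⟨min (min δ₁ δ₂) (min ρ₂ (κ / 4)), by positivity, κ / 4, by positivity,
      fun δ hδ hδ₀ k hk => ?_⟩
    obtain ⟨⟨hd1, hd2⟩, hd3, hd4⟩ : (δ < δ₁ ∧ δ < δ₂) ∧ δ < ρ₂ ∧ δ < κ / 4 := by simpa using hδ₀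
    obtain ⟨j, hj1, hj2⟩ := hfloor δ hδ s hs.1
    rw [abs_lt] at hk
    have hjk : j ≤ k := hle δ hδ j k (by linarith)
    obtain ⟨i, rfl⟩ := Nat.exists_eq_add_of_le' hjk
    push_cast at hk
    -- An impact replaces `x s` by its reflection. The scheme does not jump; instead the other of
    -- its two mirror copies is now the one close to the restarted motion.
    obtain ⟨y, hy, hyc⟩ : ∃ y, (y = (eulerStep F U δ)^[j] (x 0) ∨
        y = reflect ((eulerStep F U δ)^[j] (x 0))) ∧ ‖y - c s‖ < ε₁ := by
      have h3 := h2 δ hδ hd2 j (by rw [abs_lt]; constructor <;> linarith)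
      rcases resetCoord_eq_or (x s) with h4 | h4
      · rw [hcs, h4]
        rcases h3 with h3 | h3
        · exact ⟨_, Or.inl rfl, h3⟩
        · exact ⟨_, Or.inr rfl, h3⟩
      · rw [hcs, h4]
        rcases h3 with h3 | h3
        · exact ⟨_, Or.inr rfl, by rwa [norm_reflect_sub]⟩
        · refine ⟨_, Or.inl rfl, ?_⟩
          rwa [← norm_reflect_sub, reflect_reflect]
    have h5 := h1 δ hδ hd1 y hyc i (by linarith)
    have hlip : ‖c (s + i * δ) - c t‖ ≤ ε / 2 := by
      have hi0 : 0 ≤ (i : ℝ) * δ := by positivity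
      have := (convex_Icc s (s + η')).norm_image_sub_le_of_norm_hasDerivWithin_le (f := c)
        (f' := fun r => fullField F U (c r)) (C := M)
        (fun r hr => (hc r ⟨hr.1, by linarith [hr.2]⟩).hasDerivWithinAt)
        (fun r _ => hM ▸ norm_fullField_le hU.le hB _)
        (x := t) (y := s + i * δ) ⟨by linarith, by linarith⟩ ⟨by linarith, by linarith⟩
      refine this.trans ?_
      have habs : ‖s + i * δ - t‖ ≤ κ / 2 := by
        rw [Real.norm_eq_abs, abs_le]; constructor <;> linarith
      calc M * ‖s + i * δ - t‖ ≤ M * (ε / M / 2) := by gcongr; linarith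
        _ = ε / 2 := by field_simp
    have hxt : x t = c t := hcx t ⟨ht1, by linarith⟩ (by linarith)
    have h6 : ‖(eulerStep F U δ)^[i] y - x t‖ < ε := by
      rw [hxt]
      calc _ ≤ ‖(eulerStep F U δ)^[i] y - c (s + i * δ)‖ + ‖c (s + i * δ) - c t‖ :=
            norm_sub_le_norm_sub_add_norm_sub _ _ _
        _ < ε := by linarith
    rw [Function.iterate_add_apply]
    rcases hy with rfl | rfl
    · exact Or.inl h6
    · rw [iterate_eulerStep_reflect F hU.le] at h6
      exact Or.inr h6

/-- Meant for quantities that do not see the impacts (`|u|`, the height, the energy): a local bound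
to the right of every time propagates by continuous induction, even through accumulating jump times.
-/
theorem abs_sub_le_of_right_lipschitz {f : ℝ → ℝ} {a b C : ℝ} (hab : a ≤ b)
    (hleft : ∀ s ∈ Ioc a b, ContinuousWithinAt f (Iio s) s)
    (hright : ∀ s ∈ Ico a b, ∃ ε > 0, ∀ t ∈ Ioo s (s + ε), t ≤ b → |f t - f s| ≤ C * (t - s)) :
    |f b - f a| ≤ C * (b - a) := by
  refine continuous_induction (P := fun t => |f t - f a| ≤ C * (t - a)) (by simp) ?_ ?_ b
    ⟨hab, le_rfl⟩
  · intro s hs ih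
    have h1 : Tendsto (fun t => |f t - f a|) (𝓝[<] s) (𝓝 |f s - f a|) :=
      ((hleft s hs).tendsto.sub_const _).abs
    have h2 : Tendsto (fun t => C * (t - a)) (𝓝[<] s) (𝓝 (C * (s - a))) :=
      tendsto_nhdsWithin_of_tendsto_nhds ((continuous_id.sub continuous_const).const_mul C).continuousAt
    refine le_of_tendsto_of_tendsto h1 h2 ?_
    filter_upwards [Ioo_mem_nhdsLT hs.1] with t ht
    exact ih t ⟨ht.1.le, ht.2⟩
  · intro s hs ih
    obtain ⟨ε, hε, h⟩ := hright s hs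
    refine ⟨ε, hε, fun t ht htb => ?_⟩
    calc |f t - f a| ≤ |f t - f s| + |f s - f a| := abs_sub_le _ _ _
      _ ≤ C * (t - s) + C * (s - a) := add_le_add (h t ht htb) (ih s ⟨hs.1, le_rfl⟩)
      _ = _ := by ring

theorem IsReflectedMotion.abs_normal_velocity_sub_le {F : ℝ × ℝ × Z → ℝ × Z} {U B : ℝ} (hU : 0 < U)
    (hB : ∀ x, ‖F x‖ ≤ B) {x : ℝ → ℝ × ℝ × Z} {T : ℝ} (hx : IsReflectedMotion F U x T) {a b : ℝ}
    (ha : 0 ≤ a) (hab : a ≤ b) (hb : b < T) :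
    |(|(x b).2.1| - |(x a).2.1|)| ≤ max U B * (b - a) := by
  refine abs_sub_le_of_right_lipschitz (f := fun t => |(x t).2.1|) hab ?_ ?_
  · intro s hs
    exact (hx.left s ⟨ha.trans_lt hs.1, hs.2.trans_lt hb⟩).snd.fst.abs
  · intro s hs
    obtain ⟨ε, hε, c, hc, hcs, hcx⟩ := hx.right s ⟨ha.trans hs.1, hs.2.trans hb⟩
    refine ⟨ε, hε, fun t ht htb => ?_⟩
    rw [hcx t ht (htb.trans_lt hb), ← resetCoord_abs (x s), ← hcs]
    have h := norm_sub_le_of_hasDerivAt_fullField hU.le hB (c := c) (t := s) (δ := t - s)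
      (fun r hr => hc r ⟨hr.1, by linarith [hr.2, ht.2]⟩) t ⟨ht.1.le, by linarith⟩
    calc _ ≤ |(c t).2.1 - (c s).2.1| := abs_abs_sub_abs_le_abs_sub _ _
      _ ≤ ‖c t - c s‖ := (norm_fst_le (c t - c s).2).trans (norm_snd_le (c t - c s))
      _ ≤ _ := h

/-- The height moves with the truncated normal velocity, and truncation does not increase absolute
values. -/
theorem IsReflectedMotion.abs_height_sub_le {F : ℝ × ℝ × Z → ℝ × Z} {U C : ℝ} (hU : 0 ≤ U)
    {x : ℝ → ℝ × ℝ × Z} {T : ℝ} (hx : IsReflectedMotion F U x T) {a b : ℝ}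
    (ha : 0 ≤ a) (hab : a ≤ b) (hb : b < T) (hC : ∀ t ∈ Icc a b, |(x t).2.1| ≤ C) :
    |(x b).1 - (x a).1| ≤ C * (b - a) := by
  refine abs_sub_le_of_right_lipschitz (f := fun t => (x t).1) hab ?_ ?_
  · intro s hs
    exact (hx.left s ⟨ha.trans_lt hs.1, hs.2.trans_lt hb⟩).fst
  · intro s hs
    obtain ⟨ε, hε, c, hc, hcs, hcx⟩ := hx.right s ⟨ha.trans hs.1, hs.2.trans hb⟩
    refine ⟨ε, hε, fun t ht htb => ?_⟩
    rw [hcx t ht (htb.trans_lt hb), ← resetCoord_fst (x s), ← hcs]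
    have hcl : ∀ u, |u| ≤ C → |clamp U u| ≤ C := by
      intro u hu
      have h0 : clamp U 0 = 0 := clamp_of_abs_le (by simpa using hU)
      have h := abs_clamp_sub_le U u 0
      rw [h0, sub_zero, sub_zero] at h
      exact h.trans hu
    have hder : ∀ r ∈ Icc s t, HasDerivAt (fun r => (c r).1) (clamp U (c r).2.1) r :=
      fun r hr =>
        (ContinuousLinearMap.fst ℝ ℝ (ℝ × Z)).hasFDerivAt.comp_hasDerivAt r
          (hc r ⟨hr.1, hr.2.trans_lt ht.2⟩)
    refine norm_image_sub_le_of_norm_deriv_right_le_segment (f := fun r => (c r).1)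
      (fun r hr => (hder r hr).continuousAt.continuousWithinAt)
      (fun r hr => (hder r ⟨hr.1, hr.2.le⟩).hasDerivWithinAt)
      (fun r hr => hcl _ ?_) t ⟨ht.1.le, le_rfl⟩
    rcases hr.1.eq_or_lt with h | h
    · rw [← h, hcs, resetCoord_abs]; exact hC s ⟨hs.1, hs.2.le⟩
    · rw [← hcx r ⟨h, hr.2.trans ht.2⟩ (by linarith [hr.2])]
      exact hC r ⟨hs.1.trans h.le, hr.2.le.trans htb⟩

end Motion

/-! ### Pulling sets back along reflected and free motions. -/

section NullSets

variable {Z : Type*} [NormedAddCommGroup Z] [NormedSpace ℝ Z] [FiniteDimensional ℝ Z]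
  [MeasureSpace Z] [BorelSpace Z] [(volume : Measure Z).IsAddHaarMeasure]

/-- The initial states of the reflected motions which are in `A` at time `r`. -/
def reflectedPullback (F : ℝ × ℝ × Z → ℝ × Z) (U r : ℝ) (A : Set (ℝ × ℝ × Z)) :
    Set (ℝ × ℝ × Z) :=
  {y | ∃ x T, IsReflectedMotion F U x T ∧ r < T ∧ x 0 = y ∧ x r ∈ A}

/-- By convergence of the scheme, an initial state in the pullback has its iterates in the open set
`V` for all small steps. So the pullback lies in an increasing union of sets, each contained in a
single preimage of controlled volume; no measurability of the pullback is needed. -/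
theorem volume_reflectedPullback_le_of_isOpen {F : ℝ × ℝ × Z → ℝ × Z} {L : ℝ≥0}
    (hL : LipschitzWith L F) {U B : ℝ} (hU : 0 < U) (hB : ∀ x, ‖F x‖ ≤ B) {r : ℝ} (hr : 0 < r)
    {A V : Set (ℝ × ℝ × Z)} (hV : IsOpen V) (hAV : A ⊆ V) (hAV' : ∀ y ∈ A, reflect y ∈ V) :
    volume (reflectedPullback F U r A) ≤
      ENNReal.ofReal (Real.exp (2 * Module.finrank ℝ (ℝ × Z) * L * r)) * volume V := by
  set C := ENNReal.ofReal (Real.exp (2 * Module.finrank ℝ (ℝ × Z) * L * r)) with hC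
  -- With step `r / (k + 1)`, exactly `k + 1` steps reach time `r`.
  let S : ℕ → Set (ℝ × ℝ × Z) := fun N =>
    ⋂ k ≥ N, (eulerStep F U (r / (k + 1 : ℕ)))^[k + 1] ⁻¹' V
  have hSmono : Monotone S := fun N N' h =>
    biInter_subset_biInter_left fun k (hk : N' ≤ k) => h.trans hk
  have hsub : reflectedPullback F U r A ⊆ ⋃ N, S N := by
    rintro _ ⟨x, T, hx, hrT, rfl, hxA⟩
    obtain ⟨ε₁, hε₁, h1⟩ := Metric.isOpen_iff.1 hV _ (hAV hxA)
    obtain ⟨ε₂, hε₂, h2⟩ := Metric.isOpen_iff.1 hV _ (hAV' _ hxA)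
    obtain ⟨δ₀, hδ₀, ρ, hρ, h⟩ := hx.eulerStep_convergence hL hU hB hrT r ⟨hr.le, le_rfl⟩
      (min ε₁ ε₂) (by positivity)
    obtain ⟨N, hN⟩ := exists_nat_gt (r / δ₀)
    refine mem_iUnion.2 ⟨N, mem_iInter₂.2 fun k hk => ?_⟩
    have hNk : (N : ℝ) ≤ k := by exact_mod_cast hk
    have hk0 : (0 : ℝ) < ((k + 1 : ℕ) : ℝ) := by positivity
    rcases h (r / (k + 1 : ℕ)) (by positivity) (by
        rw [div_lt_iff₀ hk0]
        rw [div_lt_iff₀ hδ₀] at hN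
        push_cast
        nlinarith) (k + 1) (by
        rw [mul_div_cancel₀ _ hk0.ne', sub_self, abs_zero]; exact hρ) with h3 | h3
    · exact h1 (by rw [mem_ball_iff_norm]; exact h3.trans_le (min_le_left _ _))
    · refine h2 ?_
      rw [mem_ball_iff_norm, ← norm_reflect_sub, reflect_reflect]
      exact h3.trans_le (min_le_right _ _)
  refine (measure_mono hsub).trans ?_
  rw [hSmono.measure_iUnion]
  refine iSup_le fun N => ?_
  -- The index `max N K` makes the step small enough for `δ L ≤ 1 / 2`.
  obtain ⟨K, hK⟩ := exists_nat_gt (2 * r * L)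
  have hbound := volume_iterate_eulerStep_preimage_le_exp hL U (δ := r / ((max N K + 1 : ℕ) : ℝ))
    (by positivity) (by
      have h1 : (K : ℝ) ≤ (max N K : ℕ) := by exact_mod_cast le_max_right N K
      rw [div_mul_eq_mul_div, div_le_iff₀ (by positivity)]
      push_cast at h1 ⊢
      linarith) (max N K + 1) hV.measurableSet
  rw [mul_div_cancel₀ _ (by positivity)] at hbound
  exact (measure_mono (biInter_subset_of_mem (le_max_left N K : max N K ≥ N))).trans hbound

instance isAddHaarMeasure_volume_real_real_prod :
    (volume : Measure (ℝ × ℝ × Z)).IsAddHaarMeasure :=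
  inferInstanceAs ((volume : Measure ℝ).prod (volume : Measure (ℝ × Z))).IsAddHaarMeasure

theorem volume_reflect_preimage_le (A : Set (ℝ × ℝ × Z)) : volume (reflect ⁻¹' A) ≤ volume A := by
  have h : AntilipschitzWith 1 (reflect : ℝ × ℝ × Z → ℝ × ℝ × Z) :=
    AntilipschitzWith.of_le_mul_dist fun x y => by
      rw [dist_eq_norm, dist_eq_norm, norm_reflect_sub]; simp
  simpa using h.addHaar_preimage_le volume A

/-- Outer regularity reduces to open neighbourhoods of `A` and its mirror image, whence the factor
`2`. Dividing by the constant `C` allows the infimum over these neighbourhoods to be taken directly.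
-/
theorem volume_reflectedPullback_le {F : ℝ × ℝ × Z → ℝ × Z} {L : ℝ≥0}
    (hL : LipschitzWith L F) {U B : ℝ} (hU : 0 < U) (hB : ∀ x, ‖F x‖ ≤ B) {r : ℝ} (hr : 0 < r)
    (A : Set (ℝ × ℝ × Z)) :
    volume (reflectedPullback F U r A) ≤
      ENNReal.ofReal (Real.exp (2 * Module.finrank ℝ (ℝ × Z) * L * r)) * (2 * volume A) := by
  set C := ENNReal.ofReal (Real.exp (2 * Module.finrank ℝ (ℝ × Z) * L * r)) with hC
  have hC0 : C ≠ 0 := by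
    rw [hC, Ne, ENNReal.ofReal_eq_zero, not_le]; exact Real.exp_pos _
  have hCt : C ≠ ⊤ := ENNReal.ofReal_ne_top
  have h1 : volume (reflectedPullback F U r A) / C ≤ volume (A ∪ reflect ⁻¹' A) := by
    rw [Set.measure_eq_iInf_isOpen (A ∪ reflect ⁻¹' A)]
    refine le_iInf₂ fun V hAV => le_iInf fun hV => ?_
    rw [ENNReal.div_le_iff' hC0 hCt]
    refine volume_reflectedPullback_le_of_isOpen hL hU hB hr hV
      (subset_union_left.trans hAV) fun y hy => hAV (Or.inr ?_)
    rwa [mem_preimage, reflect_reflect]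
  rw [ENNReal.div_le_iff' hC0 hCt] at h1
  refine h1.trans ?_
  gcongr
  rw [two_mul]
  exact (measure_union_le _ _).trans (add_le_add le_rfl (volume_reflect_preimage_le A))

theorem volume_reflectedPullback_eq_zero {F : ℝ × ℝ × Z → ℝ × Z} {L : ℝ≥0}
    (hL : LipschitzWith L F) {U B : ℝ} (hU : 0 < U) (hB : ∀ x, ‖F x‖ ≤ B) {r : ℝ} (hr : 0 < r)
    {A : Set (ℝ × ℝ × Z)} (hA : volume A = 0) : volume (reflectedPullback F U r A) = 0 := by
  have := volume_reflectedPullback_le hL hU hB hr A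
  rwa [hA, mul_zero, mul_zero, nonpos_iff_eq_zero] at this

/-- The initial states of the reflected motions, with third component in `K`, whose position and
normal velocity come arbitrarily close to zero as time approaches some `T ≤ 1`. -/
def reflectedSingular (F : ℝ × ℝ × Z → ℝ × Z) (U : ℝ) (K : Set Z) : Set (ℝ × ℝ × Z) :=
  {y | ∃ x T, 0 < T ∧ T ≤ 1 ∧ IsReflectedMotion F U x T ∧ x 0 = y ∧ (∀ t ∈ Ico 0 T, (x t).2.2 ∈ K) ∧
    (∀ t ∈ Ico 0 T, ∀ ε > 0, ∃ t' ∈ Ico t T, |(x t').1| < ε) ∧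
    ∀ t ∈ Ico 0 T, ∀ ε > 0, ∃ t' ∈ Ico t T, |(x t').2.1| < ε}

/-- Compare `|u|` at `t` with a later time at which it is almost zero. -/
theorem IsReflectedMotion.abs_normal_velocity_le {F : ℝ × ℝ × Z → ℝ × Z} {U B : ℝ} (hU : 0 < U)
    (hB : ∀ x, ‖F x‖ ≤ B) {x : ℝ → ℝ × ℝ × Z} {T : ℝ} (hx : IsReflectedMotion F U x T)
    (hu : ∀ t ∈ Ico 0 T, ∀ ε > 0, ∃ t' ∈ Ico t T, |(x t').2.1| < ε) {t : ℝ} (ht : t ∈ Ico 0 T) :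
    |(x t).2.1| ≤ max U B * (T - t) := by
  refine le_of_forall_pos_le_add fun ε hε => ?_
  obtain ⟨t', ht', h⟩ := hu t ht ε hε
  have h1 := hx.abs_normal_velocity_sub_le hU hB ht.1 ht'.1 ht'.2
  rw [abs_le] at h1
  have h2 : max U B * (t' - t) ≤ max U B * (T - t) := by
    have : 0 < max U B := hU.trans_le (le_max_left _ _)
    gcongr
    exact ht'.2.le
  linarith [h1.1]

/-- Integrating the linear bound on `|u|` gives the square of the remaining time. -/
theorem IsReflectedMotion.abs_height_le {F : ℝ × ℝ × Z → ℝ × Z} {U B : ℝ} (hU : 0 < U)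
    (hB : ∀ x, ‖F x‖ ≤ B) {x : ℝ → ℝ × ℝ × Z} {T : ℝ} (hx : IsReflectedMotion F U x T)
    (hh : ∀ t ∈ Ico 0 T, ∀ ε > 0, ∃ t' ∈ Ico t T, |(x t').1| < ε)
    (hu : ∀ t ∈ Ico 0 T, ∀ ε > 0, ∃ t' ∈ Ico t T, |(x t').2.1| < ε) {t : ℝ} (ht : t ∈ Ico 0 T) :
    |(x t).1| ≤ max U B * (T - t) ^ 2 := by
  have hM : 0 < max U B := hU.trans_le (le_max_left _ _)
  refine le_of_forall_pos_le_add fun ε hε => ?_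
  obtain ⟨t', ht', h⟩ := hh t ht ε hε
  have hTt : 0 ≤ T - t := by linarith [ht.2]
  have h1 := hx.abs_height_sub_le hU.le (C := max U B * (T - t)) ht.1 ht'.1 ht'.2 fun r hr =>
    (hx.abs_normal_velocity_le hU hB hu ⟨ht.1.trans hr.1, hr.2.trans_lt ht'.2⟩).trans
      (by gcongr; exact hr.1)
  have h2 : max U B * (T - t) * (t' - t) ≤ max U B * (T - t) ^ 2 := by
    rw [sq, ← mul_assoc]; gcongr; exact ht'.2.le
  rw [abs_sub_comm] at h1
  have := abs_sub_abs_le_abs_sub (x t).1 (x t').1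
  linarith

/-- Some grid time lies within one grid step before the end, where the state is in a box of volume
proportional to the cube of the step. There are only inversely many grid times, and each pullback
costs a bounded factor. -/
theorem volume_reflectedSingular {F : ℝ × ℝ × Z → ℝ × Z} {L : ℝ≥0}
    (hL : LipschitzWith L F) {U B : ℝ} (hU : 0 < U) (hB : ∀ x, ‖F x‖ ≤ B) {K : Set Z}
    (hK : volume K ≠ ⊤) : volume (reflectedSingular F U K) = 0 := by
  have hM0 : 0 < max U B := hU.trans_le (le_max_left _ _)
  set M := max U B with hM
  set C := Real.exp (2 * Module.finrank ℝ (ℝ × Z) * L) with hC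
  have hC1 : 1 ≤ C := Real.one_le_exp (by positivity)
  let box : ℝ → Set (ℝ × ℝ × Z) := fun τ =>
    Icc (-(M * τ ^ 2)) (M * τ ^ 2) ×ˢ Icc (-(M * τ)) (M * τ) ×ˢ K
  have hbox : ∀ τ, 0 ≤ τ → volume (box τ) = ENNReal.ofReal (4 * M ^ 2 * τ ^ 3) * volume K := by
    intro τ hτ
    simp only [box, Measure.volume_eq_prod, Measure.prod_prod, Real.volume_Icc]
    rw [← mul_assoc, ← ENNReal.ofReal_mul (by linarith [mul_nonneg hM0.le (sq_nonneg τ)])]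
    congr 2
    ring
  have hmem : ∀ x T, IsReflectedMotion F U x T → (∀ t ∈ Ico 0 T, (x t).2.2 ∈ K) →
      (∀ t ∈ Ico 0 T, ∀ ε > 0, ∃ t' ∈ Ico t T, |(x t').1| < ε) →
      (∀ t ∈ Ico 0 T, ∀ ε > 0, ∃ t' ∈ Ico t T, |(x t').2.1| < ε) →
      ∀ t ∈ Ico 0 T, ∀ τ, T - t ≤ τ → x t ∈ box τ := by
    intro x T hx hxK hh hu t ht τ hτ
    have hTt : 0 ≤ T - t := by linarith [ht.2]
    refine ⟨abs_le.1 ?_, abs_le.1 ?_, hxK t ht⟩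
    · exact (hx.abs_height_le hU hB hh hu ht).trans (by gcongr)
    · exact (hx.abs_normal_velocity_le hU hB hu ht).trans (by gcongr)
  have hcover : ∀ N : ℕ, reflectedSingular F U K ⊆ ⋃ k ∈ Finset.range (N + 1),
      (if k = 0 then box (1 / (N + 1)) else
        reflectedPullback F U (k / (N + 1)) (box (1 / (N + 1)))) := by
    rintro N _ ⟨x, T, hT, hT1, hx, rfl, hxK, hh, hu⟩
    have hN : (0 : ℝ) < N + 1 := by positivity
    -- The index of the last grid time strictly before `T`. Index `0` is treated apart because the
    -- pullback estimate needs a positive time.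
    set k := ⌈T * (N + 1)⌉₊ - 1 with hk
    have hceil : 0 < ⌈T * (N + 1)⌉₊ := Nat.ceil_pos.2 (by positivity)
    have hk1 : ((k : ℝ) + 1) = ⌈T * (N + 1)⌉₊ := by
      have : k + 1 = ⌈T * (N + 1)⌉₊ := by omega
      exact_mod_cast this
    have h1 : T * (N + 1) ≤ k + 1 := hk1 ▸ Nat.le_ceil _
    have h2 : (k : ℝ) < T * (N + 1) := by
      have := Nat.ceil_lt_add_one (a := T * (N + 1)) (by positivity)
      linarith
    have hkN : k < N + 1 := by
      have h3 : (k : ℝ) < N + 1 := h2.trans_le (mul_le_of_le_one_left hN.le hT1)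
      exact_mod_cast h3
    have hkT : (k : ℝ) / (N + 1) < T := by rwa [div_lt_iff₀ hN]
    have hTk : T - k / (N + 1) ≤ 1 / (N + 1) := by
      rw [sub_le_iff_le_add, ← add_div, le_div_iff₀ hN]; linarith
    have hxb := hmem x T hx hxK hh hu (k / (N + 1)) ⟨by positivity, hkT⟩ _ hTk
    refine mem_iUnion₂.2 ⟨k, Finset.mem_range.2 hkN, ?_⟩
    split_ifs with h0
    · simpa [h0] using hxb
    · exact ⟨x, T, hx, hkT, rfl, hxb⟩
  have hest : ∀ N : ℕ, volume (reflectedSingular F U K) ≤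
      ENNReal.ofReal (8 * C * M ^ 2 * (1 / (N + 1))) * volume K := by
    intro N
    have hN : (0 : ℝ) < N + 1 := by positivity
    have hpiece : ∀ k ∈ Finset.range (N + 1),
        volume (if k = 0 then box (1 / (N + 1)) else
          reflectedPullback F U (k / (N + 1)) (box (1 / (N + 1)))) ≤
        ENNReal.ofReal (8 * C * M ^ 2 * (1 / (N + 1)) ^ 3) * volume K := by
      intro k hk
      have e1 : ENNReal.ofReal (8 * C * M ^ 2 * (1 / (N + 1)) ^ 3) * volume K =
          ENNReal.ofReal C * (2 * volume (box (1 / (N + 1)))) := by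
        rw [hbox _ (by positivity), ← mul_assoc, ← mul_assoc,
          ← ENNReal.ofReal_ofNat 2, ← ENNReal.ofReal_mul (by positivity),
          ← ENNReal.ofReal_mul (by positivity)]
        congr 2
        ring
      rw [e1]
      split_ifs with h0
      · rw [two_mul, ← one_mul (volume (box (1 / (N + 1))))]
        refine mul_le_mul' ?_ ?_
        · rw [← ENNReal.ofReal_one]; exact ENNReal.ofReal_le_ofReal hC1
        · rw [one_mul]; exact le_self_add
      · refine (volume_reflectedPullback_le hL hU hB (by positivity) _).trans ?_
        refine mul_le_mul' (ENNReal.ofReal_le_ofReal (Real.exp_le_exp.2 ?_)) le_rfl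
        refine mul_le_of_le_one_right (by positivity) ?_
        rw [div_le_one hN]
        have := Finset.mem_range.1 hk
        have h3 : (k : ℝ) < ((N + 1 : ℕ) : ℝ) := by exact_mod_cast this
        push_cast at h3
        exact h3.le
    calc _ ≤ _ := measure_mono (hcover N)
      _ ≤ ∑ k ∈ Finset.range (N + 1), _ := measure_biUnion_finset_le _ _
      _ ≤ ∑ k ∈ Finset.range (N + 1), ENNReal.ofReal (8 * C * M ^ 2 * (1 / (N + 1)) ^ 3) *
          volume K := Finset.sum_le_sum hpiece
      _ = ENNReal.ofReal (8 * C * M ^ 2 * (1 / (N + 1)) ^ 2) * volume K := by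
          rw [Finset.sum_const, Finset.card_range, nsmul_eq_mul, ← mul_assoc,
            ← ENNReal.ofReal_natCast, ← ENNReal.ofReal_mul (by positivity)]
          congr 2
          push_cast
          field_simp
      _ ≤ _ := by
          gcongr
          have h1 : (1 : ℝ) / (N + 1) ≤ 1 := by
            rw [div_le_one hN]; linarith [(Nat.cast_nonneg N : (0 : ℝ) ≤ N)]
          have h0 : (0 : ℝ) ≤ 1 / (N + 1) := by positivity
          nlinarith
  have hlim : Tendsto (fun N : ℕ => ENNReal.ofReal (8 * C * M ^ 2 * (1 / (N + 1))) * volume K) atTop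
      (𝓝 0) := by
    have h1 : Tendsto (fun N : ℕ => ENNReal.ofReal (8 * C * M ^ 2 * (1 / ((N : ℝ) + 1)))) atTop
        (𝓝 (ENNReal.ofReal (8 * C * M ^ 2 * 0))) :=
      ENNReal.tendsto_ofReal (tendsto_one_div_add_atTop_nhds_zero_nat.const_mul _)
    rw [mul_zero, ENNReal.ofReal_zero] at h1
    simpa using ENNReal.Tendsto.mul_const h1 (Or.inr hK)
  exact le_antisymm (ge_of_tendsto' hlim hest) (by simp)

/-- The initial states of the solution curves of the field which are in `A` at time `r`. -/
def freePullback (F : ℝ × ℝ × Z → ℝ × Z) (U r : ℝ) (A : Set (ℝ × ℝ × Z)) : Set (ℝ × ℝ × Z) :=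
  {y | ∃ x : ℝ → ℝ × ℝ × Z, ContinuousOn x (Icc 0 r) ∧
    (∀ t ∈ Ico 0 r, HasDerivWithinAt x (fullField F U (x t)) (Ioi t) t) ∧ x 0 = y ∧ x r ∈ A}

theorem lipschitzWith_fullField {F : ℝ × ℝ × Z → ℝ × Z} {L : ℝ≥0} (hL : LipschitzWith L F) (U : ℝ) :
    LipschitzWith (max 1 L) (fullField F U) :=
  LipschitzWith.of_dist_le_mul fun x y => by
    rw [dist_eq_norm, dist_eq_norm]; exact_mod_cast norm_fullField_sub_le hL U x y

/-- Motions are known only through right derivatives, which time reversal would turn into left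
derivatives. The integral form of the equation shows that the solution is differentiable in both
directions inside the interval. -/
theorem exists_backward_solution {E : Type*} [NormedAddCommGroup E] [NormedSpace ℝ E]
    [CompleteSpace E] {f : E → E} (hf : Continuous f) {x : ℝ → E} {r : ℝ} (hr : 0 ≤ r)
    (hx : ContinuousOn x (Icc 0 r)) (hd : ∀ t ∈ Ico 0 r, HasDerivWithinAt x (f (x t)) (Ioi t) t) :
    ContinuousOn (fun t => x (r - t)) (Icc 0 r) ∧
      ∀ t ∈ Ico 0 r, HasDerivWithinAt (fun t => x (r - t)) (-f (x (r - t))) (Ici t) t := by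
  -- Freezing the time outside `[0, r]` makes the integrand continuous on the whole line.
  let g : ℝ → E := fun t => f (x (projIcc 0 r hr t))
  have hg : Continuous g :=
    hf.comp (hx.comp_continuous (continuous_subtype_val.comp continuous_projIcc) fun t =>
      (projIcc 0 r hr t).2)
  have hgx : ∀ t ∈ Icc 0 r, g t = f (x t) := fun t ht => by simp [g, projIcc_of_mem hr ht]
  have hG : ∀ t, HasDerivAt (fun t => x 0 + ∫ s in (0 : ℝ)..t, g s) (g t) t := fun t =>
    (intervalIntegral.integral_hasDerivAt_right (hg.intervalIntegrable _ _)
      (hg.stronglyMeasurableAtFilter _ _) hg.continuousAt).const_add (x 0)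
  have hxG : ∀ t ∈ Icc 0 r, x t = x 0 + ∫ s in (0 : ℝ)..t, g s := by
    intro t ht
    rw [intervalIntegral.integral_eq_sub_of_hasDeriv_right_of_le (f := x) ht.1
      (hx.mono (Icc_subset_Icc_right ht.2)) (fun s hs => ?_) (hg.intervalIntegrable _ _)]
    · abel
    · rw [hgx s ⟨hs.1.le, hs.2.le.trans ht.2⟩]
      exact hd s ⟨hs.1.le, hs.2.trans_le ht.2⟩
  refine ⟨hx.comp (by fun_prop) fun t ht => ⟨by linarith [ht.2], by linarith [ht.1]⟩, ?_⟩
  intro t ht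
  have h1 : HasDerivAt (fun t => x 0 + ∫ s in (0 : ℝ)..(r - t), g s) (-g (r - t)) t :=
    (hG (r - t)).comp_const_sub r t
  rw [hgx (r - t) ⟨by linarith [ht.2], by linarith [ht.1]⟩] at h1
  have h2 : HasDerivWithinAt (fun t => x (r - t)) (-f (x (r - t))) (Icc t r) t :=
    h1.hasDerivWithinAt.congr
      (fun s hs => hxG (r - s) ⟨by linarith [hs.2], by linarith [hs.1, ht.1]⟩)
      (hxG (r - t) ⟨by linarith [ht.2], by linarith [ht.1]⟩)
  exact h2.mono_of_mem_nhdsWithin (Icc_mem_nhdsGE ht.2)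

/-- Here `f` may be an arbitrary choice function: its inverse is Lipschitz on the image of `s`, and
Hausdorff measure handles nonmeasurable sets. -/
theorem addHaar_eq_zero_of_le_mul_dist {E : Type*} [NormedAddCommGroup E]
    [NormedSpace ℝ E] [FiniteDimensional ℝ E] [MeasurableSpace E] [BorelSpace E] (μ : Measure E)
    [μ.IsAddHaarMeasure] {s A : Set E} {f : E → E} (K : ℝ≥0) (hf : ∀ y ∈ s, f y ∈ A)
    (hK : ∀ y ∈ s, ∀ y' ∈ s, dist y y' ≤ K * dist (f y) (f y')) (hA : μ A = 0) : μ s = 0 := by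
  set H : Measure E := Measure.hausdorffMeasure (Module.finrank ℝ E) with hH
  have hHA : H A = 0 := Measure.absolutelyContinuous_isAddHaarMeasure H μ hA
  have hanti : AntilipschitzWith K (fun y : s => f y) :=
    AntilipschitzWith.of_le_mul_dist fun y y' => hK y y.2 y' y'.2
  have h1 := hanti.hausdorffMeasure_preimage_le (d := Module.finrank ℝ E) (by positivity) A
  rw [← hH, hHA, mul_zero] at h1
  have h2 : (fun y : s => f y) ⁻¹' A = univ := eq_univ_of_forall fun y => hf y y.2
  rw [h2, nonpos_iff_eq_zero] at h1
  have h3 := (isometry_subtype_coe (s := s)).hausdorffMeasure_image (d := Module.finrank ℝ E)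
    (Or.inl (by positivity)) univ
  rw [h1, image_univ, Subtype.range_coe] at h3
  exact Measure.absolutelyContinuous_isAddHaarMeasure μ H h3

/-- Choose one motion for each initial state. Gronwall backward in time bounds the distance of the
initial states by that of the final ones. -/
theorem volume_freePullback_eq_zero {F : ℝ × ℝ × Z → ℝ × Z} {L : ℝ≥0}
    (hL : LipschitzWith L F) (U : ℝ) {r : ℝ} (hr : 0 < r)
    {A : Set (ℝ × ℝ × Z)} (hA : volume A = 0) : volume (freePullback F U r A) = 0 := by
  classical
  choose! x hxc hxd hx0 hxA using fun y (hy : y ∈ freePullback F U r A) => hy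
  refine addHaar_eq_zero_of_le_mul_dist volume
    (Real.toNNReal (Real.exp ((max 1 L : ℝ≥0) * r))) (f := fun y => x y r) hxA ?_ hA
  intro y hy y' hy'
  have hF := lipschitzWith_fullField hL U
  obtain ⟨hc, hd⟩ := exists_backward_solution hF.continuous hr.le (hxc y hy) (hxd y hy)
  obtain ⟨hc', hd'⟩ := exists_backward_solution hF.continuous hr.le (hxc y' hy') (hxd y' hy')
  have h := dist_le_of_trajectories_ODE (v := fun _ x => -fullField F U x) (K := max 1 L)
    (fun _ => hF.neg) hc hd hc' hd' le_rfl r ⟨hr.le, le_rfl⟩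
  simp only [sub_self, sub_zero, hx0 y hy, hx0 y' hy'] at h
  rw [Real.coe_toNNReal _ (Real.exp_pos _).le, mul_comm]
  exact h

end NullSets

/-! ### Linear algebra for completing covectors to coordinates. -/

section LinearAlgebra

variable {E F : Type*} [NormedAddCommGroup E] [NormedSpace ℝ E] [FiniteDimensional ℝ E]
  [NormedAddCommGroup F] [NormedSpace ℝ F] [FiniteDimensional ℝ F]

theorem isInvertible_of_ker {A : E →L[ℝ] F} (hA : ∀ w, A w = 0 → w = 0)
    (hdim : Module.finrank ℝ E = Module.finrank ℝ F) : A.IsInvertible := by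
  have hinj : Function.Injective (A : E →ₗ[ℝ] F) :=
    (injective_iff_map_eq_zero _).2 hA
  exact ⟨(LinearMap.linearEquivOfInjective (A : E →ₗ[ℝ] F) hinj hdim).toContinuousLinearEquiv, by
    ext w; rfl⟩

theorem exists_complementary_coordinates (A : E →ₗ[ℝ] F) (hA : Function.Surjective A) {r : ℕ}
    (hr : Module.finrank ℝ E = Module.finrank ℝ F + r) :
    ∃ ζ : E →L[ℝ] (Fin r → ℝ), ∀ w, A w = 0 → ζ w = 0 → w = 0 := by
  have h1 := A.finrank_range_add_finrank_ker
  rw [LinearMap.range_eq_top.2 hA, finrank_top] at h1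
  have h2 : Module.finrank ℝ (LinearMap.ker A) = Module.finrank ℝ (Fin r → ℝ) := by
    rw [Module.finrank_fin_fun]; omega
  obtain ⟨e⟩ := FiniteDimensional.nonempty_linearEquiv_of_finrank_eq h2
  obtain ⟨p, hp⟩ := (LinearMap.ker A).subtype.exists_leftInverse_of_injective
    (LinearMap.ker A).ker_subtype
  refine ⟨LinearMap.toContinuousLinearMap (e.toLinearMap ∘ₗ p), fun w hw hζ => ?_⟩
  have h3 : p w = ⟨w, hw⟩ := congrArg (fun f => f ⟨w, hw⟩) hp
  have h4 : e (p w) = 0 := hζ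
  rw [h3, e.map_eq_zero_iff] at h4
  exact congrArg Subtype.val h4

/-- A functional vanishing on a proper range would be a linear relation between the covectors. -/
theorem surjective_pi_of_linearIndependent {ι : Type*} [Finite ι] {f : ι → (E →L[ℝ] ℝ)}
    (hf : LinearIndependent ℝ f) :
    Function.Surjective (LinearMap.pi fun i => (f i : E →ₗ[ℝ] ℝ)) := by
  classical
  cases nonempty_fintype ι
  rw [← LinearMap.range_eq_top]
  by_contra hne
  obtain ⟨φ, hφ, hle⟩ := Submodule.exists_le_ker_of_lt_top _ (lt_top_iff_ne_top.2 hne)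
  have h0 : ∑ i, φ (Pi.single i 1) • f i = 0 := by
    ext w
    have h1 : φ (LinearMap.pi (fun i => (f i : E →ₗ[ℝ] ℝ)) w) = 0 := hle ⟨w, rfl⟩
    rw [LinearMap.pi_apply_eq_sum_univ] at h1
    simp only [sum_apply, smul_apply,
      zero_apply]
    rw [← h1]
    refine Finset.sum_congr rfl fun i _ => ?_
    have : (Pi.single i 1 : ι → ℝ) = fun j => if i = j then 1 else 0 := by
      ext j; simp [Pi.single_apply, eq_comm]
    simp only [smul_eq_mul, LinearMap.pi_apply, ContinuousLinearMap.coe_coe, mul_comm, this]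
  have h2 := Fintype.linearIndependent_iff.1 hf _ h0
  refine hφ (LinearMap.pi_ext' fun i => LinearMap.ext_ring ?_)
  simpa using h2 i

theorem eventually_isInvertible {X : Type*} [TopologicalSpace X] {A : X → E →L[ℝ] F} {x : X}
    (hA : ContinuousAt A x) (hx : (A x).IsInvertible) : ∀ᶠ y in 𝓝 x, (A y).IsInvertible := by
  obtain ⟨e, he⟩ := hx
  exact hA.eventually (he ▸ ContinuousLinearEquiv.nhds e)

theorem contDiffOn_inverse {X : Type*} [NormedAddCommGroup X] [NormedSpace ℝ X]
    {A : X → E →L[ℝ] F} {s : Set X} (hA : ContDiffOn ℝ ∞ A s) (hs : ∀ x ∈ s, (A x).IsInvertible) :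
    ContDiffOn ℝ ∞ (fun x => (A x).inverse) s := by
  intro x hx
  obtain ⟨e, he⟩ := hs x hx
  have h := contDiffAt_map_inverse (𝕜 := ℝ) (n := ∞) e
  rw [he] at h
  exact h.comp_contDiffWithinAt x (hA x hx)

end LinearAlgebra

/-! ### Coordinates of the distribution adapted to a function. -/

/-- The coordinate expressions, on an open set, of a metric, of constraint one-forms, of a
potential, and of a function. -/
structure LocalSystem (E : Type*) [NormedAddCommGroup E] [NormedSpace ℝ E] (m : ℕ) where
  /-- the domain of the coordinate expressions -/
  U : Set E
  isOpen_U : IsOpen U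
  /-- the metric -/
  G : E → E →L[ℝ] E →L[ℝ] ℝ
  /-- the constraint one-forms -/
  η : Fin m → E → E →L[ℝ] ℝ
  /-- the potential -/
  V : E → ℝ
  /-- the distinguished function -/
  h : E → ℝ
  smooth_G : ContDiffOn ℝ ∞ G U
  smooth_η : ∀ α, ContDiffOn ℝ ∞ (η α) U
  smooth_V : ContDiffOn ℝ ∞ V U
  smooth_h : ContDiffOn ℝ ∞ h U
  symm : ∀ y ∈ U, ∀ w w', G y w w' = G y w' w
  pos : ∀ y ∈ U, ∀ w, w ≠ 0 → 0 < G y w w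

/-- Coordinates of the constraint distribution adapted to `h`. -/
structure AdaptedCoords {E : Type*} [NormedAddCommGroup E] [NormedSpace ℝ E] {m : ℕ}
    (S : LocalSystem E m) (a r : ℕ) where
  /-- the coordinates of the position -/
  ψ : OpenPartialHomeomorph E (ℝ × (Fin a → ℝ))
  source_subset : ψ.source ⊆ S.U
  /-- the coordinates other than `h` -/
  π : E →L[ℝ] (Fin a → ℝ)
  ψ_apply : ∀ y, ψ y = (S.h y, π y)
  smooth_symm : ContDiffOn ℝ ∞ ψ.symm ψ.target
  /-- the frame of the tangential part of the distribution -/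
  e : Fin r → E → E
  /-- the normal vector in the distribution -/
  f : E → E
  /-- the velocity in terms of its coordinates -/
  P : E → (ℝ × (Fin r → ℝ)) →L[ℝ] E
  smooth_e : ∀ j, ContDiffOn ℝ ∞ (e j) ψ.source
  smooth_f : ContDiffOn ℝ ∞ f ψ.source
  smooth_P : ContDiffOn ℝ ∞ P ψ.source
  η_e : ∀ y ∈ ψ.source, ∀ α j, S.η α y (e j y) = 0
  dh_e : ∀ y ∈ ψ.source, ∀ j, fderiv ℝ S.h y (e j y) = 0
  η_f : ∀ y ∈ ψ.source, ∀ α, S.η α y (f y) = 0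
  G_f : ∀ y ∈ ψ.source, ∀ w, (∀ α, S.η α y w = 0) → S.G y w (f y) = fderiv ℝ S.h y w
  P_apply : ∀ y ∈ ψ.source, ∀ w, (∀ α, S.η α y w = 0) →
    P y (fderiv ℝ S.h y w, fun j => S.G y w (e j y)) = w

/-- Position coordinates come from completing `dh` by constant covectors and inverting. The fields
`e j` form a frame of the common kernel of `η` and `dh`. The normal vector `f` is the multiple of
the vector `E₁` in the distribution, orthogonal to the `e j`, for which `g(w, f) = dh(w)` on the
distribution; thus the normal velocity too is a momentum along a section of the distribution. -/
theorem exists_adaptedCoords {E : Type*} [NormedAddCommGroup E] [NormedSpace ℝ E]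
    [FiniteDimensional ℝ E] {m a r : ℕ} (S : LocalSystem E m) {y₀ : E} (hy₀ : y₀ ∈ S.U)
    (hη : LinearIndependent ℝ fun α => S.η α y₀)
    (hh : fderiv ℝ S.h y₀ ∉ Submodule.span ℝ (range fun α => S.η α y₀))
    (ha : Module.finrank ℝ E = a + 1) (hr : Module.finrank ℝ E = m + 1 + r) :
    ∃ C : AdaptedCoords S a r, y₀ ∈ C.ψ.source := by
  have : CompleteSpace E := FiniteDimensional.complete ℝ E
  have hdh : ContDiffOn ℝ ∞ (fderiv ℝ S.h) S.U := S.smooth_h.fderiv_of_isOpen S.isOpen_U (by simp)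
  have hli : LinearIndependent ℝ (Fin.cons (fderiv ℝ S.h y₀) fun α => S.η α y₀ :
      Fin (m + 1) → E →L[ℝ] ℝ) := linearIndependent_finCons.2 ⟨hη, hh⟩
  obtain ⟨ζ, hζ⟩ := exists_complementary_coordinates _ (surjective_pi_of_linearIndependent hli)
    (r := r) (by rw [Module.finrank_fin_fun]; exact hr)
  have hne : fderiv ℝ S.h y₀ ≠ 0 := fun h0 => hh (h0 ▸ Submodule.zero_mem _)
  obtain ⟨π, hπ⟩ := exists_complementary_coordinates (fderiv ℝ S.h y₀ : E →ₗ[ℝ] ℝ) (r := a)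
    (LinearMap.surjective fun h0 => hne (by ext w; exact congrArg (fun f => f w) h0))
    (by rw [Module.finrank_self, ha, add_comm])
  -- the covectors `η`, `dh`, completed by constant ones
  let A₁ : E → E →L[ℝ] ((Fin m → ℝ) × ℝ × (Fin r → ℝ)) := fun y =>
    (ContinuousLinearMap.pi fun α => S.η α y).prod ((fderiv ℝ S.h y).prod ζ)
  have hA₁ : ContDiffOn ℝ ∞ A₁ S.U := by
    refine contDiffOn_clm_apply.2 fun w => ?_
    refine (contDiffOn_pi.2 fun α => (S.smooth_η α).clm_apply contDiffOn_const).prodMk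
      ((hdh.clm_apply contDiffOn_const).prodMk contDiffOn_const)
  have hdim : Module.finrank ℝ E = Module.finrank ℝ ((Fin m → ℝ) × ℝ × (Fin r → ℝ)) := by
    simp only [Module.finrank_prod, Module.finrank_fin_fun, Module.finrank_self]; omega
  have hA₁inv : (A₁ y₀).IsInvertible := by
    refine isInvertible_of_ker (fun w hw => ?_) hdim
    simp only [A₁, ContinuousLinearMap.prod_apply, Prod.mk_eq_zero] at hw
    obtain ⟨h1, h2, h3⟩ := hw
    refine hζ w ?_ h3
    ext i
    refine Fin.cases ?_ (fun α => ?_) i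
    · exact h2
    · exact congrFun h1 α
  let Ψ' : E → E →L[ℝ] (ℝ × (Fin a → ℝ)) := fun y => (fderiv ℝ S.h y).prod π
  have hΨ' : ContDiffOn ℝ ∞ Ψ' S.U :=
    contDiffOn_clm_apply.2 fun w => (hdh.clm_apply contDiffOn_const).prodMk contDiffOn_const
  have hΨ'inv : (Ψ' y₀).IsInvertible := by
    refine isInvertible_of_ker (fun w hw => ?_) ?_
    · simp only [Ψ', ContinuousLinearMap.prod_apply, Prod.mk_eq_zero] at hw
      exact hπ w hw.1 hw.2
    · simp only [Module.finrank_prod, Module.finrank_fin_fun, Module.finrank_self]; omega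
  have hder : ∀ y ∈ S.U, HasFDerivAt (fun y => (S.h y, π y)) (Ψ' y) y := fun y hy =>
    (((S.smooth_h.contDiffAt (S.isOpen_U.mem_nhds hy)).differentiableAt (by simp)).hasFDerivAt).prodMk
      π.hasFDerivAt
  have hsm : ∀ y ∈ S.U, ContDiffAt ℝ ∞ (fun y => (S.h y, π y)) y := fun y hy =>
    (S.smooth_h.contDiffAt (S.isOpen_U.mem_nhds hy)).prodMk π.contDiff.contDiffAt
  have hUy0 : S.U ∈ 𝓝 y₀ := S.isOpen_U.mem_nhds hy₀
  have hUy : ∀ᶠ y in 𝓝 y₀, y ∈ S.U := hUy0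
  obtain ⟨N, hN, hNo, hyN⟩ := mem_nhds_iff.1 (hUy.and
    ((eventually_isInvertible (hA₁.continuousOn.continuousAt hUy0) hA₁inv).and
      (eventually_isInvertible (hΨ'.continuousOn.continuousAt hUy0) hΨ'inv)))
  obtain ⟨ε₀, hε₀⟩ := id hΨ'inv
  have hder₀ := hder y₀ hy₀
  rw [← hε₀] at hder₀
  let ψ₀ := (hsm y₀ hy₀).toOpenPartialHomeomorph _ hder₀ (by simp)
  let ψ := ψ₀.restr N
  have hψs : ψ.source = ψ₀.source ∩ N := by
    change ψ₀.source ∩ interior N = _; rw [hNo.interior_eq]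
  have hsN : ∀ y ∈ ψ.source, y ∈ S.U ∧ (A₁ y).IsInvertible ∧ (Ψ' y).IsInvertible := fun y hy =>
    hN (hψs ▸ hy).2
  have hsU : ψ.source ⊆ S.U := fun y hy => (hsN y hy).1
  -- the tangential frame
  let e : Fin r → E → E := fun j y => (A₁ y).inverse (0, 0, Pi.single j 1)
  have hAe : ∀ y ∈ ψ.source, ∀ j, A₁ y (e j y) = (0, 0, Pi.single j 1) := fun y hy j =>
    (((hsN y hy).2.1.inverse_apply_eq).1 rfl).symm
  have hηe : ∀ y ∈ ψ.source, ∀ α j, S.η α y (e j y) = 0 := fun y hy α j =>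
    congrFun (congrArg Prod.fst (hAe y hy j)) α
  have hdhe : ∀ y ∈ ψ.source, ∀ j, fderiv ℝ S.h y (e j y) = 0 := fun y hy j =>
    congrArg (fun p => p.2.1) (hAe y hy j)
  have hζe : ∀ y ∈ ψ.source, ∀ j, ζ (e j y) = Pi.single j 1 := fun y hy j =>
    congrArg (fun p => p.2.2) (hAe y hy j)
  have hse : ∀ j, ContDiffOn ℝ ∞ (e j) ψ.source := fun j =>
    (contDiffOn_inverse (hA₁.mono hsU) fun y hy => (hsN y hy).2.1).clm_apply contDiffOn_const
  have hspan : ∀ y ∈ ψ.source, ∀ z, (∀ α, S.η α y z = 0) → fderiv ℝ S.h y z = 0 →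
      z = ∑ j, ζ z j • e j y := by
    intro y hy z hz1 hz2
    obtain ⟨E₁, hE₁⟩ := (hsN y hy).2.1
    apply E₁.injective
    have hA : ∀ v, E₁ v = A₁ y v := fun v => congrArg (fun f => f v) hE₁
    rw [map_sum]
    simp only [map_smul, hA, hAe y hy]
    refine Prod.ext ?_ (Prod.ext ?_ ?_)
    · ext α; simpa [A₁, Prod.fst_sum] using hz1 α
    · simpa [A₁, Prod.fst_sum, Prod.snd_sum] using hz2
    · ext j
      simp [A₁, Prod.snd_sum, Pi.single_apply]
  -- the covectors `η`, `dh`, `g(e_j, ·)`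
  let A₂ : E → E →L[ℝ] ((Fin m → ℝ) × ℝ × (Fin r → ℝ)) := fun y =>
    (ContinuousLinearMap.pi fun α => S.η α y).prod ((fderiv ℝ S.h y).prod
      (ContinuousLinearMap.pi fun j => S.G y (e j y)))
  have hA₂ : ContDiffOn ℝ ∞ A₂ ψ.source := by
    refine contDiffOn_clm_apply.2 fun w => ?_
    refine (contDiffOn_pi.2 fun α => ((S.smooth_η α).mono hsU).clm_apply contDiffOn_const).prodMk
      (((hdh.mono hsU).clm_apply contDiffOn_const).prodMk (contDiffOn_pi.2 fun j => ?_))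
    exact ((S.smooth_G.mono hsU).clm_apply (hse j)).clm_apply contDiffOn_const
  have hA₂inv : ∀ y ∈ ψ.source, (A₂ y).IsInvertible := by
    intro y hy
    refine isInvertible_of_ker (fun w hw => ?_) hdim
    simp only [A₂, ContinuousLinearMap.prod_apply, Prod.mk_eq_zero] at hw
    obtain ⟨h1, h2, h3⟩ := hw
    -- A vector in the kernel lies in the span of the `e j` and is orthogonal to it, so positivity
    -- of the metric kills it.
    have hw := hspan y hy w (fun α => congrFun h1 α) h2
    by_contra hw0
    have h5 := S.pos y (hsU hy) w hw0
    have h6 : S.G y w w = 0 := by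
      have h7 : ∀ v, S.G y (∑ j, ζ w j • e j y) v = ∑ j, ζ w j • S.G y (e j y) v := fun v => by
        simp only [map_sum, map_smul, sum_apply, smul_apply]
      have h8 : ∀ j, S.G y (e j y) w = 0 := fun j => congrFun h3 j
      have h9 := h7 w
      rw [← hw] at h9
      rw [h9]
      exact Finset.sum_eq_zero fun j _ => by rw [h8, smul_zero]
    exact h5.ne' h6
  have hsP : ContDiffOn ℝ ∞ (fun y => (A₂ y).inverse) ψ.source := contDiffOn_inverse hA₂ hA₂inv
  let E₁ : E → E := fun y => (A₂ y).inverse (0, 1, 0)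
  have hsE₁ : ContDiffOn ℝ ∞ E₁ ψ.source := hsP.clm_apply contDiffOn_const
  have hAE : ∀ y ∈ ψ.source, A₂ y (E₁ y) = (0, 1, 0) := fun y hy =>
    (((hA₂inv y hy).inverse_apply_eq).1 rfl).symm
  have hηE : ∀ y ∈ ψ.source, ∀ α, S.η α y (E₁ y) = 0 := fun y hy α =>
    congrFun (congrArg Prod.fst (hAE y hy)) α
  have hdhE : ∀ y ∈ ψ.source, fderiv ℝ S.h y (E₁ y) = 1 := fun y hy =>
    congrArg (fun p => p.2.1) (hAE y hy)
  have hGE : ∀ y ∈ ψ.source, ∀ j, S.G y (e j y) (E₁ y) = 0 := fun y hy j =>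
    congrFun (congrArg (fun p => p.2.2) (hAE y hy)) j
  let ρ : E → ℝ := fun y => S.G y (E₁ y) (E₁ y)
  have hρ : ∀ y ∈ ψ.source, 0 < ρ y := fun y hy => S.pos y (hsU hy) _ fun h0 => by
    have := hdhE y hy
    rw [h0, map_zero] at this
    exact zero_ne_one this
  have hsρ : ContDiffOn ℝ ∞ ρ ψ.source :=
    ((S.smooth_G.mono hsU).clm_apply hsE₁).clm_apply hsE₁
  let ι : (ℝ × (Fin r → ℝ)) →L[ℝ] ((Fin m → ℝ) × ℝ × (Fin r → ℝ)) :=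
    ContinuousLinearMap.inr ℝ (Fin m → ℝ) (ℝ × (Fin r → ℝ))
  refine ⟨{
    ψ := ψ
    source_subset := hsU
    π := π
    ψ_apply := fun y => rfl
    smooth_symm := ?_
    e := e
    f := fun y => (ρ y)⁻¹ • E₁ y
    P := fun y => (A₂ y).inverse.comp ι
    smooth_e := hse
    smooth_f := (hsρ.inv fun y hy => (hρ y hy).ne').smul hsE₁
    smooth_P := hsP.clm_comp contDiffOn_const
    η_e := hηe
    dh_e := hdhe
    η_f := fun y hy α => by rw [map_smul, hηE y hy, smul_zero]
    G_f := ?_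
    P_apply := ?_ }, ?_⟩
  · intro p hp
    have hy := ψ.map_target hp
    obtain ⟨E', hE'⟩ := (hsN _ hy).2.2
    refine (ψ.contDiffAt_symm hp (f₀' := E') ?_ (hsm _ (hsU hy))).contDiffWithinAt
    rw [hE']
    exact hder _ (hsU hy)
  · intro y hy w hw
    -- Split `w` into its multiple of `E₁` and a part tangent to the levels of the function, which
    -- is orthogonal to `E₁`.
    have hwz : ∃ z, (∀ α, S.η α y z = 0) ∧ fderiv ℝ S.h y z = 0 ∧
        w = fderiv ℝ S.h y w • E₁ y + z := by
      refine ⟨w - fderiv ℝ S.h y w • E₁ y, fun α => ?_, ?_, by abel⟩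
      · rw [map_sub, map_smul, hw, hηE y hy, smul_zero, sub_zero]
      · rw [map_sub, map_smul, hdhE y hy, smul_eq_mul, mul_one, sub_self]
    obtain ⟨z, hz1, hz2, hwz⟩ := hwz
    have hzs := hspan y hy z hz1 hz2
    have hGz : S.G y z (E₁ y) = 0 := by
      rw [hzs]
      simp only [map_sum, map_smul, sum_apply, smul_apply,
        hGE y hy, smul_zero, Finset.sum_const_zero]
    have hGw : S.G y w (E₁ y) = fderiv ℝ S.h y w * ρ y := by
      conv_lhs => rw [hwz]
      rw [map_add, add_apply, hGz, add_zero, map_smul,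
        smul_apply, smul_eq_mul]
    rw [map_smul, hGw, smul_eq_mul]
    field_simp [(hρ y hy).ne']
  · intro y hy w hw
    change (A₂ y).inverse (0, fderiv ℝ S.h y w, fun j => S.G y w (e j y)) = w
    rw [(hA₂inv y hy).inverse_apply_eq]
    refine Prod.ext ?_ (Prod.ext ?_ ?_)
    · ext α; simpa [A₂] using (hw α).symm
    · simp [A₂]
    · ext j; simpa [A₂] using S.symm y (hsU hy) w (e j y)
  · rw [hψs]
    exact ⟨ContDiffAt.mem_toOpenPartialHomeomorph_source _ _ _, hyN⟩

/-- A smooth cutoff equal to `1` on `K` gives a compactly supported smooth map, which is globally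
Lipschitz and bounded. -/
theorem exists_lipschitz_extension {X Y : Type*} [NormedAddCommGroup X] [NormedSpace ℝ X]
    [FiniteDimensional ℝ X] [NormedAddCommGroup Y] [NormedSpace ℝ Y] {f : X → Y} {Ω K : Set X}
    (hΩ : IsOpen Ω) (hf : ContDiffOn ℝ ∞ f Ω) (hK : IsCompact K) (hKΩ : K ⊆ Ω) :
    ∃ F : X → Y, (∃ L : ℝ≥0, LipschitzWith L F) ∧ (∃ B, ∀ x, ‖F x‖ ≤ B) ∧ EqOn F f K := by
  obtain ⟨K', hK', hKK', hK'Ω⟩ := exists_compact_between hK hΩ hKΩ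
  obtain ⟨χ, hχ0, hχ1, -⟩ := exists_contMDiffMap_zero_one_of_isClosed (n := (⊤ : ℕ∞)) 𝓘(ℝ, X)
    (isOpen_interior (s := K')).isClosed_compl hK.isClosed
    (disjoint_left.2 fun x hx hxK => hx (hKK' hxK))
  have hχs : ContDiff ℝ ∞ χ := χ.contMDiff.contDiff
  have hzero : ∀ x ∉ interior K', χ x = 0 := fun x hx => hχ0 hx
  have hts : tsupport χ ⊆ K' := by
    refine closure_minimal (fun x hx => ?_) hK'.isClosed
    by_contra h
    exact hx (hzero x fun h' => h (interior_subset h'))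
  have hsm : ContDiff ℝ ∞ fun x => χ x • f x := by
    refine contDiff_iff_contDiffAt.2 fun x => ?_
    by_cases hx : x ∈ Ω
    · exact hχs.contDiffAt.smul (hf.contDiffAt (hΩ.mem_nhds hx))
    · have h1 : ∀ᶠ y in 𝓝 x, χ y • f y = 0 := by
        have h2 : K'ᶜ ∈ 𝓝 x := hK'.isClosed.isOpen_compl.mem_nhds fun h => hx (hK'Ω h)
        filter_upwards [h2] with y hy
        rw [hzero y fun h => hy (interior_subset h), zero_smul]
      exact contDiffAt_const.congr_of_eventuallyEq h1
  have hcs : HasCompactSupport fun x => χ x • f x :=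
    HasCompactSupport.intro hK' fun x hx => by
      rw [hzero x fun h => hx (interior_subset h), zero_smul]
  obtain ⟨L, hL⟩ := ContDiff.lipschitzWith_of_hasCompactSupport hcs hsm (by simp)
  obtain ⟨B, hB⟩ := hcs.exists_bound_of_continuous hsm.continuous
  refine ⟨_, ⟨L, hL⟩, ⟨B, hB⟩, fun x hx => ?_⟩
  have : χ x = 1 := hχ1 hx
  simp [this]

/-! ### The equations of motion in adapted coordinates. -/

namespace AdaptedCoords

variable {E : Type*} [NormedAddCommGroup E] [NormedSpace ℝ E] [FiniteDimensional ℝ E] {m a r : ℕ}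
  {S : LocalSystem E m} (C : AdaptedCoords S a r)

/-- The adapted coordinates of a state. -/
def coord (p : E × E) : ℝ × ℝ × (Fin a → ℝ) × (Fin r → ℝ) :=
  (S.h p.1, fderiv ℝ S.h p.1 p.2, C.π p.1, fun j => S.G p.1 p.2 (C.e j p.1))

/-- The state with given adapted coordinates. -/
def lift (x : ℝ × ℝ × (Fin a → ℝ) × (Fin r → ℝ)) : E × E :=
  (C.ψ.symm (x.1, x.2.2.1), C.P (C.ψ.symm (x.1, x.2.2.1)) (x.2.1, x.2.2.2))

/-- The domain of the adapted coordinates. -/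
def domain : Set (ℝ × ℝ × (Fin a → ℝ) × (Fin r → ℝ)) := {x | (x.1, x.2.2.1) ∈ C.ψ.target}

theorem isOpen_domain : IsOpen C.domain :=
  C.ψ.open_target.preimage (by fun_prop)

theorem coord_mem_domain {p : E × E} (hp : p.1 ∈ C.ψ.source) : C.coord p ∈ C.domain := by
  have := C.ψ.map_source hp
  rwa [C.ψ_apply] at this

theorem lift_coord {p : E × E} (hp : p.1 ∈ C.ψ.source) (hη : ∀ α, S.η α p.1 p.2 = 0) :
    C.lift (C.coord p) = p := by
  have h1 : C.ψ.symm (S.h p.1, C.π p.1) = p.1 := by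
    rw [← C.ψ_apply, C.ψ.left_inv hp]
  simp only [lift, coord, h1, C.P_apply _ hp _ hη]

/-- The derivative of the momentum `g(w, v)` along a motion, for a section `v` of the constraint
distribution. -/
def force (S : LocalSystem E m) (v : E → E) (p : E × E) : ℝ :=
  2⁻¹ * fderiv ℝ S.G p.1 (v p.1) p.2 p.2 - fderiv ℝ S.V p.1 (v p.1) +
    S.G p.1 p.2 (fderiv ℝ v p.1 p.2)

/-- The vector field of the motion in adapted coordinates, without its first component. -/
def field (x : ℝ × ℝ × (Fin a → ℝ) × (Fin r → ℝ)) : ℝ × (Fin a → ℝ) × (Fin r → ℝ) :=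
  (force S C.f (C.lift x), C.π (C.lift x).2, fun j => force S (C.e j) (C.lift x))

theorem smooth_fderiv_h : ContDiffOn ℝ ∞ (fderiv ℝ S.h) C.ψ.source :=
  (S.smooth_h.mono C.source_subset).fderiv_of_isOpen C.ψ.open_source (by simp)

theorem contDiffOn_coord : ContDiffOn ℝ ∞ C.coord (Prod.fst ⁻¹' C.ψ.source) := by
  have h1 : ContDiffOn ℝ ∞ (Prod.fst : E × E → E) (Prod.fst ⁻¹' C.ψ.source) := contDiffOn_fst
  have h2 : ContDiffOn ℝ ∞ (Prod.snd : E × E → E) (Prod.fst ⁻¹' C.ψ.source) := contDiffOn_snd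
  have hm : MapsTo (Prod.fst : E × E → E) (Prod.fst ⁻¹' C.ψ.source) C.ψ.source := fun _ h => h
  refine ((S.smooth_h.mono C.source_subset).comp h1 hm).prodMk
    (((C.smooth_fderiv_h.comp h1 hm).clm_apply h2).prodMk
      ((C.π.contDiff.comp_contDiffOn h1).prodMk (contDiffOn_pi.2 fun j => ?_)))
  exact (((S.smooth_G.mono C.source_subset).comp h1 hm).clm_apply h2).clm_apply
    ((C.smooth_e j).comp h1 hm)

theorem contDiffOn_lift : ContDiffOn ℝ ∞ C.lift C.domain := by
  have h1 : ContDiffOn ℝ ∞ (fun x : ℝ × ℝ × (Fin a → ℝ) × (Fin r → ℝ) =>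
      C.ψ.symm (x.1, x.2.2.1)) C.domain :=
    C.smooth_symm.comp (by fun_prop) fun x hx => hx
  refine h1.prodMk ((C.smooth_P.comp h1 fun x hx => C.ψ.map_target hx).clm_apply ?_)
  fun_prop

theorem lift_mem {x : ℝ × ℝ × (Fin a → ℝ) × (Fin r → ℝ)} (hx : x ∈ C.domain) :
    (C.lift x).1 ∈ C.ψ.source := C.ψ.map_target hx

set_option synthInstance.maxHeartbeats 200000 in
set_option maxSynthPendingDepth 3 in
theorem contDiffOn_force {v : E → E} (hv : ContDiffOn ℝ ∞ v C.ψ.source) :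
    ContDiffOn ℝ ∞ (force S v) (Prod.fst ⁻¹' C.ψ.source) := by
  have h1 : ContDiffOn ℝ ∞ (Prod.fst : E × E → E) (Prod.fst ⁻¹' C.ψ.source) := contDiffOn_fst
  have h2 : ContDiffOn ℝ ∞ (Prod.snd : E × E → E) (Prod.fst ⁻¹' C.ψ.source) := contDiffOn_snd
  have hm : MapsTo (Prod.fst : E × E → E) (Prod.fst ⁻¹' C.ψ.source) C.ψ.source := fun _ h => h
  have hG := S.smooth_G.mono C.source_subset
  have hG' : ContDiffOn ℝ ∞ (fderiv ℝ S.G) C.ψ.source :=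
    hG.fderiv_of_isOpen C.ψ.open_source (by simp)
  have hV' : ContDiffOn ℝ ∞ (fderiv ℝ S.V) C.ψ.source :=
    (S.smooth_V.mono C.source_subset).fderiv_of_isOpen C.ψ.open_source (by simp)
  have hv' : ContDiffOn ℝ ∞ (fderiv ℝ v) C.ψ.source := hv.fderiv_of_isOpen C.ψ.open_source (by simp)
  have h3 := ((((hG'.comp h1 hm).clm_apply (hv.comp h1 hm)).clm_apply h2).clm_apply h2)
  exact ((contDiffOn_const.mul h3).sub ((hV'.comp h1 hm).clm_apply (hv.comp h1 hm))).add
    (((hG.comp h1 hm).clm_apply h2).clm_apply ((hv'.comp h1 hm).clm_apply h2))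

theorem contDiffOn_field : ContDiffOn ℝ ∞ C.field C.domain := by
  have h1 := C.contDiffOn_lift
  have hm : MapsTo C.lift C.domain (Prod.fst ⁻¹' C.ψ.source) := fun x hx => C.lift_mem hx
  exact ((C.contDiffOn_force C.smooth_f).comp h1 hm).prodMk
    ((C.π.contDiff.comp_contDiffOn h1.snd).prodMk
      (contDiffOn_pi.2 fun j => (C.contDiffOn_force (C.smooth_e j)).comp h1 hm))

/-- Only the momentum covector and the position are differentiated, never the velocity; `hp'` is the
Lagrange–d'Alembert equation evaluated on `v`. -/
theorem hasDerivAt_momentum {v : E → E} (hv : ContDiffOn ℝ ∞ v C.ψ.source) {x w : ℝ → E} {t : ℝ}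
    (hxt : x t ∈ C.ψ.source) (hx : HasDerivAt x (w t) t) {p' : E →L[ℝ] ℝ}
    (hp : HasDerivAt (fun s => S.G (x s) (w s)) p' t)
    (hp' : p' (v (x t)) = 2⁻¹ * fderiv ℝ S.G (x t) (v (x t)) (w t) (w t) -
      fderiv ℝ S.V (x t) (v (x t))) :
    HasDerivAt (fun s => S.G (x s) (w s) (v (x s))) (force S v (x t, w t)) t := by
  have hvt : HasFDerivAt v (fderiv ℝ v (x t)) (x t) :=
    ((hv.contDiffAt (C.ψ.open_source.mem_nhds hxt)).differentiableAt (by simp)).hasFDerivAt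
  have := hp.clm_apply (hvt.comp_hasDerivAt t hx)
  simp only [Function.comp_apply] at this
  rw [hp'] at this
  exact this

/-- On the distribution the velocity coordinates are momenta along `f` and the `e j`, sections of
the distribution, so the multipliers do not appear and the equation closes in these coordinates. -/
theorem hasDerivAt_coord {x w : ℝ → E} {t : ℝ} (hxt : x t ∈ C.ψ.source)
    (hx : HasDerivAt x (w t) t) (hη : ∀ᶠ s in 𝓝 t, ∀ α, S.η α (x s) (w s) = 0) {p' : E →L[ℝ] ℝ}
    (hp : HasDerivAt (fun s => S.G (x s) (w s)) p' t)
    (hp' : ∀ v, (∀ α, S.η α (x t) v = 0) →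
      p' v = 2⁻¹ * fderiv ℝ S.G (x t) v (w t) (w t) - fderiv ℝ S.V (x t) v) :
    HasDerivAt (fun s => C.coord (x s, w s))
      ((C.coord (x t, w t)).2.1, C.field (C.coord (x t, w t))) t := by
  have hsrc : ∀ᶠ s in 𝓝 t, x s ∈ C.ψ.source :=
    hx.continuousAt.eventually (C.ψ.open_source.mem_nhds hxt)
  have hh : HasFDerivAt S.h (fderiv ℝ S.h (x t)) (x t) :=
    ((S.smooth_h.contDiffAt (S.isOpen_U.mem_nhds (C.source_subset hxt))).differentiableAt
      (by simp)).hasFDerivAt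
  have hu : HasDerivAt (fun s => fderiv ℝ S.h (x s) (w s)) (force S C.f (x t, w t)) t := by
    refine (C.hasDerivAt_momentum C.smooth_f hxt hx hp (hp' _ (C.η_f _ hxt))).congr_of_eventuallyEq ?_
    filter_upwards [hη, hsrc] with s h1 h2
    exact (C.G_f _ h2 _ h1).symm
  have hb : HasDerivAt (fun s => fun j => S.G (x s) (w s) (C.e j (x s)))
      (fun j => force S (C.e j) (x t, w t)) t :=
    hasDerivAt_pi.2 fun j => C.hasDerivAt_momentum (C.smooth_e j) hxt hx hp
      (hp' _ fun α => C.η_e _ hxt α j)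
  have hl : C.lift (C.coord (x t, w t)) = (x t, w t) := C.lift_coord hxt hη.self_of_nhds
  rw [field, hl]
  exact (hh.comp_hasDerivAt t hx).prodMk (hu.prodMk ((C.π.hasFDerivAt.comp_hasDerivAt t hx).prodMk hb))

/-- The states whose position coordinates are in a closed ball and whose velocity coordinates are
bounded by `R`. -/
def box (p₀ : ℝ × (Fin a → ℝ)) (ε R : ℝ) : Set (ℝ × ℝ × (Fin a → ℝ) × (Fin r → ℝ)) :=
  {x | (x.1, x.2.2.1) ∈ Metric.closedBall p₀ ε ∧ |x.2.1| ≤ R ∧ ‖x.2.2.2‖ ≤ R}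

theorem isCompact_box (p₀ : ℝ × (Fin a → ℝ)) (ε R : ℝ) : IsCompact (box (r := r) p₀ ε R) := by
  refine Metric.isCompact_of_isClosed_isBounded ?_ ?_
  · refine (Metric.isClosed_closedBall.preimage (by fun_prop)).inter ?_
    exact (isClosed_le continuous_snd.fst.abs continuous_const).inter
      (isClosed_le continuous_snd.snd.snd.norm continuous_const)
  · refine (Metric.isBounded_closedBall (x := (p₀.1, (0 : ℝ), p₀.2, (0 : Fin r → ℝ)))
      (r := max ε R)).subset fun x hx => ?_
    obtain ⟨h1, h2, h3⟩ := hx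
    rw [Metric.mem_closedBall, Prod.dist_eq, max_le_iff] at h1
    simp only [Metric.mem_closedBall, Prod.dist_eq, max_le_iff, dist_zero_right]
    exact ⟨h1.1.trans (le_max_left _ _), h2.trans (le_max_right _ _), h1.2.trans (le_max_left _ _),
      h3.trans (le_max_right _ _)⟩

theorem exists_extension {p₀ : ℝ × (Fin a → ℝ)} {ε : ℝ}
    (hε : Metric.closedBall p₀ ε ⊆ C.ψ.target) (R : ℝ) :
    ∃ F : ℝ × ℝ × (Fin a → ℝ) × (Fin r → ℝ) → ℝ × (Fin a → ℝ) × (Fin r → ℝ),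
      (∃ L : ℝ≥0, LipschitzWith L F) ∧ (∃ B, ∀ x, ‖F x‖ ≤ B) ∧ EqOn F C.field (box p₀ ε R) :=
  exists_lipschitz_extension C.isOpen_domain C.contDiffOn_field (isCompact_box p₀ ε R)
    fun _ hx => hε hx.1

end AdaptedCoords

/-! ### Coordinates of the tangent bundle over a chart. -/

abbrev Vec (n : ℕ) := EuclideanSpace ℝ (Fin n)

section TangentCoordinates

variable {n : ℕ} {Q : Type*} [TopologicalSpace Q]
  [ChartedSpace (EuclideanSpace ℝ (Fin n)) Q] [IsManifold (𝓡 n) ∞ Q]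

/-- The derivative of the chart at `q₀`. -/
def dchart (q₀ q : Q) : Vec n →L[ℝ] Vec n :=
  mfderiv (𝓡 n) 𝓘(ℝ, Vec n) (extChartAt (𝓡 n) q₀) q

/-- The derivative of the inverse of the chart at `q₀`. -/
def dchartSymm (q₀ : Q) (y : Vec n) : Vec n →L[ℝ] Vec n :=
  mfderiv 𝓘(ℝ, Vec n) (𝓡 n) (extChartAt (𝓡 n) q₀).symm y

/-- The coordinates, in the chart at `q₀`, of a position and of a velocity. -/
def tcoord (q₀ : Q) (v : TangentBundle (𝓡 n) Q) : Vec n × Vec n :=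
  (extChartAt (𝓡 n) q₀ v.proj, dchart q₀ v.proj v.snd)

/-- The state with given coordinates in the chart at `q₀`. -/
def ofCoord (q₀ : Q) (p : Vec n × Vec n) : TangentBundle (𝓡 n) Q :=
  ⟨(extChartAt (𝓡 n) q₀).symm p.1, dchartSymm q₀ p.1 p.2⟩

theorem isManifold_one : IsManifold (𝓡 n) 1 Q := IsManifold.of_le (n := ∞) (by simp)

theorem mdifferentiableAt_chart {q₀ q : Q} (hq : q ∈ (extChartAt (𝓡 n) q₀).source) :
    MDifferentiableAt (𝓡 n) 𝓘(ℝ, Vec n) (extChartAt (𝓡 n) q₀) q := by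
  have := isManifold_one (n := n) (Q := Q)
  rw [extChartAt_source] at hq
  exact mdifferentiableAt_extChartAt hq

theorem mdifferentiableAt_chart_symm {q₀ : Q} {y : Vec n} (hy : y ∈ (extChartAt (𝓡 n) q₀).target) :
    MDifferentiableAt 𝓘(ℝ, Vec n) (𝓡 n) (extChartAt (𝓡 n) q₀).symm y := by
  have := isManifold_one (n := n) (Q := Q)
  have h := mdifferentiableWithinAt_extChartAt_symm (I := 𝓡 n) hy
  rw [ModelWithCorners.Boundaryless.range_eq_univ] at h
  exact mdifferentiableWithinAt_univ.1 h

theorem dchart_dchartSymm {q₀ : Q} {y : Vec n} (hy : y ∈ (extChartAt (𝓡 n) q₀).target) (w : Vec n) :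
    dchart q₀ ((extChartAt (𝓡 n) q₀).symm y) (dchartSymm q₀ y w) = w := by
  have := isManifold_one (n := n) (Q := Q)
  have h := mfderiv_extChartAt_comp_mfderivWithin_extChartAt_symm (I := 𝓡 n) hy
  have h2 : mfderivWithin 𝓘(ℝ, Vec n) (𝓡 n) (extChartAt (𝓡 n) q₀).symm (range (𝓡 n)) y =
      mfderiv 𝓘(ℝ, Vec n) (𝓡 n) (extChartAt (𝓡 n) q₀).symm y := by
    rw [ModelWithCorners.Boundaryless.range_eq_univ, mfderivWithin_univ]
  rw [h2] at h
  exact congrArg (fun f : Vec n →L[ℝ] Vec n => f w) h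

theorem dchartSymm_dchart {q₀ q : Q} (hq : q ∈ (extChartAt (𝓡 n) q₀).source) (w : Vec n) :
    dchartSymm q₀ (extChartAt (𝓡 n) q₀ q) (dchart q₀ q w) = w := by
  have := isManifold_one (n := n) (Q := Q)
  have h := mfderivWithin_extChartAt_symm_comp_mfderiv_extChartAt' (I := 𝓡 n) hq
  have h2 : mfderivWithin 𝓘(ℝ, Vec n) (𝓡 n) (extChartAt (𝓡 n) q₀).symm (range (𝓡 n))
      (extChartAt (𝓡 n) q₀ q) =
      mfderiv 𝓘(ℝ, Vec n) (𝓡 n) (extChartAt (𝓡 n) q₀).symm (extChartAt (𝓡 n) q₀ q) := by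
    rw [ModelWithCorners.Boundaryless.range_eq_univ, mfderivWithin_univ]
  rw [h2] at h
  exact congrArg (fun f : Vec n →L[ℝ] Vec n => f w) h

theorem tcoord_ofCoord {q₀ : Q} {p : Vec n × Vec n} (hp : p.1 ∈ (extChartAt (𝓡 n) q₀).target) :
    tcoord q₀ (ofCoord q₀ p) = p :=
  Prod.ext ((extChartAt (𝓡 n) q₀).right_inv hp) (dchart_dchartSymm hp p.2)

theorem ofCoord_tcoord {q₀ : Q} {v : TangentBundle (𝓡 n) Q}
    (hv : v.proj ∈ (extChartAt (𝓡 n) q₀).source) : ofCoord q₀ (tcoord q₀ v) = v := by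
  obtain ⟨q, w⟩ := v
  change (⟨(extChartAt (𝓡 n) q₀).symm (extChartAt (𝓡 n) q₀ q),
    dchartSymm q₀ (extChartAt (𝓡 n) q₀ q) (dchart q₀ q w)⟩ : TangentBundle (𝓡 n) Q) = ⟨q, w⟩
  have h : ∀ (q' : Q) (w' : Vec n), q' = q → w' = w →
      (⟨q', w'⟩ : TangentBundle (𝓡 n) Q) = ⟨q, w⟩ := by
    rintro _ _ rfl rfl
    rfl
  exact h _ _ ((extChartAt (𝓡 n) q₀).left_inv hv) (dchartSymm_dchart hv w)

theorem continuousOn_tcoord (q₀ : Q) :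
    ContinuousOn (tcoord (n := n) q₀) {v | v.proj ∈ (extChartAt (𝓡 n) q₀).source} := by
  have := isManifold_one (n := n) (Q := Q)
  have ho := isOpen_extChartAt_source (I := 𝓡 n) q₀
  have h1 : ContMDiffOn (𝓡 n) 𝓘(ℝ, Vec n) 1 (extChartAt (𝓡 n) q₀) (extChartAt (𝓡 n) q₀).source := by
    rw [extChartAt_source]; exact contMDiffOn_extChartAt
  have h2 := h1.continuousOn_tangentMapWithin le_rfl ho.uniqueMDiffOn
  have h3 := ((tangentBundleModelSpaceHomeomorph 𝓘(ℝ, Vec n)).continuous).comp_continuousOn h2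
  refine h3.congr fun v hv => ?_
  refine Prod.ext rfl ?_
  change mfderiv (𝓡 n) 𝓘(ℝ, Vec n) (extChartAt (𝓡 n) q₀) v.proj v.snd =
    mfderivWithin (𝓡 n) 𝓘(ℝ, Vec n) (extChartAt (𝓡 n) q₀) (extChartAt (𝓡 n) q₀).source v.proj v.snd
  rw [mfderivWithin_of_isOpen ho hv]

theorem contMDiffOn_tangentMapWithin_chart_symm (q₀ : Q) :
    ContMDiffOn 𝓘(ℝ, Vec n).tangent (𝓡 n).tangent ∞
      (tangentMapWithin 𝓘(ℝ, Vec n) (𝓡 n) (extChartAt (𝓡 n) q₀).symm (extChartAt (𝓡 n) q₀).target)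
      (Bundle.TotalSpace.proj ⁻¹' (extChartAt (𝓡 n) q₀).target) := by
  have := isManifold_one (n := n) (Q := Q)
  have ho := isOpen_extChartAt_target (I := 𝓡 n) q₀
  exact (contMDiffOn_extChartAt_symm (n := ∞) q₀).contMDiffOn_tangentMapWithin (by simp)
    ho.uniqueMDiffOn

theorem tangentMapWithin_chart_symm (q₀ : Q) {p : Vec n × Vec n}
    (hp : p.1 ∈ (extChartAt (𝓡 n) q₀).target) :
    tangentMapWithin 𝓘(ℝ, Vec n) (𝓡 n) (extChartAt (𝓡 n) q₀).symm (extChartAt (𝓡 n) q₀).target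
      (⟨p.1, p.2⟩ : TangentBundle 𝓘(ℝ, Vec n) (Vec n)) = ofCoord q₀ p := by
  have ho := isOpen_extChartAt_target (I := 𝓡 n) q₀
  unfold tangentMapWithin ofCoord
  congr 1
  change mfderivWithin 𝓘(ℝ, Vec n) (𝓡 n) (extChartAt (𝓡 n) q₀).symm (extChartAt (𝓡 n) q₀).target
    p.1 p.2 = mfderiv 𝓘(ℝ, Vec n) (𝓡 n) (extChartAt (𝓡 n) q₀).symm p.1 p.2
  rw [mfderivWithin_of_isOpen ho hp]

theorem continuousOn_ofCoord (q₀ : Q) :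
    ContinuousOn (ofCoord (n := n) q₀) {p | p.1 ∈ (extChartAt (𝓡 n) q₀).target} := by
  have h1 := (contMDiffOn_tangentMapWithin_chart_symm (n := n) q₀).continuousOn
  have h2 : Continuous fun p : Vec n × Vec n =>
      (⟨p.1, p.2⟩ : TangentBundle 𝓘(ℝ, Vec n) (Vec n)) :=
    (tangentBundleModelSpaceHomeomorph 𝓘(ℝ, Vec n)).symm.continuous
  refine (h1.comp h2.continuousOn fun p hp => hp).congr fun p hp => ?_
  exact (tangentMapWithin_chart_symm q₀ hp).symm

/-- Constant coordinate vector fields are smooth; evaluating one-forms and the metric on them yields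
smoothness of their coordinate expressions. -/
theorem contMDiffOn_ofCoord (q₀ : Q) (w : Vec n) :
    ContMDiffOn 𝓘(ℝ, Vec n) (𝓡 n).tangent ∞ (fun y => ofCoord q₀ (y, w))
      (extChartAt (𝓡 n) q₀).target := by
  have h1 := contMDiffOn_tangentMapWithin_chart_symm (n := n) q₀
  have h2 : ContMDiffOn 𝓘(ℝ, Vec n) 𝓘(ℝ, Vec n).tangent ∞
      (fun y : Vec n => (⟨y, w⟩ : TangentBundle 𝓘(ℝ, Vec n) (Vec n))) (extChartAt (𝓡 n) q₀).target :=
    contMDiffOn_vectorSpace_iff_contDiffOn.2 contDiffOn_const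
  refine (h1.comp h2 fun p hp => hp).congr fun y hy => ?_
  exact (tangentMapWithin_chart_symm q₀ (p := (y, w)) hy).symm

/-- The transition map between two charts. -/
theorem contDiffOn_transition (q₀ q₁ : Q) :
    ContDiffOn ℝ ∞ (extChartAt (𝓡 n) q₁ ∘ (extChartAt (𝓡 n) q₀).symm)
      ((extChartAt (𝓡 n) q₀).target ∩
        (extChartAt (𝓡 n) q₀).symm ⁻¹' (extChartAt (𝓡 n) q₁).source) := by
  rw [← contMDiffOn_iff_contDiffOn]
  have h1 : ContMDiffOn (𝓡 n) 𝓘(ℝ, Vec n) ∞ (extChartAt (𝓡 n) q₁) (extChartAt (𝓡 n) q₁).source := by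
    rw [extChartAt_source]; exact contMDiffOn_extChartAt
  exact h1.comp ((contMDiffOn_extChartAt_symm q₀).mono inter_subset_left) fun y hy => hy.2

theorem isOpen_transition_domain (q₀ q₁ : Q) :
    IsOpen ((extChartAt (𝓡 n) q₀).target ∩
        (extChartAt (𝓡 n) q₀).symm ⁻¹' (extChartAt (𝓡 n) q₁).source) :=
  (continuousOn_extChartAt_symm q₀).isOpen_inter_preimage (isOpen_extChartAt_target q₀)
    (isOpen_extChartAt_source q₁)

theorem tcoord_ofCoord_eq {q₀ q₁ : Q} {p : Vec n × Vec n}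
    (hp : p.1 ∈ (extChartAt (𝓡 n) q₀).target)
    (hp' : (extChartAt (𝓡 n) q₀).symm p.1 ∈ (extChartAt (𝓡 n) q₁).source) :
    tcoord q₁ (ofCoord q₀ p) = ((extChartAt (𝓡 n) q₁ ∘ (extChartAt (𝓡 n) q₀).symm) p.1,
      fderiv ℝ (extChartAt (𝓡 n) q₁ ∘ (extChartAt (𝓡 n) q₀).symm) p.1 p.2) := by
  refine Prod.ext rfl ?_
  have h := mfderiv_comp p.1 (mdifferentiableAt_chart hp') (mdifferentiableAt_chart_symm hp)
  rw [mfderiv_eq_fderiv] at h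
  exact (congrArg (fun f : Vec n →L[ℝ] Vec n => f p.2) h).symm

theorem differentiableAt_tcoord_ofCoord {q₀ q₁ : Q} {p : Vec n × Vec n}
    (hp : p.1 ∈ (extChartAt (𝓡 n) q₀).target)
    (hp' : (extChartAt (𝓡 n) q₀).symm p.1 ∈ (extChartAt (𝓡 n) q₁).source) :
    DifferentiableAt ℝ (fun p => tcoord q₁ (ofCoord (n := n) q₀ p)) p := by
  have ho := isOpen_transition_domain (n := n) q₀ q₁
  have hs := contDiffOn_transition (n := n) q₀ q₁
  have h1 : ∀ᶠ p' in 𝓝 p, p'.1 ∈ (extChartAt (𝓡 n) q₀).target ∩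
      (extChartAt (𝓡 n) q₀).symm ⁻¹' (extChartAt (𝓡 n) q₁).source :=
    continuous_fst.continuousAt.eventually (ho.mem_nhds ⟨hp, hp'⟩)
  have h2 : DifferentiableAt ℝ (fun p : Vec n × Vec n =>
      ((extChartAt (𝓡 n) q₁ ∘ (extChartAt (𝓡 n) q₀).symm) p.1,
      fderiv ℝ (extChartAt (𝓡 n) q₁ ∘ (extChartAt (𝓡 n) q₀).symm) p.1 p.2)) p := by
    have h3 := (hs.contDiffAt (ho.mem_nhds ⟨hp, hp'⟩)).differentiableAt (by simp)
    have h4 := ((hs.fderiv_of_isOpen ho (m := ∞) (by simp)).contDiffAt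
      (ho.mem_nhds ⟨hp, hp'⟩)).differentiableAt (by simp)
    exact (h3.comp p differentiableAt_fst).prodMk
      ((h4.comp p differentiableAt_fst).clm_apply differentiableAt_snd)
  refine h2.congr_of_eventuallyEq ?_
  filter_upwards [h1] with p' hp'
  exact tcoord_ofCoord_eq hp'.1 hp'.2

end TangentCoordinates

/-! ### The impact system in a chart. -/

namespace ImpactSystem

variable {n m : ℕ} {Q : Type*} [TopologicalSpace Q]
  [ChartedSpace (EuclideanSpace ℝ (Fin n)) Q] [IsManifold (𝓡 n) ∞ Q] (M : ImpactSystem n m Q)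

/-- The metric in the chart around `q₀`. -/
def coordG (q₀ : Q) (y : Vec n) : Vec n →L[ℝ] Vec n →L[ℝ] ℝ :=
  ContinuousLinearMap.bilinearComp (M.metric.inner ((extChartAt (𝓡 n) q₀).symm y))
    (dchartSymm q₀ y) (dchartSymm q₀ y)

theorem coordLagrangian_eq (q₀ : Q) (y w : Vec n) :
    M.coordLagrangian q₀ y w = M.coordG q₀ y w w / 2 - M.V ((extChartAt (𝓡 n) q₀).symm y) := rfl

theorem contDiffOn_coordη (q₀ : Q) (α : Fin m) :
    ContDiffOn ℝ ∞ (M.coordη q₀ α) (extChartAt (𝓡 n) q₀).target := by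
  refine contDiffOn_clm_apply.2 fun w => ?_
  rw [← contMDiffOn_iff_contDiffOn]
  exact (M.η_smooth α).comp_contMDiffOn (contMDiffOn_ofCoord q₀ w)

theorem contDiffOn_coordG (q₀ : Q) :
    ContDiffOn ℝ ∞ (M.coordG q₀) (extChartAt (𝓡 n) q₀).target := by
  refine contDiffOn_clm_apply.2 fun w => contDiffOn_clm_apply.2 fun w' => ?_
  rw [← contMDiffOn_iff_contDiffOn]
  have h1 : ContMDiffOn 𝓘(ℝ, Vec n) ((𝓡 n).prod 𝓘(ℝ, ℝ)) ∞
      (fun y => Bundle.TotalSpace.mk' ℝ (E := Bundle.Trivial Q ℝ) ((extChartAt (𝓡 n) q₀).symm y)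
        (M.metric.inner ((extChartAt (𝓡 n) q₀).symm y)
          (ofCoord q₀ (y, w)).snd (ofCoord q₀ (y, w')).snd)) (extChartAt (𝓡 n) q₀).target := by
    refine ContMDiffOn.clm_bundle_apply₂ (F₁ := Vec n) (F₂ := Vec n) ?_ (contMDiffOn_ofCoord q₀ w)
      (contMDiffOn_ofCoord q₀ w')
    exact M.metric.contMDiff.comp_contMDiffOn (contMDiffOn_extChartAt_symm q₀)
  intro y hy
  have h2 := h1 y hy
  simp only [Bundle.contMDiffWithinAt_totalSpace] at h2
  exact h2.2

theorem contDiffOn_chart_symm {f : Q → ℝ} (hf : ContMDiff (𝓡 n) 𝓘(ℝ, ℝ) ∞ f) (q₀ : Q) :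
    ContDiffOn ℝ ∞ (fun y => f ((extChartAt (𝓡 n) q₀).symm y)) (extChartAt (𝓡 n) q₀).target := by
  rw [← contMDiffOn_iff_contDiffOn]
  exact hf.comp_contMDiffOn (contMDiffOn_extChartAt_symm q₀)

theorem dchartSymm_injective {q₀ : Q} {y : Vec n} (hy : y ∈ (extChartAt (𝓡 n) q₀).target) :
    Function.Injective (dchartSymm q₀ y) := fun w w' h => by
  rw [← dchart_dchartSymm hy w, h, dchart_dchartSymm hy]

theorem dchartSymm_surjective {q₀ : Q} {y : Vec n} (hy : y ∈ (extChartAt (𝓡 n) q₀).target) :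
    Function.Surjective (dchartSymm q₀ y) :=
  LinearMap.surjective_of_injective (f := (dchartSymm q₀ y : Vec n →ₗ[ℝ] Vec n))
    (dchartSymm_injective hy)

theorem coordG_pos {q₀ : Q} {y : Vec n} (hy : y ∈ (extChartAt (𝓡 n) q₀).target) {w : Vec n}
    (hw : w ≠ 0) : 0 < M.coordG q₀ y w w := by
  refine M.metric.pos _ (dchartSymm q₀ y w) fun h0 => hw ?_
  have h1 : dchartSymm q₀ y w = dchartSymm q₀ y 0 := by
    rw [map_zero]; exact h0
  exact dchartSymm_injective hy h1

/-- The expressions of the system in the chart around `q₀`, with a function `h` given in this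
chart. -/
def localSystem (q₀ : Q) (h : Vec n → ℝ)
    (hh : ContDiffOn ℝ ∞ h (extChartAt (𝓡 n) q₀).target) : LocalSystem (Vec n) m where
  U := (extChartAt (𝓡 n) q₀).target
  isOpen_U := isOpen_extChartAt_target q₀
  G := M.coordG q₀
  η := M.coordη q₀
  V := fun y => M.V ((extChartAt (𝓡 n) q₀).symm y)
  h := h
  smooth_G := M.contDiffOn_coordG q₀
  smooth_η := M.contDiffOn_coordη q₀
  smooth_V := contDiffOn_chart_symm M.V_smooth q₀
  smooth_h := hh
  symm _ _ _ _ := M.metric.symm _ _ _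
  pos _ hy _ hw := M.coordG_pos hy hw

theorem sum_smul_clm_apply {ι E : Type*} [Fintype ι] [NormedAddCommGroup E] [NormedSpace ℝ E]
    (f : ι → E →L[ℝ] ℝ) (c : ι → ℝ) (w : E) : (∑ i, c i • f i) w = ∑ i, c i * f i w := by
  simp [sum_apply]

theorem linearIndependent_coordη {q₀ : Q} {y : Vec n} (hy : y ∈ (extChartAt (𝓡 n) q₀).target) :
    LinearIndependent ℝ fun α => M.coordη q₀ α y := by
  rw [Fintype.linearIndependent_iff]
  intro c hc
  have h2 : ∑ α, c α • (M.η α ((extChartAt (𝓡 n) q₀).symm y) : Vec n →L[ℝ] ℝ) = 0 := by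
    refine ContinuousLinearMap.ext fun w => ?_
    obtain ⟨w', rfl⟩ := dchartSymm_surjective hy w
    have h := congrArg (fun f : Vec n →L[ℝ] ℝ => f w') hc
    simp only [sum_apply, smul_apply] at h
    exact (sum_smul_clm_apply (E := Vec n) _ c _).trans h
  exact Fintype.linearIndependent_iff.1 (M.η_linearIndependent ((extChartAt (𝓡 n) q₀).symm y)) c h2

theorem fderiv_h_chart {q₀ : Q} {y : Vec n} (hy : y ∈ (extChartAt (𝓡 n) q₀).target) (w : Vec n) :
    fderiv ℝ (fun y => M.h ((extChartAt (𝓡 n) q₀).symm y)) y w =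
      M.dh (ofCoord q₀ (y, w)).proj (ofCoord q₀ (y, w)).snd := by
  have h := mfderiv_comp y ((M.h_smooth.mdifferentiable (by simp)) _)
    (mdifferentiableAt_chart_symm (q₀ := q₀) hy)
  rw [mfderiv_eq_fderiv] at h
  exact congrArg (fun f : Vec n →L[ℝ] ℝ => f w) h

theorem fderiv_h_notMem_span {q₀ : Q} {y : Vec n} (hy : y ∈ (extChartAt (𝓡 n) q₀).target)
    (h0 : M.h ((extChartAt (𝓡 n) q₀).symm y) = 0) :
    fderiv ℝ (fun y => M.h ((extChartAt (𝓡 n) q₀).symm y)) y ∉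
      Submodule.span ℝ (range fun α => M.coordη q₀ α y) := by
  intro hmem
  obtain ⟨c, hc⟩ := (Submodule.mem_span_range_iff_exists_fun ℝ).1 hmem
  have h2 : ∑ α, c α • (M.η α ((extChartAt (𝓡 n) q₀).symm y) : Vec n →L[ℝ] ℝ) =
      M.dh ((extChartAt (𝓡 n) q₀).symm y) := by
    refine ContinuousLinearMap.ext fun w => ?_
    obtain ⟨w', rfl⟩ := dchartSymm_surjective hy w
    have h := congrArg (fun f : Vec n →L[ℝ] ℝ => f w') hc
    simp only [M.fderiv_h_chart hy w', sum_apply, smul_apply] at h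
    exact (sum_smul_clm_apply (E := Vec n) _ c _).trans h
  exact M.nontrivial_impact _ h0 ((Submodule.mem_span_range_iff_exists_fun (M := Vec n →L[ℝ] ℝ) ℝ).2 ⟨c, h2⟩)

end ImpactSystem

theorem hasDerivAt_of_comp_toSpanSingleton {E F : Type*} [NormedAddCommGroup E] [NormedSpace ℝ E]
    [NormedAddCommGroup F] [NormedSpace ℝ F] {f : ℝ → F} {A : E →L[ℝ] F} {v : E} {t : ℝ}
    (h : HasFDerivAt f (A.comp (ContinuousLinearMap.toSpanSingleton ℝ v)) t) :
    HasDerivAt f (A v) t := by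
  simpa using h.hasDerivAt

variable {n m : ℕ} {Q : Type*} [TopologicalSpace Q]
  [ChartedSpace (EuclideanSpace ℝ (Fin n)) Q] [IsManifold (𝓡 n) ∞ Q]

/-! ### Free motions in a chart. -/

namespace ImpactSystem

variable (M : ImpactSystem n m Q)

theorem continuous_proj : Continuous fun v : TangentBundle (𝓡 n) Q => v.proj :=
  FiberBundle.continuous_proj _ _

theorem continuous_dh : Continuous fun v : TangentBundle (𝓡 n) Q => M.dh v.proj v.snd := by
  have := isManifold_one (n := n) (Q := Q)
  have h1 : Continuous (tangentMap (𝓡 n) 𝓘(ℝ, ℝ) M.h) := M.h_smooth.continuous_tangentMap (by simp)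
  exact (continuous_snd.comp (tangentBundleModelSpaceHomeomorph 𝓘(ℝ, ℝ)).continuous).comp h1

theorem coordη_tcoord {q₀ : Q} (α : Fin m) {v : TangentBundle (𝓡 n) Q}
    (hv : v.proj ∈ (extChartAt (𝓡 n) q₀).source) :
    M.coordη q₀ α (tcoord q₀ v).1 (tcoord q₀ v).2 = M.η α v.proj v.snd := by
  have h := congrArg (fun v : TangentBundle (𝓡 n) Q => M.η α v.proj v.snd) (ofCoord_tcoord hv)
  exact h

theorem coordη_tcoord_eq_zero {q₀ : Q} {v : TangentBundle (𝓡 n) Q} (hD : v ∈ M.D)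
    (hv : v.proj ∈ (extChartAt (𝓡 n) q₀).source) (α : Fin m) :
    M.coordη q₀ α (tcoord q₀ v).1 (tcoord q₀ v).2 = 0 := (M.coordη_tcoord α hv).trans (hD α)

theorem fderiv_coordLagrangian_velocity {q₀ : Q} (y w : Vec n) :
    fderiv ℝ (fun w => M.coordLagrangian q₀ y w) w = M.coordG q₀ y w := by
  have hs : ∀ w w', M.coordG q₀ y w w' = M.coordG q₀ y w' w := fun w w' => M.metric.symm _ _ _
  have h1 : HasFDerivAt (fun w => M.coordLagrangian q₀ y w) (M.coordG q₀ y w) w := by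
    have h2 : HasFDerivAt (fun w => M.coordG q₀ y w w)
        ((M.coordG q₀ y w).comp (ContinuousLinearMap.id ℝ (Vec n)) + (M.coordG q₀ y).flip w) w :=
      (M.coordG q₀ y).hasFDerivAt.clm_apply (hasFDerivAt_id w)
    have h3 := (h2.const_mul (2⁻¹ : ℝ)).sub_const (M.V ((extChartAt (𝓡 n) q₀).symm y))
    have h4 : (fun w => M.coordLagrangian q₀ y w) = fun w =>
        2⁻¹ * M.coordG q₀ y w w - M.V ((extChartAt (𝓡 n) q₀).symm y) := by
      ext w; rw [coordLagrangian_eq]; ring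
    rw [h4]
    have h5 : (2⁻¹ : ℝ) • ((M.coordG q₀ y w).comp (ContinuousLinearMap.id ℝ (Vec n)) +
        (M.coordG q₀ y).flip w) = M.coordG q₀ y w := by
      ext w'
      have := hs w' w
      simp only [smul_apply, add_apply, ContinuousLinearMap.comp_id, ContinuousLinearMap.flip_apply,
        smul_eq_mul]
      linarith
    exact h5 ▸ h3
  exact h1.fderiv

theorem fderiv_coordLagrangian_position {q₀ : Q} {y : Vec n}
    (hy : y ∈ (extChartAt (𝓡 n) q₀).target) (w v : Vec n) :
    fderiv ℝ (fun y => M.coordLagrangian q₀ y w) y v =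
      2⁻¹ * fderiv ℝ (M.coordG q₀) y v w w -
        fderiv ℝ (fun y => M.V ((extChartAt (𝓡 n) q₀).symm y)) y v := by
  have ho := (isOpen_extChartAt_target (I := 𝓡 n) q₀).mem_nhds hy
  have hG := (((M.contDiffOn_coordG q₀).contDiffAt ho).differentiableAt (by simp)).hasFDerivAt
  have hV := (((contDiffOn_chart_symm M.V_smooth q₀).contDiffAt ho).differentiableAt
    (by simp)).hasFDerivAt
  have h2 := (((hG.clm_apply (hasFDerivAt_const w y)).clm_apply
    (hasFDerivAt_const w y)).const_mul (2⁻¹ : ℝ)).sub hV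
  have h4 : (fun y => M.coordLagrangian q₀ y w) = fun y =>
      2⁻¹ * M.coordG q₀ y w w - M.V ((extChartAt (𝓡 n) q₀).symm y) := by
    ext y; rw [coordLagrangian_eq]; ring
  rw [h4]
  erw [h2.fderiv]
  simp

/-- Coordinates and momentum of a free motion, in a chart. -/
theorem IsFreeMotionOn.coordinates {M : ImpactSystem n m Q} {c : ℝ → TangentBundle (𝓡 n) Q}
    {J : Set ℝ} (hc : M.IsFreeMotionOn c J) (hJ : IsOpen J) {t : ℝ} (ht : t ∈ J) {q₀ : Q}
    (hq : (c t).proj ∈ (extChartAt (𝓡 n) q₀).source) :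
    HasDerivAt (fun s => (tcoord q₀ (c s)).1) (tcoord q₀ (c t)).2 t ∧
    (∀ᶠ s in 𝓝 t, ∀ α, M.coordη q₀ α (tcoord q₀ (c s)).1 (tcoord q₀ (c s)).2 = 0) ∧
    ∃ p' : Vec n →L[ℝ] ℝ,
      HasDerivAt (fun s => M.coordG q₀ (tcoord q₀ (c s)).1 (tcoord q₀ (c s)).2) p' t ∧
      ∀ v, (∀ α, M.coordη q₀ α (tcoord q₀ (c t)).1 v = 0) → p' v =
        2⁻¹ * fderiv ℝ (M.coordG q₀) (tcoord q₀ (c t)).1 v (tcoord q₀ (c t)).2 (tcoord q₀ (c t)).2 -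
        fderiv ℝ (fun y => M.V ((extChartAt (𝓡 n) q₀).symm y)) (tcoord q₀ (c t)).1 v := by
  have hd : ∀ s ∈ J, (c s).proj ∈ (extChartAt (𝓡 n) q₀).source →
      HasDerivAt (fun s => (tcoord q₀ (c s)).1) (tcoord q₀ (c s)).2 s := by
    intro s hs hqs
    have h1 := HasMFDerivAt.comp s (mdifferentiableAt_chart hqs).hasMFDerivAt (hc s hs).2.1
    have h2 : HasFDerivAt (fun s => (tcoord q₀ (c s)).1) ((dchart q₀ (c s).proj).comp
        (ContinuousLinearMap.toSpanSingleton ℝ ((c s).snd : Vec n))) s :=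
      hasMFDerivAt_iff_hasFDerivAt.1 h1
    exact hasDerivAt_of_comp_toSpanSingleton h2
  have hsrc : ∀ᶠ s in 𝓝 t, s ∈ J ∧ (c s).proj ∈ (extChartAt (𝓡 n) q₀).source :=
    (hJ.eventually_mem ht).and
      ((hc t ht).2.1.continuousAt.eventually ((isOpen_extChartAt_source q₀).mem_nhds hq))
  refine ⟨hd t ht hq, ?_, ?_⟩
  · filter_upwards [hsrc] with s hs
    exact M.coordη_tcoord_eq_zero (hc s hs.1).1 hs.2
  · obtain ⟨mult, hm⟩ := (hc t ht).2.2 q₀ hq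
    refine ⟨_, hm.congr_of_eventuallyEq ?_, fun v hv => ?_⟩
    · filter_upwards [hsrc] with s hs
      have h1 : deriv (fun s => extChartAt (𝓡 n) q₀ (c s).proj) s = (tcoord q₀ (c s)).2 :=
        (hd s hs.1 hs.2).deriv
      rw [h1]
      exact (M.fderiv_coordLagrangian_velocity _ _).symm
    · have h1 : deriv (fun s => extChartAt (𝓡 n) q₀ (c s).proj) t = (tcoord q₀ (c t)).2 :=
        (hd t ht hq).deriv
      rw [h1, add_apply, M.fderiv_coordLagrangian_position
        ((extChartAt (𝓡 n) q₀).map_source hq), sum_smul_clm_apply]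
      -- The constraint forces do no work along the distribution.
      have h2 : ∑ α, mult α * M.coordη q₀ α (extChartAt (𝓡 n) q₀ (c t).proj) v = 0 :=
        Finset.sum_eq_zero fun α _ => by rw [show M.coordη q₀ α
          (extChartAt (𝓡 n) q₀ (c t).proj) v = 0 from hv α, mul_zero]
      rw [h2, add_zero]
      rfl

theorem IsFreeMotionOn.hasDerivAt_h {M : ImpactSystem n m Q} {c : ℝ → TangentBundle (𝓡 n) Q}
    {J : Set ℝ} (hc : M.IsFreeMotionOn c J) {t : ℝ} (ht : t ∈ J) :
    HasDerivAt (fun s => M.h (c s).proj) (M.dh (c t).proj (c t).snd) t := by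
  have h1 := HasMFDerivAt.comp t ((M.h_smooth.mdifferentiable (by simp)) (c t).proj).hasMFDerivAt
    (hc t ht).2.1
  let A : Vec n →L[ℝ] ℝ := M.dh (c t).proj
  let v : Vec n := (c t).snd
  have h2 : HasFDerivAt (fun s => M.h (c s).proj)
      (A.comp (ContinuousLinearMap.toSpanSingleton ℝ v)) t := hasMFDerivAt_iff_hasFDerivAt.1 h1
  exact hasDerivAt_of_comp_toSpanSingleton h2

end ImpactSystem

/-! ### The impact as an orthogonal reflection within the distribution. -/

section ImpactAlgebra

variable {E : Type*} [NormedAddCommGroup E] [NormedSpace ℝ E] {m : ℕ}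
  {g : E →L[ℝ] E →L[ℝ] ℝ} {η : Fin m → E →L[ℝ] ℝ} {W : Fin m → E}

/-- A kernel vector `x` gives `w = ∑ x β • W β` annihilated by every `η α`, while `g(w, w) = ∑ x β *
η β w`. So `w = 0`, and independence of the one-forms gives `x = 0`. -/
theorem isUnit_det_gram (hpos : ∀ w, w ≠ 0 → 0 < g w w) (hη : LinearIndependent ℝ η)
    (hW : ∀ α v, g (W α) v = η α v) :
    IsUnit (Matrix.of fun α β => η α (W β)).det := by
  rw [isUnit_iff_ne_zero]
  intro h0
  obtain ⟨x, hx, hmx⟩ := Matrix.exists_mulVec_eq_zero_iff.2 h0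
  set w := ∑ β, x β • W β with hw
  have h1 : ∀ α, η α w = 0 := by
    intro α
    have := congrFun hmx α
    simp only [Matrix.mulVec, dotProduct, Matrix.of_apply, Pi.zero_apply] at this
    rw [hw, map_sum, ← this]
    exact Finset.sum_congr rfl fun β _ => by rw [map_smul, smul_eq_mul, mul_comm]
  have h2 : ∀ v, g w v = ∑ β, x β * η β v := by
    intro v
    rw [hw, map_sum, sum_apply]
    exact Finset.sum_congr rfl fun β _ => by rw [map_smul, smul_apply, hW, smul_eq_mul]
  have h3 : w = 0 := by
    by_contra hne
    have := hpos w hne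
    rw [h2, Finset.sum_eq_zero fun β _ => by rw [h1, mul_zero]] at this
    exact lt_irrefl _ this
  refine hx (funext fun β => Fintype.linearIndependent_iff.1 hη x ?_ β)
  refine ContinuousLinearMap.ext fun v => ?_
  rw [ImpactSystem.sum_smul_clm_apply, ← h2, h3]
  simp

/-- The normal direction of the impact. -/
theorem exists_impact_normal (hsymm : ∀ w w', g w w' = g w' w) (hpos : ∀ w, w ≠ 0 → 0 < g w w)
    (hη : LinearIndependent ℝ η) (hW : ∀ α v, g (W α) v = η α v) {ξ : E →L[ℝ] ℝ} {G : E}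
    (hG : ∀ v, g G v = ξ v) (N : Matrix (Fin m) (Fin m) ℝ)
    (hN : N = (Matrix.of fun α β => η α (W β))⁻¹) :
    ∃ B : E, B = G - ∑ α, (∑ β, N α β * ξ (W β)) • W α ∧ (∀ α, η α B = 0) ∧
      (∀ w, (∀ α, η α w = 0) → g B w = ξ w) ∧ ξ B = ξ G - ∑ α, ∑ β, N α β * ξ (W α) * ξ (W β) ∧
      (ξ ∉ Submodule.span ℝ (range η) → 0 < ξ B) := by
  set c : Fin m → ℝ := fun α => ∑ β, N α β * ξ (W β) with hc
  have hB : ∀ f : E →L[ℝ] ℝ, f (G - ∑ α, c α • W α) = f G - ∑ α, c α * f (W α) := by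
    intro f
    simp [map_sub, map_sum, map_smul]
  have hη0 : ∀ α, η α (G - ∑ α, c α • W α) = 0 := by
    intro α
    have h1 : (Matrix.of fun α β => η α (W β)).mulVec c = fun α => ξ (W α) := by
      have : c = N.mulVec fun α => ξ (W α) := rfl
      rw [this, hN, Matrix.mulVec_mulVec, Matrix.mul_nonsing_inv _ (isUnit_det_gram hpos hη hW),
        Matrix.one_mulVec]
    have h2 := congrFun h1 α
    simp only [Matrix.mulVec, dotProduct, Matrix.of_apply] at h2
    rw [hB, ← hW α G, hsymm, hG, ← h2, sub_eq_zero]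
    exact Finset.sum_congr rfl fun β _ => mul_comm _ _
  have hgB : ∀ w, g (G - ∑ α, c α • W α) w = ξ w - ∑ α, c α * η α w := by
    intro w
    simp [map_sub, map_sum, map_smul, sum_apply, hG, hW]
  have hgB' : ∀ w, (∀ α, η α w = 0) → g (G - ∑ α, c α • W α) w = ξ w := by
    intro w hw
    rw [hgB, Finset.sum_eq_zero fun α _ => by rw [hw, mul_zero], sub_zero]
  refine ⟨_, rfl, hη0, hgB', ?_, fun hξ => ?_⟩
  · rw [hB]
    congr 1
    refine Finset.sum_congr rfl fun α _ => ?_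
    rw [hc, Finset.sum_mul]
    exact Finset.sum_congr rfl fun β _ => by ring
  -- Here `ξ B = g(B, B)`, and `B = 0` would express `ξ` through the `η α`.
  · rw [← hgB' _ hη0]
    refine hpos _ fun h0 => hξ ?_
    refine (Submodule.mem_span_range_iff_exists_fun ℝ).2 ⟨c, ?_⟩
    ext w
    have := hgB w
    rw [h0, map_zero, zero_apply] at this
    rw [ImpactSystem.sum_smul_clm_apply]
    linarith

end ImpactAlgebra

namespace ImpactSystem

variable {n m : ℕ} {Q : Type*} [TopologicalSpace Q]
  [ChartedSpace (EuclideanSpace ℝ (Fin n)) Q] [IsManifold (𝓡 n) ∞ Q] (M : ImpactSystem n m Q)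

/-- The impact map reverses the component of the velocity along the normal direction `B`. -/
theorem impactMap_eq {v : TangentBundle (𝓡 n) Q} (h0 : M.h v.proj = 0) :
    ∃ B : TangentSpace (𝓡 n) v.proj, ∃ d : ℝ, 0 < d ∧ (∀ α, M.η α v.proj B = 0) ∧
      (∀ w : TangentSpace (𝓡 n) v.proj, (∀ α, M.η α v.proj w = 0) →
        M.metric.inner v.proj B w = M.dh v.proj w) ∧
      M.dh v.proj B = d ∧
      M.impactMap v = ⟨v.proj, v.snd - (2 * M.dh v.proj v.snd / d) • B⟩ := by
  obtain ⟨B, hB, hη, hg, hd, hpos⟩ := exists_impact_normal (E := Vec n)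
    (g := M.metric.inner v.proj) (η := fun α => M.η α v.proj) (W := fun α => M.W α v.proj)
    (M.metric.symm v.proj) (M.metric.pos v.proj) (M.η_linearIndependent v.proj)
    (fun α w => M.sharp_spec v.proj (M.η α v.proj) w) (ξ := M.dh v.proj) (G := M.gradh v.proj)
    (M.sharp_spec v.proj (M.dh v.proj)) _ rfl
  refine ⟨B, M.impactDenom v.proj, ?_, hη, hg, hd, ?_⟩
  · have h1 : M.impactDenom v.proj = M.dh v.proj B := hd.symm
    rw [h1]
    exact hpos (M.nontrivial_impact v.proj h0)
  · have key : ∀ (x G : Vec n) (W : Fin m → Vec n) (c : Fin m → ℝ) (u d : ℝ),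
        x + ∑ k, (2 * c k * u / d) • W k + (-2 * u / d) • G =
          x - (2 * u / d) • (G - ∑ k, c k • W k) := by
      intro x G W c u d
      rw [smul_sub, Finset.smul_sum, add_assoc, sub_eq_add_neg]
      congr 1
      have : ∀ k, (2 * c k * u / d) • W k = (2 * u / d) • c k • W k := fun k => by
        rw [smul_smul]; congr 1; ring
      simp only [this]
      rw [show (-2 * u / d) = -(2 * u / d) by ring, neg_smul]
      abel
    unfold impactMap
    rw [hB]
    exact congrArg (fun w : Vec n => (⟨v.proj, w⟩ : TangentBundle (𝓡 n) Q)) (key _ _ _ _ _ _)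

theorem impactMap_mem_D {v : TangentBundle (𝓡 n) Q} (hv : v ∈ M.D) (h0 : M.h v.proj = 0) :
    M.impactMap v ∈ M.D := by
  obtain ⟨B, d, -, hB, -, -, h⟩ := M.impactMap_eq h0
  rw [h]
  intro α
  have h1 : M.η α v.proj (v.snd - (2 * M.dh v.proj v.snd / d) • B) =
      M.η α v.proj v.snd - (2 * M.dh v.proj v.snd / d) * M.η α v.proj B := by
    rw [map_sub, map_smul]; rfl
  exact h1.trans (by rw [hv α, hB α]; ring)

theorem dh_impactMap {v : TangentBundle (𝓡 n) Q} (h0 : M.h v.proj = 0) :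
    M.dh (M.impactMap v).proj (M.impactMap v).snd = -M.dh v.proj v.snd := by
  obtain ⟨B, d, hd, -, -, hB, h⟩ := M.impactMap_eq h0
  rw [h]
  have h1 : M.dh v.proj (v.snd - (2 * M.dh v.proj v.snd / d) • B) =
      M.dh v.proj v.snd - (2 * M.dh v.proj v.snd / d) * M.dh v.proj B := by
    rw [map_sub, map_smul]; rfl
  refine h1.trans ?_
  rw [hB, div_mul_cancel₀ _ hd.ne']
  ring

/-- The impulse is along `B`, which is orthogonal to the vectors of the distribution tangent to the
levels of `h`; hence the tangential momenta are preserved. -/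
theorem inner_impactMap {v : TangentBundle (𝓡 n) Q} (h0 : M.h v.proj = 0)
    {e : TangentSpace (𝓡 n) v.proj} (he : ∀ α, M.η α v.proj e = 0) (hde : M.dh v.proj e = 0) :
    M.metric.inner v.proj (M.impactMap v).snd e = M.metric.inner v.proj v.snd e := by
  obtain ⟨B, d, hd, -, hg, hB, h⟩ := M.impactMap_eq h0
  rw [h]
  have h1 : M.metric.inner v.proj (v.snd - (2 * M.dh v.proj v.snd / d) • B) e =
      M.metric.inner v.proj v.snd e - (2 * M.dh v.proj v.snd / d) * M.metric.inner v.proj B e := by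
    rw [map_sub, map_smul]; rfl
  refine h1.trans ?_
  rw [hg e he, hde]
  ring

/-- The energy of a state. -/
def energy (v : TangentBundle (𝓡 n) Q) : ℝ :=
  M.metric.inner v.proj v.snd v.snd / 2 + M.V v.proj

theorem energy_impactMap {v : TangentBundle (𝓡 n) Q} (hv : v ∈ M.D) (h0 : M.h v.proj = 0) :
    M.energy (M.impactMap v) = M.energy v := by
  obtain ⟨B, d, hd, hη, hg, hB, h⟩ := M.impactMap_eq h0
  rw [h]
  set s := 2 * M.dh v.proj v.snd / d with hs
  have key : ∀ (g : Vec n →L[ℝ] Vec n →L[ℝ] ℝ) (x B : Vec n), g x B = g B x →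
      g (x - s • B) (x - s • B) = g x x - 2 * s * g B x + s ^ 2 * g B B := by
    intro g x B hg
    simp only [map_sub, map_smul, sub_apply, smul_apply, smul_eq_mul, hg]
    ring
  have h1 := key (M.metric.inner v.proj) v.snd B (M.metric.symm v.proj _ _)
  have h2 : M.metric.inner v.proj B v.snd = M.dh v.proj v.snd := hg _ hv
  have h3 : M.metric.inner v.proj B B = d := (hg _ hη).trans hB
  have h4 : M.metric.inner v.proj (v.snd - s • B) (v.snd - s • B) =
      M.metric.inner v.proj v.snd v.snd := by
    have h5 : s * d = 2 * M.dh v.proj v.snd := by rw [hs]; field_simp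
    have h6 : ∀ a b c u : ℝ, b = u → c = d → s * d = 2 * u → a - 2 * s * b + s ^ 2 * c = a := by
      rintro a b c u rfl rfl h
      linear_combination s * h
    exact h1.trans (h6 _ _ _ _ h2 h3 h5)
  exact congrArg (fun x => x / 2 + M.V v.proj) h4

theorem impactMap_proj (v : TangentBundle (𝓡 n) Q) : (M.impactMap v).proj = v.proj := rfl

theorem reset_of_mem {v : TangentBundle (𝓡 n) Q} (h : v ∈ M.impactSurface) :
    M.reset v = M.impactMap v := if_pos h

theorem reset_of_notMem {v : TangentBundle (𝓡 n) Q} (h : v ∉ M.impactSurface) :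
    M.reset v = v := if_neg h

theorem reset_proj (v : TangentBundle (𝓡 n) Q) : (M.reset v).proj = v.proj := by
  by_cases h : v ∈ M.impactSurface
  · rw [M.reset_of_mem h, impactMap_proj]
  · rw [M.reset_of_notMem h]

theorem reset_mem_D {v : TangentBundle (𝓡 n) Q} : M.reset v ∈ M.D ↔ v ∈ M.D := by
  by_cases h : v ∈ M.impactSurface
  · rw [M.reset_of_mem h]
    exact ⟨fun _ => h.1, fun _ => M.impactMap_mem_D h.1 h.2.1⟩
  · rw [M.reset_of_notMem h]

theorem energy_reset (v : TangentBundle (𝓡 n) Q) : M.energy (M.reset v) = M.energy v := by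
  by_cases h : v ∈ M.impactSurface
  · rw [M.reset_of_mem h, M.energy_impactMap h.1 h.2.1]
  · rw [M.reset_of_notMem h]

end ImpactSystem

/-! ### Adapted charts of the state space. -/

variable {n m : ℕ} {Q : Type*} [TopologicalSpace Q]
  [ChartedSpace (EuclideanSpace ℝ (Fin n)) Q] [IsManifold (𝓡 n) ∞ Q]

/-- The space of adapted coordinates of the states. -/
abbrev StateCoord (n m : ℕ) := ℝ × ℝ × (Fin (n - 1) → ℝ) × (Fin (n - m - 1) → ℝ)

/-- A chart of the constraint distribution which either is adapted to `h` or does not meet the set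
where `h` vanishes. -/
structure StateChart (M : ImpactSystem n m Q) where
  /-- the chart of `Q` -/
  base : Q
  /-- the first coordinate -/
  f : Vec n → ℝ
  smooth_f : ContDiffOn ℝ ∞ f (extChartAt (𝓡 n) base).target
  /-- the coordinates adapted to `f` -/
  C : AdaptedCoords (M.localSystem base f smooth_f) (n - 1) (n - m - 1)
  /-- the center of the domain -/
  center : ℝ × (Fin (n - 1) → ℝ)
  /-- the radius of the domain -/
  radius : ℝ
  closedBall_subset : Metric.closedBall center radius ⊆ C.ψ.target
  /-- the domain -/
  O : Set Q
  O_eq : O = {q | q ∈ (extChartAt (𝓡 n) base).source ∧ extChartAt (𝓡 n) base q ∈ C.ψ.source ∧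
    C.ψ (extChartAt (𝓡 n) base q) ∈ Metric.ball center radius}
  adapted : (f = fun y => M.h ((extChartAt (𝓡 n) base).symm y)) ∨ ∀ q ∈ O, M.h q ≠ 0

namespace StateChart

variable {M : ImpactSystem n m Q} (c : StateChart M)

/-- The adapted coordinates of a state. -/
def coord (v : TangentBundle (𝓡 n) Q) : StateCoord n m := c.C.coord (tcoord c.base v)

/-- The state with given adapted coordinates. -/
def state (x : StateCoord n m) : TangentBundle (𝓡 n) Q := ofCoord c.base (c.C.lift x)

theorem mem_source {q : Q} (hq : q ∈ c.O) : q ∈ (extChartAt (𝓡 n) c.base).source := by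
  rw [c.O_eq] at hq; exact hq.1

theorem chart_mem_source {q : Q} (hq : q ∈ c.O) : extChartAt (𝓡 n) c.base q ∈ c.C.ψ.source := by
  rw [c.O_eq] at hq; exact hq.2.1

theorem isOpen_O : IsOpen c.O := by
  have h1 := (continuousOn_extChartAt (I := 𝓡 n) c.base).isOpen_inter_preimage
    (isOpen_extChartAt_source c.base)
    (c.C.ψ.isOpen_inter_preimage (Metric.isOpen_ball (x := c.center) (ε := c.radius)))
  rw [c.O_eq]
  exact h1

theorem tcoord_mem {v : TangentBundle (𝓡 n) Q} (hv : v.proj ∈ c.O) :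
    (tcoord c.base v).1 ∈ c.C.ψ.source := c.chart_mem_source hv

theorem coord_mem_domain {v : TangentBundle (𝓡 n) Q} (hv : v.proj ∈ c.O) :
    c.coord v ∈ c.C.domain := c.C.coord_mem_domain (c.tcoord_mem hv)

theorem position_mem_ball {v : TangentBundle (𝓡 n) Q} (hv : v.proj ∈ c.O) :
    ((c.coord v).1, (c.coord v).2.2.1) ∈ Metric.ball c.center c.radius := by
  rw [c.O_eq] at hv
  have := hv.2.2
  rwa [c.C.ψ_apply] at this

theorem continuousOn_coord : ContinuousOn c.coord (Bundle.TotalSpace.proj ⁻¹' c.O) :=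
  c.C.contDiffOn_coord.continuousOn.comp
    ((continuousOn_tcoord c.base).mono fun _ hv => c.mem_source hv) fun _ hv => c.tcoord_mem hv

theorem continuousAt_coord {v : TangentBundle (𝓡 n) Q} (hv : v.proj ∈ c.O) :
    ContinuousAt c.coord v :=
  c.continuousOn_coord.continuousAt ((c.isOpen_O.preimage ImpactSystem.continuous_proj).mem_nhds hv)

theorem lift_coord {v : TangentBundle (𝓡 n) Q} (hD : v ∈ M.D) (hv : v.proj ∈ c.O) :
    c.C.lift (c.coord v) = tcoord c.base v :=
  c.C.lift_coord (c.tcoord_mem hv) (M.coordη_tcoord_eq_zero hD (c.mem_source hv))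

theorem state_coord {v : TangentBundle (𝓡 n) Q} (hD : v ∈ M.D) (hv : v.proj ∈ c.O) :
    c.state (c.coord v) = v := by
  rw [state, c.lift_coord hD hv, ofCoord_tcoord (c.mem_source hv)]

theorem lift_mem_target {x : StateCoord n m} (hx : x ∈ c.C.domain) :
    (c.C.lift x).1 ∈ (extChartAt (𝓡 n) c.base).target := c.C.source_subset (c.C.lift_mem hx)

theorem continuousOn_state : ContinuousOn c.state c.C.domain :=
  (continuousOn_ofCoord c.base).comp c.C.contDiffOn_lift.continuousOn fun _ hx =>
    c.lift_mem_target hx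

theorem continuousAt_state {x : StateCoord n m} (hx : x ∈ c.C.domain) : ContinuousAt c.state x :=
  c.continuousOn_state.continuousAt (c.C.isOpen_domain.mem_nhds hx)

theorem differentiableAt_lift {x : StateCoord n m} (hx : x ∈ c.C.domain) :
    DifferentiableAt ℝ c.C.lift x :=
  (c.C.contDiffOn_lift.contDiffAt (c.C.isOpen_domain.mem_nhds hx)).differentiableAt (by simp)

theorem differentiableAt_coord {p : Vec n × Vec n} (hp : p.1 ∈ c.C.ψ.source) :
    DifferentiableAt ℝ c.C.coord p :=
  (c.C.contDiffOn_coord.contDiffAt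
    ((c.C.ψ.open_source.preimage continuous_fst).mem_nhds hp)).differentiableAt (by simp)

/-- Stated only at coordinates of states of the distribution, where `state` inverts `coord`; this
suffices for transporting null sets. -/
theorem differentiableAt_tcoord_state {v : TangentBundle (𝓡 n) Q} (hD : v ∈ M.D)
    (hv : v.proj ∈ c.O) {q₁ : Q} (hv' : v.proj ∈ (extChartAt (𝓡 n) q₁).source) :
    DifferentiableAt ℝ (fun x => tcoord q₁ (c.state x)) (c.coord v) := by
  have h1 := c.differentiableAt_lift (c.coord_mem_domain hv)
  have h3 : (ofCoord c.base (c.C.lift (c.coord v))).proj = v.proj :=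
    congrArg Bundle.TotalSpace.proj (c.state_coord hD hv)
  have h2 : DifferentiableAt ℝ (fun p => tcoord q₁ (ofCoord (n := n) c.base p))
      (c.C.lift (c.coord v)) :=
    differentiableAt_tcoord_ofCoord (c.lift_mem_target (c.coord_mem_domain hv)) (by
      change (ofCoord c.base (c.C.lift (c.coord v))).proj ∈ _
      rw [h3]; exact hv')
  exact h2.comp _ h1

theorem differentiableAt_coord_state {v : TangentBundle (𝓡 n) Q} (hD : v ∈ M.D)
    (hv : v.proj ∈ c.O) (c' : StateChart M) (hv' : v.proj ∈ c'.O) :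
    DifferentiableAt ℝ (fun x => c'.coord (c.state x)) (c.coord v) := by
  have h1 := c.differentiableAt_tcoord_state hD hv (c'.mem_source hv')
  have h2 : DifferentiableAt ℝ c'.C.coord (tcoord c'.base (c.state (c.coord v))) := by
    rw [c.state_coord hD hv]
    exact c'.differentiableAt_coord (c'.tcoord_mem hv')
  exact DifferentiableAt.comp (g := c'.C.coord) _ h2 h1

theorem hasDerivAt_coord {γ : ℝ → TangentBundle (𝓡 n) Q} {J : Set ℝ} (hγ : M.IsFreeMotionOn γ J)
    (hJ : IsOpen J) {t : ℝ} (ht : t ∈ J) (hq : (γ t).proj ∈ c.O) :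
    HasDerivAt (fun s => c.coord (γ s)) ((c.coord (γ t)).2.1, c.C.field (c.coord (γ t))) t := by
  obtain ⟨h1, h2, p', h3, h4⟩ := hγ.coordinates hJ ht (c.mem_source hq)
  exact c.C.hasDerivAt_coord (S := M.localSystem c.base c.f c.smooth_f)
    (x := fun s => (tcoord c.base (γ s)).1) (w := fun s => (tcoord c.base (γ s)).2)
    (c.tcoord_mem hq) h1 h2 h3 h4

/-- Positions in a smaller closed ball of the chart form a closed set. -/
theorem isClosed_closedBall [T2Space Q] {k : ℝ × (Fin (n - 1) → ℝ)} {ρ : ℝ}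
    (h : Metric.closedBall k ρ ⊆ Metric.ball c.center c.radius) :
    IsClosed {q | q ∈ c.O ∧ c.C.ψ (extChartAt (𝓡 n) c.base q) ∈ Metric.closedBall k ρ} := by
  have hsub : Metric.closedBall k ρ ⊆ c.C.ψ.target :=
    h.trans (Metric.ball_subset_closedBall.trans c.closedBall_subset)
  -- The set is the image of a compact ball. In the Hausdorff space `Q` it is therefore closed in
  -- `Q`, not only in the domain of the chart.
  have himg : {q | q ∈ c.O ∧ c.C.ψ (extChartAt (𝓡 n) c.base q) ∈ Metric.closedBall k ρ} =
      (fun x => (extChartAt (𝓡 n) c.base).symm (c.C.ψ.symm x)) '' Metric.closedBall k ρ := by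
    ext q
    constructor
    · rintro ⟨hq, hk⟩
      refine ⟨_, hk, ?_⟩
      change (extChartAt (𝓡 n) c.base).symm (c.C.ψ.symm (c.C.ψ _)) = q
      rw [c.C.ψ.left_inv (c.chart_mem_source hq), (extChartAt (𝓡 n) c.base).left_inv (c.mem_source hq)]
    · rintro ⟨x, hx, rfl⟩
      have h1 := c.C.ψ.map_target (hsub hx)
      have h2 : c.C.ψ.symm x ∈ (extChartAt (𝓡 n) c.base).target := c.C.source_subset h1
      have h3 := (extChartAt (𝓡 n) c.base).right_inv h2
      have h4 := c.C.ψ.right_inv (hsub hx)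
      rw [c.O_eq]
      refine ⟨?_, by rwa [h3, h4]⟩
      change _ ∧ _ ∧ _
      rw [h3, h4]
      exact ⟨(extChartAt (𝓡 n) c.base).map_target h2, h1, h hx⟩
  rw [himg]
  refine ((isCompact_closedBall k ρ).image_of_continuousOn ?_).isClosed
  exact (continuousOn_extChartAt_symm (I := 𝓡 n) c.base).comp
    (c.C.smooth_symm.continuousOn.mono hsub) fun x hx => c.C.source_subset (c.C.ψ.map_target (hsub hx))

end StateChart

/-- Charts around every point. -/
theorem exists_stateChart (M : ImpactSystem n m Q) (hmn : m + 1 ≤ n) (q : Q) :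
    ∃ c : StateChart M, q ∈ c.O := by
  have hsrc := mem_extChartAt_source (I := 𝓡 n) q
  have htgt := mem_extChartAt_target (I := 𝓡 n) q
  have hφ : (extChartAt (𝓡 n) q).symm (extChartAt (𝓡 n) q q) = q :=
    (extChartAt (𝓡 n) q).left_inv hsrc
  have hfin : Module.finrank ℝ (Vec n) = n := by simp
  have key : ∀ (f : Vec n → ℝ) (hf : ContDiffOn ℝ ∞ f (extChartAt (𝓡 n) q).target),
      fderiv ℝ f (extChartAt (𝓡 n) q q) ∉
        Submodule.span ℝ (range fun α => M.coordη q α (extChartAt (𝓡 n) q q)) →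
      ∃ C : AdaptedCoords (M.localSystem q f hf) (n - 1) (n - m - 1),
        extChartAt (𝓡 n) q q ∈ C.ψ.source := fun f hf hd =>
    exists_adaptedCoords (M.localSystem q f hf) htgt (M.linearIndependent_coordη htgt) hd
      (by omega) (by omega)
  by_cases h0 : M.h q = 0
  · obtain ⟨C, hC⟩ := key _ (ImpactSystem.contDiffOn_chart_symm M.h_smooth q)
      (M.fderiv_h_notMem_span htgt (by rw [hφ]; exact h0))
    obtain ⟨ρ, hρ, hball⟩ := Metric.isOpen_iff.1 C.ψ.open_target _ (C.ψ.map_source hC)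
    refine ⟨⟨q, _, ImpactSystem.contDiffOn_chart_symm M.h_smooth q, C, C.ψ (extChartAt (𝓡 n) q q), ρ / 2,
      (Metric.closedBall_subset_ball (by linarith)).trans hball, _, rfl, Or.inl rfl⟩, ?_⟩
    exact ⟨hsrc, hC, Metric.mem_ball_self (by linarith)⟩
  -- Away from `h = 0` any constant covector outside the span of the constraints can replace `dh`;
  -- it exists because `m < n`. The domain is then shrunk so that `h` does not vanish on it.
  · have hspan : ∃ ξ : Vec n →L[ℝ] ℝ, ξ ∉
        Submodule.span ℝ (range fun α => M.coordη q α (extChartAt (𝓡 n) q q)) := by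
      by_contra! hcon
      have h1 : Submodule.span ℝ (range fun α => M.coordη q α (extChartAt (𝓡 n) q q)) = ⊤ :=
        eq_top_iff.2 fun ξ _ => hcon ξ
      have h2 := finrank_range_le_card (R := ℝ) fun α => M.coordη q α (extChartAt (𝓡 n) q q)
      have h3 : Module.finrank ℝ (Vec n →L[ℝ] ℝ) = n := by
        rw [← (LinearMap.toContinuousLinearMap (𝕜 := ℝ) (E := Vec n) (F' := ℝ)).finrank_eq]
        exact (Subspace.dual_finrank_eq (K := ℝ)).trans hfin
      rw [Set.finrank, h1, finrank_top, h3, Fintype.card_fin] at h2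
      omega
    obtain ⟨ξ, hξ⟩ := hspan
    obtain ⟨C, hC⟩ := key ξ ξ.contDiff.contDiffOn (by rw [ξ.fderiv]; exact hξ)
    have hopen : IsOpen (C.ψ.symm ⁻¹' ((extChartAt (𝓡 n) q).target ∩
        (extChartAt (𝓡 n) q).symm ⁻¹' {q | M.h q ≠ 0}) ∩ C.ψ.target) := by
      rw [inter_comm]
      refine C.ψ.symm.isOpen_inter_preimage ?_
      exact (continuousOn_extChartAt_symm (I := 𝓡 n) q).isOpen_inter_preimage
        (isOpen_extChartAt_target q) (isOpen_ne_fun M.h_smooth.continuous continuous_const)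
    have hmem : C.ψ (extChartAt (𝓡 n) q q) ∈ (C.ψ.symm ⁻¹' ((extChartAt (𝓡 n) q).target ∩
        (extChartAt (𝓡 n) q).symm ⁻¹' {q | M.h q ≠ 0}) ∩ C.ψ.target) := by
      refine ⟨?_, C.ψ.map_source hC⟩
      rw [mem_preimage, C.ψ.left_inv hC]
      refine ⟨htgt, ?_⟩
      rw [mem_preimage, hφ]
      exact h0
    obtain ⟨ρ, hρ, hball⟩ := Metric.isOpen_iff.1 hopen _ hmem
    refine ⟨⟨q, ξ, ξ.contDiff.contDiffOn, C, C.ψ (extChartAt (𝓡 n) q q), ρ / 2,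
      (Metric.closedBall_subset_ball (by linarith)).trans (hball.trans inter_subset_right),
      _, rfl, Or.inr ?_⟩, ?_⟩
    · rintro q' ⟨hq', hq'C, hq'b⟩
      have h1 := (hball (Metric.ball_subset_ball (by linarith) hq'b)).1.2
      rw [mem_preimage, C.ψ.left_inv hq'C, (extChartAt (𝓡 n) q).left_inv hq'] at h1
      exact h1
    · exact ⟨hsrc, hC, Metric.mem_ball_self (by linarith)⟩

/-- Impacts exist only if the distribution has positive dimension. -/
theorem ImpactSystem.add_one_le_of_h_eq_zero (M : ImpactSystem n m Q) {q : Q} (h0 : M.h q = 0) :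
    m + 1 ≤ n := by
  have htgt := mem_extChartAt_target (I := 𝓡 n) q
  have hφ : (extChartAt (𝓡 n) q).symm (extChartAt (𝓡 n) q q) = q :=
    (extChartAt (𝓡 n) q).left_inv (mem_extChartAt_source (I := 𝓡 n) q)
  have hli := linearIndependent_finCons.2 ⟨M.linearIndependent_coordη htgt,
    M.fderiv_h_notMem_span htgt (by rw [hφ]; exact h0)⟩
  have h1 := hli.fintype_card_le_finrank
  have h3 : Module.finrank ℝ (Vec n →L[ℝ] ℝ) = n := by
    rw [← (LinearMap.toContinuousLinearMap (𝕜 := ℝ) (E := Vec n) (F' := ℝ)).finrank_eq]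
    exact (Subspace.dual_finrank_eq (K := ℝ)).trans (by simp)
  rwa [h3, Fintype.card_fin] at h1

/-! ### Null sets in adapted charts and in bundle charts. -/

instance isAddHaarMeasure_volume_prod {X Y : Type*} [NormedAddCommGroup X]
    [NormedSpace ℝ X] [FiniteDimensional ℝ X] [MeasureSpace X] [BorelSpace X]
    [(volume : Measure X).IsAddHaarMeasure] [NormedAddCommGroup Y] [NormedSpace ℝ Y]
    [FiniteDimensional ℝ Y] [MeasureSpace Y] [BorelSpace Y] [(volume : Measure Y).IsAddHaarMeasure] :
    (volume : Measure (X × Y)).IsAddHaarMeasure :=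
  inferInstanceAs ((volume : Measure X).prod (volume : Measure Y)).IsAddHaarMeasure

/-- A linear isomorphism of the equidimensional source and target reduces to maps of a space to
itself. -/
theorem volume_image_eq_zero_of_differentiable {X Y : Type*} [NormedAddCommGroup X]
    [NormedSpace ℝ X] [FiniteDimensional ℝ X] [MeasureSpace X] [BorelSpace X]
    [(volume : Measure X).IsAddHaarMeasure] [NormedAddCommGroup Y] [NormedSpace ℝ Y]
    [FiniteDimensional ℝ Y] [MeasureSpace Y] [BorelSpace Y] [(volume : Measure Y).IsAddHaarMeasure]
    (hdim : Module.finrank ℝ X = Module.finrank ℝ Y) {f : X → Y} {s : Set X}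
    (hf : ∀ x ∈ s, DifferentiableAt ℝ f x) (hs : volume s = 0) : volume (f '' s) = 0 := by
  let T : X ≃L[ℝ] Y := ContinuousLinearEquiv.ofFinrankEq hdim
  have h1 : volume (T '' s) = 0 := by
    have : (Measure.map T (volume : Measure X)).IsAddHaarMeasure := T.isAddHaarMeasure_map volume
    refine Measure.absolutelyContinuous_isAddHaarMeasure volume (Measure.map T volume) ?_
    have h2 := T.toHomeomorph.toMeasurableEquiv.map_apply (μ := volume) (T '' s)
    refine h2.trans ?_
    change volume (T ⁻¹' (T '' s)) = 0
    rwa [preimage_image_eq _ T.injective]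
  have h3 : f '' s = (f ∘ T.symm) '' (T '' s) := by
    rw [image_image]; simp
  rw [h3]
  refine addHaar_image_eq_zero_of_differentiableOn_of_addHaar_eq_zero _ ?_ h1
  rintro _ ⟨x, hx, rfl⟩
  have h4 : DifferentiableAt ℝ f (T.symm (T x)) := by
    rw [T.symm_apply_apply]; exact hf x hx
  exact (h4.comp _ T.symm.differentiableAt).differentiableWithinAt

instance isAddHaarMeasure_volume_stateCoord (n m : ℕ) :
    (volume : Measure (StateCoord n m)).IsAddHaarMeasure := isAddHaarMeasure_volume_real_real_prod

variable {n m : ℕ} {Q : Type*} [TopologicalSpace Q]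
  [ChartedSpace (EuclideanSpace ℝ (Fin n)) Q] [IsManifold (𝓡 n) ∞ Q]

/-- The set of states of the distribution over the domain of a chart with coordinates in `S`. -/
def StateChart.preimage {M : ImpactSystem n m Q} (c : StateChart M) (S : Set (StateCoord n m)) :
    Set (TangentBundle (𝓡 n) Q) := {v | v ∈ M.D ∧ v.proj ∈ c.O ∧ c.coord v ∈ S}

/-- The coordinates of the states of `A` in the distribution. -/
def StateChart.image {M : ImpactSystem n m Q} (c : StateChart M)
    (A : Set (TangentBundle (𝓡 n) Q)) : Set (StateCoord n m) :=
  c.coord '' {v | v ∈ A ∧ v ∈ M.D ∧ v.proj ∈ c.O}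

/-- The part of `A` in the constraint distribution has null image in every adapted chart. -/
def ChartNull (M : ImpactSystem n m Q) (A : Set (TangentBundle (𝓡 n) Q)) : Prop :=
  ∀ c : StateChart M, volume (c.image A) = 0

theorem ChartNull.mono {M : ImpactSystem n m Q} {A A' : Set (TangentBundle (𝓡 n) Q)}
    (hA : ChartNull M A) (h : A' ⊆ A) : ChartNull M A' := fun c =>
  measure_mono_null (image_mono fun v (hv : v ∈ A' ∧ v ∈ M.D ∧ v.proj ∈ c.O) =>
    (⟨h hv.1, hv.2⟩ : v ∈ A ∧ v ∈ M.D ∧ v.proj ∈ c.O)) (hA c)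

theorem ChartNull.iUnion {M : ImpactSystem n m Q} {ι : Type*} [Countable ι]
    {A : ι → Set (TangentBundle (𝓡 n) Q)} (hA : ∀ i, ChartNull M (A i)) :
    ChartNull M (⋃ i, A i) := fun c => by
  refine measure_mono_null ?_ (measure_iUnion_null fun i => hA i c)
  rintro _ ⟨v, ⟨hv, hv'⟩, rfl⟩
  obtain ⟨i, hi⟩ := mem_iUnion.1 hv
  exact mem_iUnion.2 ⟨i, v, ⟨hi, hv'⟩, rfl⟩

theorem ChartNull.union {M : ImpactSystem n m Q} {A A' : Set (TangentBundle (𝓡 n) Q)}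
    (hA : ChartNull M A) (hA' : ChartNull M A') : ChartNull M (A ∪ A') := by
  rw [union_eq_iUnion]
  exact ChartNull.iUnion fun b => by cases b <;> assumption

/-- Transition maps between adapted charts are differentiable on the distribution, so nullity in one
chart passes to all. -/
theorem StateChart.chartNull_preimage {M : ImpactSystem n m Q} (c : StateChart M)
    {S : Set (StateCoord n m)} (hS : volume S = 0) : ChartNull M (c.preimage S) := fun c' => by
  refine measure_mono_null ?_ (addHaar_image_eq_zero_of_differentiableOn_of_addHaar_eq_zero
    (f := fun x => c'.coord (c.state x))
    (s := S ∩ c.coord '' {v | v ∈ M.D ∧ v.proj ∈ c.O ∧ v.proj ∈ c'.O}) volume ?_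
    (measure_mono_null inter_subset_left hS))
  · rintro _ ⟨v, ⟨⟨hD, hO, hv⟩, -, hO'⟩, rfl⟩
    refine ⟨c.coord v, ⟨hv, v, ⟨hD, hO, hO'⟩, rfl⟩, ?_⟩
    simp only [c.state_coord hD hO]
  · rintro _ ⟨-, v, ⟨hD, hO, hO'⟩, rfl⟩
    exact (c.differentiableAt_coord_state hD hO c' hO').differentiableWithinAt

/-- Locally the bundle chart has a differentiable left inverse defined on adapted coordinates, so
the set to be measured lies in a differentiable image of a null set. The two coordinate spaces have
the same dimension `2 n - m` because `m + 1 ≤ n`. -/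
theorem ChartNull.isNull {M : ImpactSystem n m Q} (hmn : m + 1 ≤ n)
    {A : Set (TangentBundle (𝓡 n) Q)} (hA : ChartNull M A) : M.IsNull A := by
  intro q₀ U hU hUt e he hli hη
  set w : Vec n × (Fin (n - m) → ℝ) → Vec n := fun p => ∑ j, p.2 j • e j p.1 with hw
  set g : Vec n × (Fin (n - m) → ℝ) → TangentBundle (𝓡 n) Q := fun p => ofCoord q₀ (p.1, w p) with hg
  change volume {p : Vec n × (Fin (n - m) → ℝ) | p.1 ∈ U ∧ g p ∈ A} = 0
  have hgD : ∀ p, p.1 ∈ U → g p ∈ M.D := by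
    intro p hp α
    change M.coordη q₀ α p.1 (w p) = 0
    rw [hw, map_sum]
    exact Finset.sum_eq_zero fun j _ => by rw [map_smul, hη _ hp, smul_zero]
  have hgc : ∀ p, p.1 ∈ U → ContinuousAt g p := by
    intro p hp
    have h1 : ContinuousAt w p := by
      refine tendsto_finsetSum _ fun j _ => ?_
      have h2 : ContinuousAt (e j) p.1 := ((he j).contDiffAt (hU.mem_nhds hp)).continuousAt
      exact (((continuous_apply j).comp continuous_snd).continuousAt).smul
        (h2.comp continuous_fst.continuousAt)
    have h3 : ContinuousAt (ofCoord (n := n) q₀) (p.1, w p) :=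
      (continuousOn_ofCoord q₀).continuousAt
        (((isOpen_extChartAt_target q₀).preimage continuous_fst).mem_nhds (hUt hp))
    exact ContinuousAt.comp (g := ofCoord (n := n) q₀) h3 (continuous_fst.continuousAt.prodMk h1)
  refine measure_null_of_locally_null _ fun p₀ hp₀ => ?_
  obtain ⟨c, hc⟩ := exists_stateChart M hmn (g p₀).proj
  let B : Vec n → (Fin (n - m) → ℝ) →L[ℝ] Vec n := fun y =>
    ∑ j, (ContinuousLinearMap.proj j : (Fin (n - m) → ℝ) →L[ℝ] ℝ).smulRight (e j y)
  have hB : ∀ y a, B y a = w (y, a) := by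
    intro y a
    simp [B, hw, sum_apply]
  have hBinj : Function.Injective (B p₀.1 : (Fin (n - m) → ℝ) →ₗ[ℝ] Vec n) := by
    refine (injective_iff_map_eq_zero _).2 fun a ha => ?_
    have h1 : w (p₀.1, a) = 0 := (hB _ _).symm.trans ha
    exact funext (Fintype.linearIndependent_iff.1 (hli p₀.1 hp₀.1) a h1)
  -- A left inverse of the frame at the base point stays invertible on nearby frames; it recovers
  -- the fibre coordinates from the velocity.
  obtain ⟨l, hl⟩ := LinearMap.exists_leftInverse_of_injective _ (LinearMap.ker_eq_bot.2 hBinj)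
  let L : Vec n →L[ℝ] (Fin (n - m) → ℝ) := LinearMap.toContinuousLinearMap l
  let Λ : Vec n → (Fin (n - m) → ℝ) →L[ℝ] (Fin (n - m) → ℝ) := fun y => L.comp (B y)
  have hBd : ∀ y ∈ U, DifferentiableAt ℝ B y := by
    intro y hy
    refine DifferentiableAt.fun_sum fun j _ => ?_
    have h2 : DifferentiableAt ℝ (e j) y :=
      ((he j).contDiffAt (hU.mem_nhds hy)).differentiableAt (by simp)
    exact ((ContinuousLinearMap.smulRightL ℝ (Fin (n - m) → ℝ) (Vec n)
      (ContinuousLinearMap.proj j)).differentiableAt).comp y h2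
  have hΛd : ∀ y ∈ U, DifferentiableAt ℝ Λ y := fun y hy =>
    (differentiableAt_const L).clm_comp (hBd y hy)
  have hΛ0 : (Λ p₀.1).IsInvertible := by
    refine isInvertible_of_ker (fun a ha => ?_) rfl
    have : l (B p₀.1 a) = a := congrArg (fun f => f a) hl
    rw [← this]
    exact ha
  have hev : ∀ᶠ p in 𝓝 p₀, p.1 ∈ U ∧ (g p).proj ∈ c.O ∧ (Λ p.1).IsInvertible := by
    refine (continuous_fst.continuousAt.eventually (hU.mem_nhds hp₀.1)).and
      (((hgc p₀ hp₀.1).eventually ((c.isOpen_O.preimage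
        ImpactSystem.continuous_proj).mem_nhds hc)).and ?_)
    exact continuous_fst.continuousAt.eventually
      (eventually_isInvertible (hΛd p₀.1 hp₀.1).continuousAt hΛ0)
  refine ⟨_, inter_mem_nhdsWithin _ hev, ?_⟩
  let κ : StateCoord n m → Vec n × (Fin (n - m) → ℝ) := fun x =>
    ((tcoord q₀ (c.state x)).1,
      (Λ (tcoord q₀ (c.state x)).1).inverse (L (tcoord q₀ (c.state x)).2))
  set s := {p : Vec n × (Fin (n - m) → ℝ) | p.1 ∈ U ∧ g p ∈ A} ∩
    {p | p.1 ∈ U ∧ (g p).proj ∈ c.O ∧ (Λ p.1).IsInvertible} with hs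
  have hts : ∀ p ∈ s, tcoord q₀ (c.state (c.coord (g p))) = (p.1, w p) := by
    intro p hp
    rw [c.state_coord (hgD p hp.1.1) hp.2.2.1]
    exact tcoord_ofCoord (p := (p.1, w p)) (hUt hp.1.1)
  have hsub : s ⊆ κ '' ((fun p => c.coord (g p)) '' s) := by
    intro p hp
    refine ⟨_, ⟨p, hp, rfl⟩, ?_⟩
    simp only [κ, hts p hp]
    refine Prod.ext rfl ?_
    have h1 : L (w p) = Λ p.1 p.2 := by
      change _ = L (B p.1 p.2); rw [hB]
    change (Λ p.1).inverse (L (w p)) = p.2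
    rw [h1]
    exact hp.2.2.2.inverse_apply_eq.2 rfl
  refine measure_mono_null hsub (volume_image_eq_zero_of_differentiable ?_ ?_ ?_)
  · simp only [Module.finrank_prod, Module.finrank_self, Module.finrank_fin_fun,
      finrank_euclideanSpace_fin]
    omega
  · rintro _ ⟨p, hp, rfl⟩
    have h1 : DifferentiableAt ℝ (fun x => tcoord q₀ (c.state x)) (c.coord (g p)) :=
      c.differentiableAt_tcoord_state (hgD p hp.1.1) hp.2.2.1
        ((extChartAt (𝓡 n) q₀).map_target (hUt hp.1.1))
    have h2 : DifferentiableAt ℝ (fun y => (Λ y).inverse) (tcoord q₀ (c.state (c.coord (g p)))).1 := by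
      rw [hts p hp]
      have h3 : DifferentiableAt ℝ ContinuousLinearMap.inverse (Λ p.1) :=
        (hp.2.2.2.contDiffAt_map_inverse (n := 1)).differentiableAt (by simp)
      exact h3.comp p.1 (hΛd p.1 hp.1.1)
    have h4 : DifferentiableAt ℝ (fun x => (Λ (tcoord q₀ (c.state x)).1).inverse)
        (c.coord (g p)) := DifferentiableAt.comp (g := fun y => (Λ y).inverse)
          (f := fun x => (tcoord q₀ (c.state x)).1) (c.coord (g p)) h2 h1.fst
    have h5 : DifferentiableAt ℝ (fun x => L (tcoord q₀ (c.state x)).2) (c.coord (g p)) :=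
      L.differentiableAt.comp (c.coord (g p)) h1.snd
    exact h1.fst.prodMk (h4.clm_apply h5)
  · refine measure_mono_null ?_ (hA c)
    rintro _ ⟨p, hp, rfl⟩
    exact ⟨g p, ⟨hp.1.2, hgD p hp.1.1, hp.2.2.1⟩, rfl⟩

/-! ### One-sided behaviour of hybrid trajectories. -/

variable {n m : ℕ} {Q : Type*} [TopologicalSpace Q]
  [ChartedSpace (EuclideanSpace ℝ (Fin n)) Q] [IsManifold (𝓡 n) ∞ Q] {M : ImpactSystem n m Q}

namespace ImpactSystem

/-- The definition of a free motion gives differentiability of position and momentum only;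
continuity of the state is recovered from adapted coordinates. -/
theorem IsFreeMotionOn.continuousAt (hmn : m + 1 ≤ n) {c : ℝ → TangentBundle (𝓡 n) Q} {J : Set ℝ}
    (hc : M.IsFreeMotionOn c J) (hJ : IsOpen J) {t : ℝ} (ht : t ∈ J) : ContinuousAt c t := by
  obtain ⟨k, hk⟩ := exists_stateChart M hmn (c t).proj
  have h1 := (k.hasDerivAt_coord hc hJ ht hk).continuousAt
  have h2 : ContinuousAt (fun s => k.state (k.coord (c s))) t :=
    ContinuousAt.comp (g := k.state) (k.continuousAt_state (k.coord_mem_domain hk)) h1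
  refine h2.congr ?_
  filter_upwards [hJ.mem_nhds ht, (hc t ht).2.1.continuousAt.eventually (k.isOpen_O.mem_nhds hk)]
    with s hs hsO
  exact k.state_coord (hc s hs).1 hsO

namespace IsHybridTrajectory

variable {γ : ℝ → TangentBundle (𝓡 n) Q} {T : ℝ} {x : TangentBundle (𝓡 n) Q}

theorem mem_D (hγ : M.IsHybridTrajectory γ T x) {t : ℝ} (ht : t ∈ Ico 0 T) : γ t ∈ M.D := by
  obtain ⟨ε, hε, c, hc, hct, -⟩ := hγ.right_motion t ht
  rw [← M.reset_mem_D, ← hct]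
  exact (hc t ⟨by linarith, by linarith⟩).1

theorem tendsto_right (hmn : m + 1 ≤ n) (hγ : M.IsHybridTrajectory γ T x) {t : ℝ}
    (ht : t ∈ Ico 0 T) : Tendsto γ (𝓝[>] t) (𝓝 (M.reset (γ t))) := by
  obtain ⟨ε, hε, c, hc, hct, hcγ⟩ := hγ.right_motion t ht
  have h1 := (hc.continuousAt hmn isOpen_Ioo (t := t) ⟨by linarith, by linarith⟩).tendsto
  rw [hct] at h1
  refine (h1.mono_left nhdsWithin_le_nhds).congr' ?_
  filter_upwards [Ioo_mem_nhdsGT (lt_min (show t < t + ε by linarith) ht.2)] with s hs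
  exact (hcγ s ⟨hs.1, hs.2.trans_le (min_le_left _ _)⟩ (hs.2.trans_le (min_le_right _ _))).symm

theorem tendsto_left (hγ : M.IsHybridTrajectory γ T x) {t : ℝ} (ht : t ∈ Ioo 0 T) :
    Tendsto γ (𝓝[<] t) (𝓝 (γ t)) := hγ.left_continuous t ht

theorem tendsto_dh_left (hγ : M.IsHybridTrajectory γ T x) {t : ℝ} (ht : t ∈ Ioo 0 T) :
    Tendsto (fun s => M.dh (γ s).proj (γ s).snd) (𝓝[<] t) (𝓝 (M.dh (γ t).proj (γ t).snd)) :=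
  (M.continuous_dh.tendsto (γ t)).comp (hγ.tendsto_left ht)

theorem tendsto_dh_right (hmn : m + 1 ≤ n) (hγ : M.IsHybridTrajectory γ T x) {t : ℝ}
    (ht : t ∈ Ico 0 T) : Tendsto (fun s => M.dh (γ s).proj (γ s).snd) (𝓝[>] t)
      (𝓝 (M.dh (M.reset (γ t)).proj (M.reset (γ t)).snd)) :=
  (M.continuous_dh.tendsto (M.reset (γ t))).comp (hγ.tendsto_right hmn ht)

theorem tendsto_h_left (hγ : M.IsHybridTrajectory γ T x) {t : ℝ} (ht : t ∈ Ioo 0 T) :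
    Tendsto (fun s => M.h (γ s).proj) (𝓝[<] t) (𝓝 (M.h (γ t).proj)) :=
  ((M.h_smooth.continuous.comp continuous_proj).tendsto (γ t)).comp (hγ.tendsto_left ht)

theorem tendsto_h_right (hmn : m + 1 ≤ n) (hγ : M.IsHybridTrajectory γ T x) {t : ℝ}
    (ht : t ∈ Ico 0 T) : Tendsto (fun s => M.h (γ s).proj) (𝓝[>] t) (𝓝 (M.h (γ t).proj)) := by
  have h := ((M.h_smooth.continuous.comp continuous_proj).tendsto (M.reset (γ t))).comp
    (hγ.tendsto_right hmn ht)
  simp only [Function.comp_def, M.reset_proj] at h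
  exact h

theorem dh_reset_pos {v : TangentBundle (𝓡 n) Q} (hv : v ∈ M.impactSurface) :
    0 < M.dh (M.reset v).proj (M.reset v).snd := by
  rw [M.reset_of_mem hv, M.dh_impactMap hv.2.1]
  linarith [hv.2.2]

/-- Impacts do not accumulate from the right. -/
theorem exists_no_impact (hmn : m + 1 ≤ n) (hγ : M.IsHybridTrajectory γ T x) {t : ℝ}
    (ht : t ∈ Ico 0 T) : ∃ ε > 0, ∀ s ∈ Ioo t (t + ε), s < T → γ s ∉ M.impactSurface := by
  obtain ⟨ε, hε, c, hc, hct, hcγ⟩ := hγ.right_motion t ht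
  refine ⟨ε, hε, fun s hs hsT himp => ?_⟩
  -- At an impact the right limit of `dh(v)` is positive, whereas near `s` the trajectory agrees
  -- with a continuous motion on which `dh(v)` is negative at `s`.
  have h1 := hγ.tendsto_dh_right hmn (t := s) ⟨by linarith [ht.1, hs.1], hsT⟩
  have h2 := (M.continuous_dh.tendsto (c s)).comp (hc.continuousAt hmn isOpen_Ioo (t := s)
    ⟨by linarith [hs.1], hs.2⟩).tendsto
  have h3 : Tendsto (fun s => M.dh (γ s).proj (γ s).snd) (𝓝[>] s)
      (𝓝 (M.dh (c s).proj (c s).snd)) := by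
    refine (h2.mono_left nhdsWithin_le_nhds).congr' ?_
    filter_upwards [Ioo_mem_nhdsGT (lt_min hs.2 hsT)] with r hr
    rw [hcγ r ⟨by linarith [hs.1, hr.1], hr.2.trans_le (min_le_left _ _)⟩
      (hr.2.trans_le (min_le_right _ _))]
    rfl
  have h4 := tendsto_nhds_unique h1 h3
  rw [← hcγ s hs hsT] at h4
  linarith [dh_reset_pos himp, himp.2.2]

/-- `h` increases after a time at which the velocity is directed to the positive side. -/
theorem exists_h_pos (hγ : M.IsHybridTrajectory γ T x) {t : ℝ} (ht : t ∈ Ico 0 T)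
    (h0 : M.h (γ t).proj = 0) (hu : 0 < M.dh (M.reset (γ t)).proj (M.reset (γ t)).snd) :
    ∃ ε > 0, ∀ s ∈ Ioo t (t + ε), s < T → 0 < M.h (γ s).proj := by
  obtain ⟨ε, hε, c, hc, hct, hcγ⟩ := hγ.right_motion t ht
  have h1 := hc.hasDerivAt_h (t := t) ⟨by linarith, by linarith⟩
  rw [hct] at h1
  have h2 := (h1.tendsto_slope.mono_left (nhdsGT_le_nhdsNE t)).eventually_const_lt hu
  obtain ⟨b, hb, hbs⟩ := mem_nhdsGT_iff_exists_Ioo_subset.1 h2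
  refine ⟨min ε (b - t), lt_min hε (by linarith [show t < b from hb]), fun s hs hsT => ?_⟩
  have h3 : s < t + ε := hs.2.trans_le (by linarith [min_le_left ε (b - t)])
  have h4 : 0 < slope (fun s => M.h (c s).proj) t s :=
    hbs ⟨hs.1, hs.2.trans_le (by linarith [min_le_right ε (b - t)])⟩
  rw [hcγ s ⟨hs.1, h3⟩ hsT]
  rw [slope_def_field, hct, M.reset_proj, h0, sub_zero] at h4
  have h5 := mul_pos h4 (show 0 < s - t by linarith [hs.1])
  rwa [div_mul_cancel₀ _ (by linarith [hs.1] : s - t ≠ 0)] at h5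

end IsHybridTrajectory

end ImpactSystem

/-! ### Hybrid trajectories as reflected motions in adapted coordinates. -/

variable {n m : ℕ} {Q : Type*} [TopologicalSpace Q]
  [ChartedSpace (EuclideanSpace ℝ (Fin n)) Q] [IsManifold (𝓡 n) ∞ Q] {M : ImpactSystem n m Q}

theorem ImpactSystem.coordG_tcoord_impactMap {q₀ : Q} {p : Vec n × Vec n}
    (hp : p.1 ∈ (extChartAt (𝓡 n) q₀).target) (h0 : M.h ((extChartAt (𝓡 n) q₀).symm p.1) = 0)
    {e : Vec n} (he : ∀ α, M.coordη q₀ α p.1 e = 0)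
    (hde : fderiv ℝ (fun y => M.h ((extChartAt (𝓡 n) q₀).symm y)) p.1 e = 0) :
    M.coordG q₀ p.1 (tcoord q₀ (M.impactMap (ofCoord q₀ p))).2 e = M.coordG q₀ p.1 p.2 e := by
  have h1 := M.inner_impactMap (v := ofCoord q₀ p) h0 (e := dchartSymm q₀ p.1 e) he
    ((M.fderiv_h_chart hp e).symm.trans hde)
  have h2 : ∀ w : Vec n, dchartSymm q₀ p.1 (dchart q₀ ((extChartAt (𝓡 n) q₀).symm p.1) w) = w := by
    intro w
    obtain ⟨w', rfl⟩ := dchartSymm_surjective hp w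
    rw [dchart_dchartSymm hp]
  have h3 := h2 (M.impactMap (ofCoord q₀ p)).snd
  refine Eq.trans ?_ h1
  exact congrArg (fun w : Vec n => M.metric.inner ((extChartAt (𝓡 n) q₀).symm p.1) w
    (dchartSymm q₀ p.1 e)) h3

namespace StateChart

variable (c : StateChart M)

/-- The first coordinate is `h`. -/
def IsAdapted : Prop := c.f = fun y => M.h ((extChartAt (𝓡 n) c.base).symm y)

theorem isAdapted_of_mem {q : Q} (hq : q ∈ c.O) (h0 : M.h q = 0) : c.IsAdapted :=
  c.adapted.resolve_right fun h => h q hq h0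

theorem coord_fst (hA : c.IsAdapted) {v : TangentBundle (𝓡 n) Q} (hv : v.proj ∈ c.O) :
    (c.coord v).1 = M.h v.proj := by
  refine (congrFun hA _).trans ?_
  exact congrArg M.h ((extChartAt (𝓡 n) c.base).left_inv (c.mem_source hv))

theorem coord_snd_fst (hA : c.IsAdapted) {v : TangentBundle (𝓡 n) Q} (hv : v.proj ∈ c.O) :
    (c.coord v).2.1 = M.dh v.proj v.snd := by
  have h1 : (c.coord v).2.1 = fderiv ℝ c.f (tcoord c.base v).1 (tcoord c.base v).2 := rfl
  rw [h1, hA]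
  refine (M.fderiv_h_chart (y := (tcoord c.base v).1)
    ((extChartAt (𝓡 n) c.base).map_source (c.mem_source hv)) _).trans ?_
  exact congrArg (fun v : TangentBundle (𝓡 n) Q => M.dh v.proj v.snd)
    (ofCoord_tcoord (c.mem_source hv))

/-- Position and tangential momenta are fixed and `dh(v)` changes sign; this is the purpose of the
choice of velocity coordinates. -/
theorem coord_impactMap (hA : c.IsAdapted) {v : TangentBundle (𝓡 n) Q} (hv : v.proj ∈ c.O)
    (h0 : M.h v.proj = 0) :
    c.coord (M.impactMap v) = ((c.coord v).1, flip (c.coord v).2) := by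
  refine Prod.ext rfl (Prod.ext ?_ (Prod.ext rfl ?_))
  · change (c.coord (M.impactMap v)).2.1 = -(c.coord v).2.1
    rw [c.coord_snd_fst hA hv, c.coord_snd_fst hA (v := M.impactMap v) hv, M.dh_impactMap h0]
  · funext j
    have hof := ofCoord_tcoord (c.mem_source hv)
    have h1 := M.coordG_tcoord_impactMap (p := tcoord c.base v)
      ((extChartAt (𝓡 n) c.base).map_source (c.mem_source hv)) (by
        rw [← h0]
        exact congrArg M.h ((extChartAt (𝓡 n) c.base).left_inv (c.mem_source hv)))
      (e := c.C.e j (tcoord c.base v).1) (fun α => c.C.η_e _ (c.tcoord_mem hv) α j) (by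
        have h2 := c.C.dh_e _ (c.tcoord_mem hv) j
        have h3 : fderiv ℝ c.f (tcoord c.base v).1 (c.C.e j (tcoord c.base v).1) = 0 := h2
        exact (congrArg (fun f : Vec n → ℝ => fderiv ℝ f (tcoord c.base v).1
          (c.C.e j (tcoord c.base v).1)) hA).symm.trans h3)
    rw [hof] at h1
    exact h1

theorem coord_reset (hA : c.IsAdapted) {v : TangentBundle (𝓡 n) Q} (hD : v ∈ M.D)
    (hv : v.proj ∈ c.O) : c.coord (M.reset v) = resetCoord (c.coord v) := by
  unfold resetCoord
  rw [c.coord_fst hA hv, c.coord_snd_fst hA hv]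
  by_cases h : v ∈ M.impactSurface
  · rw [M.reset_of_mem h, if_pos h.2, c.coord_impactMap hA hv h.2.1, c.coord_fst hA hv]
  · rw [M.reset_of_notMem h, if_neg fun h' => h ⟨hD, h'⟩]

/-- The state is in the domain of the chart, and its velocity coordinates are less than `R`. -/
def Confined (R : ℝ) (v : TangentBundle (𝓡 n) Q) : Prop :=
  v ∈ M.D ∧ v.proj ∈ c.O ∧ |(c.coord v).2.1| < R ∧ ‖(c.coord v).2.2.2‖ < R

theorem Confined.reset {c : StateChart M} {R : ℝ} {v : TangentBundle (𝓡 n) Q}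
    (h : c.Confined R v) : c.Confined R (M.reset v) := by
  by_cases hA : c.IsAdapted
  · obtain ⟨hD, hO, hu, hb⟩ := h
    refine ⟨M.reset_mem_D.2 hD, by rwa [M.reset_proj], ?_, ?_⟩
    · rwa [c.coord_reset hA hD hO, resetCoord_abs]
    · rwa [c.coord_reset hA hD hO, resetCoord_snd_snd]
  · rwa [M.reset_of_notMem fun himp => hA (c.isAdapted_of_mem h.2.1 himp.2.1)]

theorem Confined.eventually {c : StateChart M} {R : ℝ} {v : TangentBundle (𝓡 n) Q}
    (h : c.Confined R v) : ∀ᶠ v' in 𝓝 v, v' ∈ M.D → c.Confined R v' := by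
  have h1 := c.continuousAt_coord h.2.1
  have h2 : ContinuousAt (fun v => |(c.coord v).2.1|) v := h1.snd.fst.abs
  have h3 : ContinuousAt (fun v => ‖(c.coord v).2.2.2‖) v := h1.snd.snd.snd.norm
  filter_upwards [h2.eventually_lt_const h.2.2.1, h3.eventually_lt_const h.2.2.2,
    (c.isOpen_O.preimage ImpactSystem.continuous_proj).mem_nhds h.2.1] with v' hu hb hO hD
  exact ⟨hD, hO, hu, hb⟩

theorem exists_confined {v : TangentBundle (𝓡 n) Q} (hD : v ∈ M.D) (hv : v.proj ∈ c.O) :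
    ∃ R : ℕ, c.Confined (R + 1) v := by
  obtain ⟨R, hR⟩ := exists_nat_ge (max |(c.coord v).2.1| ‖(c.coord v).2.2.2‖)
  exact ⟨R, hD, hv, by linarith [le_max_left |(c.coord v).2.1| ‖(c.coord v).2.2.2‖],
    by linarith [le_max_right |(c.coord v).2.1| ‖(c.coord v).2.2.2‖]⟩

/-- A bounded Lipschitz extension of the vector field of the motion. -/
def extField (R : ℝ) : StateCoord n m → ℝ × (Fin (n - 1) → ℝ) × (Fin (n - m - 1) → ℝ) :=
  Classical.choose (c.C.exists_extension c.closedBall_subset R)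

theorem exists_lipschitz_extField (R : ℝ) : ∃ L : ℝ≥0, LipschitzWith L (c.extField R) :=
  (Classical.choose_spec (c.C.exists_extension c.closedBall_subset R)).1

theorem exists_norm_extField_le (R : ℝ) : ∃ B, ∀ x, ‖c.extField R x‖ ≤ B :=
  (Classical.choose_spec (c.C.exists_extension c.closedBall_subset R)).2.1

theorem Confined.fullField_eq {c : StateChart M} {R : ℝ} {v : TangentBundle (𝓡 n) Q}
    (h : c.Confined R v) :
    fullField (c.extField R) R (c.coord v) = ((c.coord v).2.1, c.C.field (c.coord v)) := by
  have h1 : c.extField R (c.coord v) = c.C.field (c.coord v) :=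
    (Classical.choose_spec (c.C.exists_extension c.closedBall_subset R)).2.2
      ⟨Metric.ball_subset_closedBall (c.position_mem_ball h.2.1), h.2.2.1.le, h.2.2.2.le⟩
  rw [fullField, h1, clamp_of_abs_le h.2.2.1.le]

variable {γ : ℝ → TangentBundle (𝓡 n) Q} {T : ℝ} {x : TangentBundle (𝓡 n) Q}

/-- The motion, in adapted coordinates, right after a time at which the state is confined. -/
theorem exists_coord_motion (hmn : m + 1 ≤ n) (hγ : M.IsHybridTrajectory γ T x) {t R : ℝ}
    (ht : t ∈ Ico 0 T) (hc : c.Confined R (γ t)) :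
    ∃ ε > 0, ∃ d : ℝ → StateCoord n m,
      (∀ s ∈ Ico t (t + ε), HasDerivAt d (fullField (c.extField R) R (d s)) s) ∧
      d t = c.coord (M.reset (γ t)) ∧
      ∀ s ∈ Ioo t (t + ε), s < T → c.Confined R (γ s) ∧ c.coord (γ s) = d s := by
  obtain ⟨ε, hε, κ, hκ, hκt, hκγ⟩ := hγ.right_motion t ht
  have h1 := hκ.continuousAt hmn isOpen_Ioo (t := t) ⟨by linarith, by linarith⟩
  have h2 : c.Confined R (κ t) := by rw [hκt]; exact hc.reset
  have h3 : ∀ᶠ s in 𝓝 t, κ s ∈ M.D → c.Confined R (κ s) := h1.eventually h2.eventually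
  obtain ⟨δ, hδ, hball⟩ := Metric.eventually_nhds_iff.1 h3
  have hconf : ∀ s ∈ Ico t (t + min ε δ), c.Confined R (κ s) := by
    intro s hs
    refine hball ?_ (hκ s ⟨by linarith [hs.1], hs.2.trans_le (by linarith [min_le_left ε δ])⟩).1
    rw [Real.dist_eq, abs_of_nonneg (by linarith [hs.1])]
    linarith [hs.2, min_le_right ε δ]
  refine ⟨min ε δ, lt_min hε hδ, fun s => c.coord (κ s), fun s hs => ?_, by simp only [hκt], ?_⟩
  · have h4 := hconf s hs
    rw [h4.fullField_eq]
    exact c.hasDerivAt_coord hκ isOpen_Ioo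
      ⟨by linarith [hs.1], hs.2.trans_le (by linarith [min_le_left ε δ])⟩ h4.2.1
  · intro s hs hsT
    have h5 := hκγ s ⟨hs.1, hs.2.trans_le (by linarith [min_le_left ε δ])⟩ hsT
    rw [h5]
    exact ⟨hconf s ⟨hs.1.le, hs.2⟩, rfl⟩

/-- In adapted coordinates, hybrid trajectories are reflected motions. -/
theorem isReflectedMotion (hmn : m + 1 ≤ n) (hγ : M.IsHybridTrajectory γ T x) (hA : c.IsAdapted)
    {s s' R : ℝ} (hs : 0 ≤ s) (hs' : s' ≤ T) (hconf : ∀ t ∈ Ico s s', c.Confined R (γ t))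
    (hnonneg : ∀ t ∈ Ico s s', 0 ≤ M.h (γ t).proj)
    (hreg : ∀ t ∈ Ico s s', M.h (γ t).proj = 0 → M.dh (γ t).proj (γ t).snd ≠ 0) :
    IsReflectedMotion (c.extField R) R (fun t => c.coord (γ (s + t))) (s' - s) where
  left t ht := by
    have h1 := hconf (s + t) ⟨by linarith [ht.1], by linarith [ht.2]⟩
    have h2 := hγ.left_continuous (s + t) ⟨by linarith [ht.1], by linarith [ht.2]⟩
    have h3 : ContinuousWithinAt (fun t => γ (s + t)) (Iio t) t :=
      ContinuousWithinAt.comp (t := Iio (s + t)) h2 (by fun_prop) fun r (hr : r < t) =>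
        (by simpa using hr : s + r < s + t)
    exact ContinuousAt.comp_continuousWithinAt (g := c.coord) (f := fun t => γ (s + t))
      (c.continuousAt_coord h1.2.1) h3
  right t ht := by
    have h1 := hconf (s + t) ⟨by linarith [ht.1], by linarith [ht.2]⟩
    obtain ⟨ε, hε, d, hd, hdt, hdγ⟩ := c.exists_coord_motion hmn hγ
      (t := s + t) ⟨by linarith [ht.1], by linarith [ht.2]⟩ h1
    refine ⟨ε, hε, fun r => d (s + r), fun r hr => ?_, ?_, fun r hr hrT => ?_⟩
    · exact (hd (s + r) ⟨by linarith [hr.1], by linarith [hr.2]⟩).comp_const_add s r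
    · exact hdt.trans (c.coord_reset hA h1.1 h1.2.1)
    · exact (hdγ (s + r) ⟨by linarith [hr.1], by linarith [hr.2]⟩ (by linarith)).2
  nonneg t ht := by
    have ht' : s + t ∈ Ico s s' := ⟨by linarith [ht.1], by linarith [ht.2]⟩
    rw [c.coord_fst hA (hconf _ ht').2.1]
    exact hnonneg _ ht'
  regular t ht := by
    have ht' : s + t ∈ Ico s s' := ⟨by linarith [ht.1], by linarith [ht.2]⟩
    rw [c.coord_fst hA (hconf _ ht').2.1, c.coord_snd_fst hA (hconf _ ht').2.1]
    exact hreg _ ht'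

/-- Without impacts, trajectories are solutions of the differential equation. -/
theorem mem_freePullback (hmn : m + 1 ≤ n) (hγ : M.IsHybridTrajectory γ T x)
    {s r R : ℝ} (hs : 0 ≤ s) (hr : s + r < T)
    (hconf : ∀ t ∈ Icc s (s + r), c.Confined R (γ t))
    (hfree : ∀ t ∈ Icc s (s + r), γ t ∉ M.impactSurface) {A : Set (StateCoord n m)}
    (hA : c.coord (γ (s + r)) ∈ A) : c.coord (γ s) ∈ freePullback (c.extField R) R r A := by
  have hright : ∀ t ∈ Icc 0 r, HasDerivWithinAt (fun t => c.coord (γ (s + t)))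
      (fullField (c.extField R) R (c.coord (γ (s + t)))) (Ioi t) t := by
    intro t ht
    have h1 := hconf (s + t) ⟨by linarith [ht.1], by linarith [ht.2]⟩
    obtain ⟨ε, hε, d, hd, hdt, hdγ⟩ := c.exists_coord_motion hmn hγ
      (t := s + t) ⟨by linarith [ht.1], by linarith [ht.2]⟩ h1
    rw [M.reset_of_notMem (hfree _ ⟨by linarith [ht.1], by linarith [ht.2]⟩)] at hdt
    have h2 := ((hd (s + t) ⟨le_rfl, by linarith⟩).comp_const_add s t).hasDerivWithinAt (s := Ioi t)
    rw [hdt] at h2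
    refine h2.congr_of_eventuallyEq ?_ hdt.symm
    have h3 : t < min (t + ε) (T - s) := lt_min (by linarith) (by linarith [ht.2])
    filter_upwards [Ioo_mem_nhdsGT h3] with τ hτ
    exact (hdγ (s + τ) ⟨by linarith [hτ.1], by linarith [hτ.2.trans_le (min_le_left _ _)]⟩
      (by linarith [hτ.2.trans_le (min_le_right _ _)])).2
  refine ⟨fun t => c.coord (γ (s + t)), fun t ht => ?_, fun t ht => hright t ⟨ht.1, ht.2.le⟩,
    by simp, hA⟩
  have h1 := hconf (s + t) ⟨by linarith [ht.1], by linarith [ht.2]⟩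
  have hR := (hright t ht).continuousWithinAt
  have hR' : ContinuousWithinAt (fun t => c.coord (γ (s + t))) (Ici t) t := by
    rw [← Ioi_insert]; exact hR.insert
  rcases ht.1.eq_or_lt with h0 | h0
  · subst h0
    exact hR'.mono Icc_subset_Ici_self
  · have h2 := hγ.left_continuous (s + t) ⟨by linarith [ht.1], by linarith [ht.2]⟩
    have h3 : ContinuousWithinAt (fun t => γ (s + t)) (Iio t) t :=
      ContinuousWithinAt.comp (t := Iio (s + t)) h2 (by fun_prop) fun r (hr : r < t) =>
        (by simpa using hr : s + r < s + t)
    have h4 : ContinuousWithinAt (fun t => c.coord (γ (s + t))) (Iio t) t :=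
      ContinuousAt.comp_continuousWithinAt (g := c.coord) (f := fun t => γ (s + t))
        (c.continuousAt_coord h1.2.1) h3
    have h5 := h4.union hR'
    rw [Iio_union_Ici] at h5
    exact h5.mono (subset_univ _)

end StateChart

/-! ### Pulling the singular set back through countably many charts. -/

variable {n m : ℕ} {Q : Type*} [TopologicalSpace Q]
  [ChartedSpace (EuclideanSpace ℝ (Fin n)) Q] [IsManifold (𝓡 n) ∞ Q] {M : ImpactSystem n m Q}

namespace StateChart

variable (c : StateChart M)

/-- States from which a motion in the chart reaches `A` at time `r`. -/
def pull (R r : ℝ) (A : Set (TangentBundle (𝓡 n) Q)) : Set (TangentBundle (𝓡 n) Q) :=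
  c.preimage (freePullback (c.extField R) R r (c.image A)) ∪
    c.preimage (reflectedPullback (c.extField R) R r (c.image A))

/-- States from which a motion in the chart reaches a singular state, with vanishing height and
normal velocity. -/
def singular (R : ℝ) : Set (TangentBundle (𝓡 n) Q) :=
  c.preimage (reflectedSingular (c.extField R) R
    (Metric.closedBall c.center.2 c.radius ×ˢ Metric.closedBall 0 R))

theorem chartNull_pull {R r : ℝ} (hR : 0 < R) (hr : 0 < r) {A : Set (TangentBundle (𝓡 n) Q)}
    (hA : ChartNull M A) : ChartNull M (c.pull R r A) := by
  have := isAddHaarMeasure_volume_prod (X := Fin (n - 1) → ℝ) (Y := Fin (n - m - 1) → ℝ)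
  obtain ⟨L, hL⟩ := c.exists_lipschitz_extField R
  obtain ⟨B, hB⟩ := c.exists_norm_extField_le R
  exact (c.chartNull_preimage (volume_freePullback_eq_zero hL R hr (hA c))).union
    (c.chartNull_preimage (volume_reflectedPullback_eq_zero hL hR hB hr (hA c)))

theorem chartNull_singular {R : ℝ} (hR : 0 < R) : ChartNull M (c.singular R) := by
  have := isAddHaarMeasure_volume_prod (X := Fin (n - 1) → ℝ) (Y := Fin (n - m - 1) → ℝ)
  obtain ⟨L, hL⟩ := c.exists_lipschitz_extField R
  obtain ⟨B, hB⟩ := c.exists_norm_extField_le R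
  refine c.chartNull_preimage (volume_reflectedSingular hL hR hB ?_)
  exact (Metric.isBounded_closedBall.prod Metric.isBounded_closedBall).measure_lt_top.ne

end StateChart

/-- The states which reach a singular state after a motion through finitely many charts. -/
def singularPullback {ι : Type*} (c : ι → StateChart M) : ℕ → Set (TangentBundle (𝓡 n) Q)
  | 0 => ⋃ (i : ι) (R : ℕ), (c i).singular (R + 1)
  | k + 1 => ⋃ (i : ι) (R : ℕ) (r : {r : ℚ // 0 < r}), (c i).pull (R + 1) (r : ℚ) (singularPullback c k)

theorem chartNull_singularPullback {ι : Type*} [Countable ι] (c : ι → StateChart M) (k : ℕ) :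
    ChartNull M (singularPullback c k) := by
  induction k with
  | zero =>
    exact ChartNull.iUnion fun i => ChartNull.iUnion fun R => (c i).chartNull_singular (by positivity)
  | succ k ih =>
    exact ChartNull.iUnion fun i => ChartNull.iUnion fun R => ChartNull.iUnion fun r =>
      (c i).chartNull_pull (by positivity) (by exact_mod_cast r.2) ih

variable {γ : ℝ → TangentBundle (𝓡 n) Q} {T : ℝ} {x : TangentBundle (𝓡 n) Q}

theorem StateChart.exists_confined_window (hmn : m + 1 ≤ n) (hγ : M.IsHybridTrajectory γ T x)
    (c : StateChart M) {t : ℝ} (ht : t ∈ Ico 0 T) (hc : (γ t).proj ∈ c.O) :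
    ∃ η > 0, ∃ R : ℕ, ∀ s ∈ Ioo (t - η) (t + η), 0 ≤ s → s < T → c.Confined (R + 1) (γ s) := by
  obtain ⟨R, hR⟩ := c.exists_confined (hγ.mem_D ht) hc
  obtain ⟨ε, hε, d, -, -, hd⟩ := c.exists_coord_motion hmn hγ ht hR
  have hleft : ∃ η > 0, ∀ s ∈ Ioo (t - η) t, 0 ≤ s → c.Confined (R + 1) (γ s) := by
    rcases ht.1.eq_or_lt with h0 | h0
    · exact ⟨1, one_pos, fun s hs hs0 => absurd hs.2 (by linarith)⟩
    · have h1 := (hγ.tendsto_left ⟨h0, ht.2⟩).eventually hR.eventually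
      obtain ⟨a, ha, has⟩ := mem_nhdsLT_iff_exists_Ioo_subset.1 h1
      exact ⟨t - a, by linarith [show a < t from ha], fun s hs hs0 =>
        has ⟨by linarith [hs.1], hs.2⟩ (hγ.mem_D ⟨hs0, hs.2.trans ht.2⟩)⟩
  obtain ⟨η, hη, hηs⟩ := hleft
  refine ⟨min ε η, lt_min hε hη, R, fun s hs hs0 hsT => ?_⟩
  rcases lt_trichotomy s t with h | h | h
  · exact hηs s ⟨by linarith [hs.1, min_le_right ε η], h⟩ hs0
  · rw [h]; exact hR
  · exact (hd s ⟨h, by linarith [hs.2, min_le_left ε η]⟩ hsT).1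

/-- One chart covers a neighbourhood in time of `s₀`, and a motion inside it carries membership from
just after `s₀` back to just before. -/
theorem mem_singularPullback_step (hmn : m + 1 ≤ n) (hγ : M.IsHybridTrajectory γ T x) {ι : Type*}
    {c : ι → StateChart M} (hcov : ∀ q, ∃ i, q ∈ (c i).O) {T' s₀ : ℝ} (hT' : T' ≤ T)
    (hs₀ : s₀ ∈ Ico 0 T')
    (hmode : ∃ η > 0, (∀ t ∈ Ioo (s₀ - η) (s₀ + η), 0 ≤ t → t < T' → γ t ∉ M.impactSurface) ∨
      ∀ t ∈ Ioo (s₀ - η) (s₀ + η), 0 ≤ t → t < T' → 0 ≤ M.h (γ t).proj ∧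
        (M.h (γ t).proj = 0 → M.dh (γ t).proj (γ t).snd ≠ 0)) :
    ∃ η > 0, (∀ t ∈ Ioo s₀ (s₀ + η), t < T' → γ t ∈ ⋃ k, singularPullback c k) →
      ∀ s ∈ Ioc (s₀ - η) s₀, 0 ≤ s → γ s ∈ ⋃ k, singularPullback c k := by
  obtain ⟨η₁, hη₁, hmode⟩ := hmode
  obtain ⟨i, hi⟩ := hcov (γ s₀).proj
  obtain ⟨η₂, hη₂, R, hconf⟩ := (c i).exists_confined_window hmn hγ
    (t := s₀) ⟨hs₀.1, hs₀.2.trans_le hT'⟩ hi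
  set η := min (min η₁ η₂) (T' - s₀) with hη
  have hη0 : 0 < η := lt_min (lt_min hη₁ hη₂) (by linarith [hs₀.2])
  have hηη₁ : η ≤ η₁ := (min_le_left _ _).trans (min_le_left _ _)
  have hηη₂ : η ≤ η₂ := (min_le_left _ _).trans (min_le_right _ _)
  have hηT : η ≤ T' - s₀ := min_le_right _ _
  refine ⟨η, hη0, fun hgood s hs hs0 => ?_⟩
  -- Since membership holds at all times just after `s₀`, the elapsed time can be taken rational,
  -- which keeps the unions countable.
  obtain ⟨r, hr1, hr2⟩ := exists_rat_btwn (show s₀ - s < s₀ + η - s by linarith)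
  have hr0 : (0 : ℝ) < r := by linarith [hs.2]
  obtain ⟨k, hk⟩ := mem_iUnion.1 (hgood (s + r) ⟨by linarith, by linarith⟩ (by linarith))
  have hcf : ∀ t ∈ Ico s (s₀ + η), (c i).Confined (R + 1) (γ t) := fun t ht =>
    hconf t ⟨by linarith [ht.1, hs.1], by linarith [ht.2]⟩ (hs0.trans ht.1) (by linarith [ht.2])
  have himg : (c i).coord (γ (s + r)) ∈ (c i).image (singularPullback c k) := by
    have h1 := hcf (s + r) ⟨by linarith, by linarith⟩
    exact ⟨γ (s + r), ⟨hk, h1.1, h1.2.1⟩, rfl⟩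
  have hs1 := hcf s ⟨le_rfl, by linarith [hs.2]⟩
  refine mem_iUnion.2 ⟨k + 1, mem_iUnion.2 ⟨i, mem_iUnion.2 ⟨R, mem_iUnion.2
    ⟨⟨r, by exact_mod_cast hr0⟩, ?_⟩⟩⟩⟩
  have hfree : (∀ t ∈ Icc s (s + r), γ t ∉ M.impactSurface) →
      γ s ∈ (c i).pull (R + 1) r (singularPullback c k) := fun h =>
    Or.inl ⟨hs1.1, hs1.2.1, (c i).mem_freePullback hmn hγ hs0 (by linarith)
      (fun t ht => hcf t ⟨ht.1, by linarith [ht.2]⟩) h himg⟩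
  rcases hmode with hmode | hmode
  · exact hfree fun t ht => hmode t ⟨by linarith [ht.1, hs.1], by linarith [ht.2]⟩
      (hs0.trans ht.1) (by linarith [ht.2])
  -- A chart that is not adapted does not meet `h = 0`, so the motion in it is free.
  · by_cases hA : (c i).IsAdapted
    · refine Or.inr ⟨hs1.1, hs1.2.1, fun t => (c i).coord (γ (s + t)), s₀ + η - s,
        (c i).isReflectedMotion hmn hγ hA hs0 (by linarith) hcf (fun t ht => ?_) (fun t ht => ?_),
        by linarith, by simp, himg⟩
      · exact (hmode t ⟨by linarith [ht.1, hs.1], by linarith [ht.2]⟩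
          (hs0.trans ht.1) (by linarith [ht.2])).1
      · exact (hmode t ⟨by linarith [ht.1, hs.1], by linarith [ht.2]⟩
          (hs0.trans ht.1) (by linarith [ht.2])).2
    · exact hfree fun t ht himp => hA ((c i).isAdapted_of_mem
        (hcf t ⟨ht.1, by linarith [ht.2]⟩).2.1 himp.2.1)

/-- The infimum of the times after which membership holds can be pushed backward unless it is `0`.
The infimum replaces a subdivision into finitely many charts. -/
theorem mem_singularPullback (hmn : m + 1 ≤ n) (hγ : M.IsHybridTrajectory γ T x) {ι : Type*}
    {c : ι → StateChart M} (hcov : ∀ q, ∃ i, q ∈ (c i).O) {T' : ℝ} (hT' : T' ≤ T) (hT0 : 0 < T')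
    (hmode : ∀ s₀ ∈ Ico 0 T', ∃ η > 0,
      (∀ t ∈ Ioo (s₀ - η) (s₀ + η), 0 ≤ t → t < T' → γ t ∉ M.impactSurface) ∨
      ∀ t ∈ Ioo (s₀ - η) (s₀ + η), 0 ≤ t → t < T' → 0 ≤ M.h (γ t).proj ∧
        (M.h (γ t).proj = 0 → M.dh (γ t).proj (γ t).snd ≠ 0))
    (hend : ∃ s₁ < T', ∀ t ∈ Ioo s₁ T', γ t ∈ ⋃ k, singularPullback c k) :
    x ∈ ⋃ k, singularPullback c k := by
  obtain ⟨s₁, hs₁, hend⟩ := hend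
  set G := {s | s ∈ Ico 0 T' ∧ ∀ t ∈ Ioo s T', γ t ∈ ⋃ k, singularPullback c k} with hG
  have hne : G.Nonempty := ⟨max s₁ 0, ⟨le_max_right _ _, max_lt hs₁ hT0⟩, fun t ht =>
    hend t ⟨(le_max_left _ _).trans_lt ht.1, ht.2⟩⟩
  have hbdd : BddBelow G := ⟨0, fun s hs => hs.1.1⟩
  obtain ⟨g, hg⟩ := hne
  have hs₀ : sInf G ∈ Ico 0 T' :=
    ⟨le_csInf ⟨g, hg⟩ fun s hs => hs.1.1, (csInf_le hbdd hg).trans_lt hg.1.2⟩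
  have hafter : ∀ t ∈ Ioo (sInf G) T', γ t ∈ ⋃ k, singularPullback c k := by
    intro t ht
    obtain ⟨s, hs, hst⟩ := exists_lt_of_csInf_lt ⟨g, hg⟩ ht.1
    exact hs.2 t ⟨hst, ht.2⟩
  obtain ⟨η, hη, hstep⟩ := mem_singularPullback_step hmn hγ hcov hT' hs₀ (hmode _ hs₀)
  have hbefore := hstep fun t ht htT => hafter t ⟨ht.1, htT⟩
  have h0 : sInf G = 0 := by
    by_contra hne
    have hpos : 0 < sInf G := lt_of_le_of_ne hs₀.1 (Ne.symm hne)
    have hmem : max 0 (sInf G - η / 2) ∈ G := by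
      refine ⟨⟨le_max_left _ _, (max_lt hpos (by linarith)).trans hs₀.2⟩, fun t ht => ?_⟩
      rcases le_or_gt t (sInf G) with h | h
      · exact hbefore t ⟨by linarith [(le_max_right _ _).trans_lt ht.1], h⟩
          ((le_max_left _ _).trans ht.1.le)
      · exact hafter t ⟨h, ht.2⟩
    exact absurd (csInf_le hbdd hmem) (not_le.2 (max_lt hpos (by linarith)))
  have := hbefore (sInf G) ⟨by linarith, le_rfl⟩ hs₀.1
  rwa [h0, hγ.init] at this

/-! ### First impact, first grazing, and the sign of the height. -/

variable {n m : ℕ} {Q : Type*} [TopologicalSpace Q]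
  [ChartedSpace (EuclideanSpace ℝ (Fin n)) Q] [IsManifold (𝓡 n) ∞ Q] {M : ImpactSystem n m Q}
  {γ : ℝ → TangentBundle (𝓡 n) Q} {T : ℝ} {x : TangentBundle (𝓡 n) Q}

namespace ImpactSystem.IsHybridTrajectory

/-- The infimum of the impact times is attained because impacts do not accumulate from the right. -/
theorem exists_first_impact (hmn : m + 1 ≤ n) (hγ : M.IsHybridTrajectory γ T x)
    (hex : ∃ t ∈ Ico 0 T, γ t ∈ M.impactSurface) :
    ∃ t ∈ Ico 0 T, γ t ∈ M.impactSurface ∧ ∀ s ∈ Ico 0 t, γ s ∉ M.impactSurface := by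
  set S := {t | t ∈ Ico 0 T ∧ γ t ∈ M.impactSurface} with hS
  obtain ⟨t₀, ht₀⟩ : S.Nonempty := by
    obtain ⟨t, h1, h2⟩ := hex; exact ⟨t, h1, h2⟩
  have hbdd : BddBelow S := ⟨0, fun s hs => hs.1.1⟩
  have hs : sInf S ∈ Ico 0 T :=
    ⟨le_csInf ⟨t₀, ht₀⟩ fun s hs => hs.1.1, (csInf_le hbdd ht₀).trans_lt ht₀.1.2⟩
  refine ⟨sInf S, hs, ?_, fun s hs' himp =>
    absurd (csInf_le hbdd (show s ∈ S from ⟨⟨hs'.1, hs'.2.trans hs.2⟩, himp⟩)) (not_le.2 hs'.2)⟩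
  by_contra hnot
  obtain ⟨ε, hε, hno⟩ := hγ.exists_no_impact hmn hs
  obtain ⟨s, hsS, hlt⟩ := exists_lt_of_csInf_lt ⟨t₀, ht₀⟩ (show sInf S < sInf S + ε by linarith)
  refine hno s ⟨lt_of_le_of_ne (csInf_le hbdd hsS) ?_, hlt⟩ hsS.1.2 hsS.2
  rintro heq
  exact hnot (heq ▸ hsS.2)

/-- The first time after an impact at which height and normal velocity vanish, or else the end of
the trajectory. -/
theorem exists_regular_end (hmn : m + 1 ≤ n) (hγ : M.IsHybridTrajectory γ T x) {t : ℝ}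
    (ht : t ∈ Ico 0 T) (himp : γ t ∈ M.impactSurface) :
    ∃ T', t < T' ∧ T' ≤ T ∧
      (∀ s ∈ Ioo t T', M.h (γ s).proj = 0 → M.dh (γ s).proj (γ s).snd ≠ 0) ∧
      (T' = T ∨ T' < T ∧ M.h (γ T').proj = 0 ∧ M.dh (γ T').proj (γ T').snd = 0) := by
  set S := {s | s ∈ Ioo t T ∧ M.h (γ s).proj = 0 ∧ M.dh (γ s).proj (γ s).snd = 0} with hS
  by_cases hne : S.Nonempty
  · obtain ⟨t₀, ht₀⟩ := hne
    -- The height is positive right after the impact, so grazing times stay away from `t`.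
    obtain ⟨ε, hε, hpos⟩ := hγ.exists_h_pos ht himp.2.1 (dh_reset_pos himp)
    have hlb : ∀ s ∈ S, t + ε ≤ s := by
      intro s hs
      by_contra hlt
      exact (hpos s ⟨hs.1.1, not_le.1 hlt⟩ hs.1.2).ne' hs.2.1
    have hbdd : BddBelow S := ⟨_, hlb⟩
    have h1 : t + ε ≤ sInf S := le_csInf ⟨t₀, ht₀⟩ hlb
    have h2 : sInf S < T := (csInf_le hbdd ht₀).trans_lt ht₀.1.2
    have h3 : sInf S ∈ S := by
      by_contra hnot
      have hfreq : ∃ᶠ s in 𝓝[>] (sInf S), s ∈ S := by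
        rw [frequently_iff]
        intro U hU
        obtain ⟨b, hb, hbU⟩ := mem_nhdsGT_iff_exists_Ioo_subset.1 hU
        obtain ⟨s, hsS, hlt⟩ := exists_lt_of_csInf_lt ⟨t₀, ht₀⟩ hb
        exact ⟨s, hbU ⟨lt_of_le_of_ne (csInf_le hbdd hsS) fun h => hnot (h ▸ hsS), hlt⟩, hsS⟩
      have hmem : sInf S ∈ Ico 0 T := ⟨by linarith [ht.1], h2⟩
      have h4 : M.h (γ (sInf S)).proj = 0 :=
        isClosed_singleton.mem_of_frequently_of_tendsto (hfreq.mono fun s hs => hs.2.1)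
          (hγ.tendsto_h_right hmn hmem)
      have h5 : M.dh (M.reset (γ (sInf S))).proj (M.reset (γ (sInf S))).snd = 0 :=
        isClosed_singleton.mem_of_frequently_of_tendsto (hfreq.mono fun s hs => hs.2.2)
          (hγ.tendsto_dh_right hmn hmem)
      -- The right limit controls the state after the reset. An impact would make its normal
      -- velocity positive, so there is no impact and the infimum is itself a grazing time.
      by_cases himp' : γ (sInf S) ∈ M.impactSurface
      · exact (dh_reset_pos himp').ne' h5
      · rw [M.reset_of_notMem himp'] at h5
        exact hnot ⟨⟨by linarith, h2⟩, h4, h5⟩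
    exact ⟨sInf S, by linarith, h2.le, fun s hs h h' => absurd
      (csInf_le hbdd (show s ∈ S from ⟨⟨hs.1, hs.2.trans h2⟩, h, h'⟩)) (not_le.2 hs.2),
      Or.inr ⟨h2, h3.2⟩⟩
  · exact ⟨T, ht.2, le_rfl, fun s hs h h' => hne ⟨s, hs, h, h'⟩, Or.inl rfl⟩

/-- At height zero the state is an impact, or by regularity already has positive normal velocity; in
both cases the height increases next. -/
theorem h_nonneg (hmn : m + 1 ≤ n) (hγ : M.IsHybridTrajectory γ T x) {t T' : ℝ}
    (ht : t ∈ Ico 0 T) (himp : γ t ∈ M.impactSurface) (hT' : T' ≤ T)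
    (hreg : ∀ s ∈ Ioo t T', M.h (γ s).proj = 0 → M.dh (γ s).proj (γ s).snd ≠ 0) :
    ∀ s ∈ Ico t T', 0 ≤ M.h (γ s).proj := by
  intro s hs
  refine continuous_induction (P := fun s => 0 ≤ M.h (γ s).proj) himp.2.1.ge ?_ ?_ s ⟨hs.1, le_rfl⟩
  · intro r hr ih
    have h1 := hγ.tendsto_h_left (t := r) ⟨by linarith [ht.1, hr.1], by linarith [hr.2, hs.2]⟩
    refine ge_of_tendsto h1 ?_
    filter_upwards [Ioo_mem_nhdsLT hr.1] with τ hτ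
    exact ih τ ⟨hτ.1.le, hτ.2⟩
  · intro r hr ih
    have hr' : r ∈ Ico 0 T := ⟨by linarith [ht.1, hr.1], by linarith [hr.2, hs.2]⟩
    rcases (ih r ⟨hr.1, le_rfl⟩).eq_or_lt with h0 | h0
    · have hu : 0 < M.dh (M.reset (γ r)).proj (M.reset (γ r)).snd := by
        by_cases himp' : γ r ∈ M.impactSurface
        · exact dh_reset_pos himp'
        · rcases hr.1.eq_or_lt with heq | hlt
          · exact absurd (heq ▸ himp) himp'
          · rw [M.reset_of_notMem himp']
            refine lt_of_le_of_ne (not_lt.1 fun h => himp' ⟨hγ.mem_D hr', h0.symm, h⟩) ?_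
            exact (hreg r ⟨hlt, by linarith [hr.2, hs.2]⟩ h0.symm).symm
      obtain ⟨ε, hε, hpos⟩ := hγ.exists_h_pos hr' h0.symm hu
      exact ⟨ε, hε, fun τ hτ hτs => (hpos τ hτ (by linarith [hs.2])).le⟩
    · have h1 := (hγ.tendsto_h_right hmn hr').eventually_const_lt h0
      obtain ⟨b, hb, hbs⟩ := mem_nhdsGT_iff_exists_Ioo_subset.1 h1
      exact ⟨b - r, by linarith [show r < b from hb], fun τ hτ _ =>
        (show 0 < M.h (γ τ).proj from hbs ⟨hτ.1, by linarith [hτ.2]⟩).le⟩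

theorem hasDerivWithinAt_h (hγ : M.IsHybridTrajectory γ T x) {t : ℝ} (ht : t ∈ Ico 0 T) :
    HasDerivWithinAt (fun s => M.h (γ s).proj)
      (M.dh (M.reset (γ t)).proj (M.reset (γ t)).snd) (Ici t) t := by
  obtain ⟨ε, hε, c, hc, hct, hcγ⟩ := hγ.right_motion t ht
  have h1 := hc.hasDerivAt_h (t := t) ⟨by linarith, by linarith⟩
  rw [hct] at h1
  refine (h1.hasDerivWithinAt (s := Ici t)).congr_of_eventuallyEq ?_ ?_
  · filter_upwards [Ico_mem_nhdsGE (lt_min (show t < t + ε by linarith) ht.2)] with s hs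
    rcases hs.1.eq_or_lt with h | h
    · rw [← h, hct, M.reset_proj]
    · rw [hcγ s ⟨h, hs.2.trans_le (min_le_left _ _)⟩ (hs.2.trans_le (min_le_right _ _))]
  · rw [hct, M.reset_proj]

/-- Left continuity makes `dh(v)` negative just before the impact. With no earlier jump the height
decreases to zero there, so it was nonnegative. -/
theorem regular_before_first_impact (hγ : M.IsHybridTrajectory γ T x) {t : ℝ}
    (ht : t ∈ Ico 0 T) (himp : γ t ∈ M.impactSurface)
    (hno : ∀ s ∈ Ico 0 t, γ s ∉ M.impactSurface) :
    ∃ η > 0, ∀ s ∈ Ioo (t - η) t, 0 ≤ s → 0 ≤ M.h (γ s).proj ∧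
      (M.h (γ s).proj = 0 → M.dh (γ s).proj (γ s).snd ≠ 0) := by
  rcases ht.1.eq_or_lt with h0 | h0
  · exact ⟨1, one_pos, fun s hs hs0 => absurd hs.2 (by linarith)⟩
  have h1 := (hγ.tendsto_dh_left ⟨h0, ht.2⟩).eventually_lt_const himp.2.2
  obtain ⟨a, ha, has⟩ := mem_nhdsLT_iff_exists_Ioo_subset.1 h1
  refine ⟨t - a, by linarith [show a < t from ha], fun s hs hs0 => ⟨?_, fun _ =>
    (show M.dh (γ s).proj (γ s).snd < 0 from has ⟨by linarith [hs.1], hs.2⟩).ne⟩⟩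
  have h2 := image_le_of_deriv_right_lt_deriv_boundary (f := fun s => M.h (γ s).proj)
    (f' := fun s => M.dh (M.reset (γ s)).proj (M.reset (γ s)).snd) (a := s) (b := t)
    (B := fun _ => M.h (γ s).proj) (B' := fun _ => 0) (fun r hr => ?_)
    (fun r hr => hγ.hasDerivWithinAt_h ⟨hs0.trans hr.1, hr.2.trans ht.2⟩) le_rfl
    (fun _ => hasDerivAt_const _ _) (fun r hr _ => ?_) ⟨hs.2.le, le_rfl⟩
  · exact himp.2.1.symm.le.trans h2
  · have h3 := (hγ.hasDerivWithinAt_h (t := r) ⟨hs0.trans hr.1, hr.2.trans_lt ht.2⟩).continuousWithinAt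
    rcases hr.1.eq_or_lt with h | h
    · subst h
      exact h3.mono Icc_subset_Ici_self
    · have h4 : ContinuousWithinAt (fun s => M.h (γ s).proj) (Iio r) r :=
        hγ.tendsto_h_left ⟨hs0.trans_lt h, hr.2.trans_lt ht.2⟩
      have h5 := h4.union h3
      rw [Iio_union_Ici] at h5
      exact h5.mono (subset_univ _)
  · rw [M.reset_of_notMem (hno r ⟨hs0.trans hr.1, hr.2⟩)]
    exact has ⟨by linarith [hs.1, hr.1], hr.2⟩

/-- At every time before `T'`, locally there are no impacts or the trajectory is regular. -/
theorem local_modes (hmn : m + 1 ≤ n) (hγ : M.IsHybridTrajectory γ T x) {t T' : ℝ}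
    (ht : t ∈ Ico 0 T) (himp : γ t ∈ M.impactSurface)
    (hno : ∀ s ∈ Ico 0 t, γ s ∉ M.impactSurface) (hT' : T' ≤ T)
    (hreg : ∀ s ∈ Ioo t T', M.h (γ s).proj = 0 → M.dh (γ s).proj (γ s).snd ≠ 0) :
    ∀ s₀ ∈ Ico 0 T', ∃ η > 0,
      (∀ t ∈ Ioo (s₀ - η) (s₀ + η), 0 ≤ t → t < T' → γ t ∉ M.impactSurface) ∨
      ∀ t ∈ Ioo (s₀ - η) (s₀ + η), 0 ≤ t → t < T' → 0 ≤ M.h (γ t).proj ∧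
        (M.h (γ t).proj = 0 → M.dh (γ t).proj (γ t).snd ≠ 0) := by
  intro s₀ hs₀
  rcases lt_or_ge s₀ t with hlt | hle
  · exact ⟨t - s₀, by linarith, Or.inl fun s hs hs0 _ => hno s ⟨hs0, by linarith [hs.2]⟩⟩
  · obtain ⟨η, hη, hbefore⟩ := hγ.regular_before_first_impact ht himp hno
    refine ⟨η, hη, Or.inr fun s hs hs0 hsT => ?_⟩
    rcases lt_trichotomy s t with h | h | h
    · exact hbefore s ⟨by linarith [hs.1], h⟩ hs0
    · rw [h]; exact ⟨himp.2.1.ge, fun _ => himp.2.2.ne⟩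
    · exact ⟨hγ.h_nonneg hmn ht himp hT' hreg s ⟨h.le, hsT⟩, hreg s ⟨h, hsT⟩⟩

/-- The normal velocity comes arbitrarily close to zero before an accumulation of impacts. -/
theorem exists_abs_dh_lt (hmn : m + 1 ≤ n) (hγ : M.IsHybridTrajectory γ T x) {s t ε : ℝ}
    (hs : s ∈ Ico 0 T) (ht : t ∈ Ioo s T) (hims : γ s ∈ M.impactSurface)
    (himt : γ t ∈ M.impactSurface) (hε : 0 < ε) :
    ∃ r ∈ Icc s t, |M.dh (γ r).proj (γ r).snd| < ε := by
  by_contra! hcon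
  -- After the first impact the normal velocity is positive. If it stays at distance `ε` from zero
  -- it cannot change sign continuously, and a jump occurs only from a negative value, so the second
  -- impact could not happen.
  have key : ∀ r ∈ Icc s t, r = s ∨ 0 < M.dh (γ r).proj (γ r).snd := by
    refine continuous_induction (P := fun r => r = s ∨ 0 < M.dh (γ r).proj (γ r).snd)
      (Or.inl rfl) ?_ ?_
    · intro r hr ih
      right
      have h1 : 0 ≤ M.dh (γ r).proj (γ r).snd := by
        refine ge_of_tendsto (hγ.tendsto_dh_left (t := r)
          ⟨by linarith [hs.1, hr.1], by linarith [hr.2, ht.2]⟩) ?_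
        filter_upwards [Ioo_mem_nhdsLT hr.1] with τ hτ
        exact ((ih τ ⟨hτ.1.le, hτ.2⟩).resolve_left hτ.1.ne').le
      refine lt_of_le_of_ne h1 fun h => ?_
      have h2 := hcon r ⟨hr.1.le, hr.2⟩
      rw [← h, abs_zero] at h2
      linarith
    · intro r hr ih
      have hr' : r ∈ Ico 0 T := ⟨by linarith [hs.1, hr.1], by linarith [hr.2, ht.2]⟩
      have hu : 0 < M.dh (M.reset (γ r)).proj (M.reset (γ r)).snd := by
        rcases ih r ⟨hr.1, le_rfl⟩ with h | h
        · rw [h]; exact dh_reset_pos hims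
        · rwa [M.reset_of_notMem fun himp => lt_asymm h himp.2.2]
      obtain ⟨b, hb, hbs⟩ := mem_nhdsGT_iff_exists_Ioo_subset.1
        ((hγ.tendsto_dh_right hmn hr').eventually_const_lt hu)
      exact ⟨b - r, by linarith [show r < b from hb], fun τ hτ _ =>
        Or.inr (hbs ⟨hτ.1, by linarith [hτ.2]⟩)⟩
  exact lt_asymm ((key t ⟨ht.1.le, le_rfl⟩).resolve_left ht.1.ne') himt.2.2

end ImpactSystem.IsHybridTrajectory

theorem StateChart.mem_singular (hmn : m + 1 ≤ n) (hγ : M.IsHybridTrajectory γ T x)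
    (c : StateChart M) (hA : c.IsAdapted) {s T' R : ℝ} (hs : 0 ≤ s) (hsT : s < T')
    (hs1 : T' - s ≤ 1) (hT' : T' ≤ T) (hconf : ∀ t ∈ Ico s T', c.Confined R (γ t))
    (hnonneg : ∀ t ∈ Ico s T', 0 ≤ M.h (γ t).proj)
    (hreg : ∀ t ∈ Ico s T', M.h (γ t).proj = 0 → M.dh (γ t).proj (γ t).snd ≠ 0)
    (hh : ∀ t ∈ Ico s T', ∀ ε > 0, ∃ t' ∈ Ico t T', |M.h (γ t').proj| < ε)
    (hu : ∀ t ∈ Ico s T', ∀ ε > 0, ∃ t' ∈ Ico t T', |M.dh (γ t').proj (γ t').snd| < ε) :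
    γ s ∈ c.singular R := by
  have h0 := hconf s ⟨le_rfl, hsT⟩
  refine ⟨h0.1, h0.2.1, fun t => c.coord (γ (s + t)), T' - s, by linarith, hs1,
    c.isReflectedMotion hmn hγ hA hs hT' hconf hnonneg hreg, by simp, fun t ht => ?_,
    fun t ht ε hε => ?_, fun t ht ε hε => ?_⟩
  · have h1 := hconf (s + t) ⟨by linarith [ht.1], by linarith [ht.2]⟩
    have h2 := Metric.ball_subset_closedBall (c.position_mem_ball h1.2.1)
    rw [Metric.mem_closedBall, Prod.dist_eq, max_le_iff] at h2
    exact ⟨h2.2, mem_closedBall_zero_iff.2 h1.2.2.2.le⟩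
  · obtain ⟨t', ht', h⟩ := hh (s + t) ⟨by linarith [ht.1], by linarith [ht.2]⟩ ε hε
    refine ⟨t' - s, ⟨by linarith [ht'.1], by linarith [ht'.2]⟩, ?_⟩
    simp only [add_sub_cancel]
    rwa [c.coord_fst hA (hconf t' ⟨by linarith [ht.1, ht'.1], ht'.2⟩).2.1]
  · obtain ⟨t', ht', h⟩ := hu (s + t) ⟨by linarith [ht.1], by linarith [ht.2]⟩ ε hε
    refine ⟨t' - s, ⟨by linarith [ht'.1], by linarith [ht'.2]⟩, ?_⟩
    simp only [add_sub_cancel]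
    rwa [c.coord_snd_fst hA (hconf t' ⟨by linarith [ht.1, ht'.1], ht'.2⟩).2.1]

/-! ### Staying in one chart up to the accumulation time. -/

variable {n m : ℕ} {Q : Type*} [TopologicalSpace Q]
  [ChartedSpace (EuclideanSpace ℝ (Fin n)) Q] [IsManifold (𝓡 n) ∞ Q] {M : ImpactSystem n m Q}
  {γ : ℝ → TangentBundle (𝓡 n) Q} {T : ℝ} {x : TangentBundle (𝓡 n) Q}

/-- The coordinates up to the sign of the normal velocity. -/
def foldCoord {Z : Type*} (x : ℝ × ℝ × Z) : ℝ × ℝ × Z := (x.1, |x.2.1|, x.2.2)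

theorem dist_foldCoord_le {Z : Type*} [NormedAddCommGroup Z] (x y : ℝ × ℝ × Z) :
    dist (foldCoord x) (foldCoord y) ≤ dist x y := by
  simp only [foldCoord, Prod.dist_eq]
  refine max_le_max le_rfl (max_le_max ?_ le_rfl)
  rw [Real.dist_eq, Real.dist_eq]
  exact abs_abs_sub_abs_le_abs_sub _ _

theorem foldCoord_resetCoord {Z : Type*} [NormedAddCommGroup Z] [NormedSpace ℝ Z]
    (x : ℝ × ℝ × Z) : foldCoord (resetCoord x) = foldCoord x :=
  Prod.ext (resetCoord_fst x) (Prod.ext (resetCoord_abs x) (resetCoord_snd_snd x))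

theorem continuous_foldCoord {Z : Type*} [NormedAddCommGroup Z] :
    Continuous (foldCoord : ℝ × ℝ × Z → ℝ × ℝ × Z) := by
  unfold foldCoord; fun_prop

/-- A trajectory with a cluster point at its end stays in one chart before its end. -/
theorem StateChart.exists_confined_end [T2Space Q] (hmn : m + 1 ≤ n)
    (hγ : M.IsHybridTrajectory γ T x) (c : StateChart M) (hA : c.IsAdapted)
    {v : TangentBundle (𝓡 n) Q} (hv : v.proj ∈ c.O) {t : ℕ → ℝ} (ht : Tendsto t atTop (𝓝 T))
    (htT : ∀ i, t i ∈ Ico 0 T) (hcl : MapClusterPt v atTop fun i => γ (t i)) :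
    ∃ s ∈ Ico 0 T, ∃ R : ℕ, ∀ r ∈ Ico s T, c.Confined (R + 1) (γ r) := by
  set p := ((c.coord v).1, (c.coord v).2.2.1) with hp
  obtain ⟨ρ, hρ, hball⟩ := Metric.nhds_basis_closedBall.mem_iff.1
    (Metric.isOpen_ball.mem_nhds (c.position_mem_ball hv))
  -- Within folded distance `ρ` of `v` the velocity coordinates are then less than `R + 1`.
  obtain ⟨R, hR⟩ := exists_nat_ge (‖c.coord v‖ + ρ)
  obtain ⟨B, hB⟩ := c.exists_norm_extField_le (R + 1)
  have hR0 : (0 : ℝ) ≤ R + 1 := by positivity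
  set C := max ((R : ℝ) + 1) B with hC
  have hC0 : 0 < C := lt_max_of_lt_left (by positivity)
  -- Folded coordinates do not change at impacts, so this distance grows at rate at most `C` however
  -- many impacts occur.
  set θ : ℝ → ℝ := fun r => dist (foldCoord (c.coord (γ r))) (foldCoord (c.coord v)) with hθ
  have hpos : ∀ r, dist ((c.coord (γ r)).1, (c.coord (γ r)).2.2.1) p ≤ θ r := by
    intro r
    simp only [hθ, hp, foldCoord, Prod.dist_eq]
    exact max_le_max le_rfl ((le_max_left _ _).trans (le_max_right _ _))
  have hconf : ∀ r ∈ Ico 0 T, (γ r).proj ∈ c.O → θ r ≤ ρ → c.Confined (R + 1) (γ r) := by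
    intro r hr hO hθr
    refine ⟨hγ.mem_D hr, hO, ?_, ?_⟩
    · have h1 : |(|(c.coord (γ r)).2.1| - |(c.coord v).2.1|)| ≤ θ r := by
        simp only [hθ, foldCoord, Prod.dist_eq, ← Real.dist_eq]
        exact (le_max_left _ _).trans (le_max_right _ _)
      have h2 : |(c.coord v).2.1| ≤ ‖c.coord v‖ :=
        (norm_fst_le (c.coord v).2).trans (norm_snd_le (c.coord v))
      linarith [le_abs_self (|(c.coord (γ r)).2.1| - |(c.coord v).2.1|)]
    · have h1 : ‖(c.coord (γ r)).2.2.2 - (c.coord v).2.2.2‖ ≤ θ r := by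
        simp only [hθ, foldCoord, Prod.dist_eq, ← dist_eq_norm]
        exact ((le_max_right _ _).trans (le_max_right _ _)).trans (le_max_right _ _)
      have h2 : ‖(c.coord v).2.2.2‖ ≤ ‖c.coord v‖ :=
        ((norm_snd_le _).trans (norm_snd_le _)).trans (norm_snd_le _)
      linarith [norm_sub_norm_le (c.coord (γ r)).2.2.2 (c.coord v).2.2.2]
  -- Start within `ρ / 2` of the cluster point with so little time left that at most another `ρ / 2`
  -- can be covered.
  obtain ⟨i, ⟨hiO, hiθ⟩, hiT⟩ : ∃ i, ((γ (t i)).proj ∈ c.O ∧ θ (t i) < ρ / 2) ∧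
      T - ρ / (2 * C) < t i := by
    have h1 : ∃ᶠ i in atTop, (γ (t i)).proj ∈ c.O ∧ θ (t i) < ρ / 2 := by
      have h2 : ContinuousAt (fun w => dist (foldCoord (c.coord w)) (foldCoord (c.coord v))) v :=
        (ContinuousAt.comp (g := foldCoord) continuous_foldCoord.continuousAt
          (c.continuousAt_coord hv)).dist continuousAt_const
      have h3 : ∀ᶠ w in 𝓝 v, dist (foldCoord (c.coord w)) (foldCoord (c.coord v)) < ρ / 2 :=
        h2.eventually_lt_const ((dist_self _).trans_lt (by positivity))
      exact (mapClusterPt_iff_frequently.1 hcl) _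
        (((c.isOpen_O.preimage ImpactSystem.continuous_proj).eventually_mem hv).and h3)
    exact (h1.and_eventually (ht.eventually_const_lt
      (sub_lt_self T (by positivity : 0 < ρ / (2 * C))))).exists
  have hCT : ∀ r < T, ρ / 2 + C * (r - t i) ≤ ρ := by
    intro r hr
    have h1 : r - t i ≤ ρ / (2 * C) := by linarith
    have h2 := mul_le_mul_of_nonneg_left h1 hC0.le
    have h3 : C * (ρ / (2 * C)) = ρ / 2 := by field_simp
    linarith
  refine ⟨t i, htT i, R, fun r hr => ?_⟩
  have key := continuous_induction
    (P := fun r => (γ r).proj ∈ c.O ∧ θ r ≤ ρ / 2 + C * (r - t i)) (a := t i) (b := r)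
    ⟨hiO, by simpa using hiθ.le⟩ ?_ ?_ r ⟨hr.1, le_rfl⟩
  · exact hconf r ⟨(htT i).1.trans hr.1, hr.2⟩ key.1 (key.2.trans (hCT r hr.2))
  · intro s hs ih
    have hs' : s ∈ Ioo 0 T := ⟨(htT i).1.trans_lt hs.1, hs.2.trans_lt hr.2⟩
    have h1 := hγ.tendsto_left hs'
    -- The bound alone holds inside the domain of the chart; closedness of the smaller ball prevents
    -- the left limit from leaving it.
    have hO : (γ s).proj ∈ c.O := by
      refine ((c.isClosed_closedBall hball).mem_of_tendsto
        ((ImpactSystem.continuous_proj.tendsto (γ s)).comp h1) ?_).1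
      filter_upwards [Ioo_mem_nhdsLT hs.1] with τ hτ
      have h2 := ih τ ⟨hτ.1.le, hτ.2⟩
      refine ⟨h2.1, ?_⟩
      rw [c.C.ψ_apply, Metric.mem_closedBall]
      exact (hpos τ).trans (h2.2.trans (hCT τ (hτ.2.trans hs'.2)))
    refine ⟨hO, ?_⟩
    have h3 : Tendsto θ (𝓝[<] s) (𝓝 (θ s)) :=
      ((continuous_foldCoord.tendsto _).comp
        ((c.continuousAt_coord hO).tendsto.comp h1)).dist tendsto_const_nhds
    refine le_of_tendsto h3 ?_
    filter_upwards [Ioo_mem_nhdsLT hs.1] with τ hτ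
    have h2 := (ih τ ⟨hτ.1.le, hτ.2⟩).2
    have h4 := mul_le_mul_of_nonneg_left hτ.2.le hC0.le
    linarith
  · intro s hs ih
    have hs' : s ∈ Ico 0 T := ⟨(htT i).1.trans hs.1, hs.2.trans hr.2⟩
    obtain ⟨hO, hθs⟩ := ih s ⟨hs.1, le_rfl⟩
    have hcs := hconf s hs' hO (hθs.trans (hCT s hs'.2))
    obtain ⟨ε, hε, d, hd, hds, hdγ⟩ := c.exists_coord_motion hmn hγ hs' hcs
    refine ⟨ε, hε, fun τ hτ hτr => ?_⟩
    obtain ⟨h1, h2⟩ := hdγ τ hτ (hτr.trans_lt hr.2)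
    refine ⟨h1.2.1, ?_⟩
    have h3 := norm_sub_le_of_hasDerivAt_fullField hR0 hB (c := d) (t := s) (δ := τ - s)
      (fun q hq => hd q ⟨hq.1, by linarith [hq.2, hτ.2]⟩) τ ⟨hτ.1.le, by linarith⟩
    have h4 : dist (foldCoord (d τ)) (foldCoord (c.coord (γ s))) ≤ C * (τ - s) := by
      rw [← foldCoord_resetCoord (c.coord (γ s)), ← c.coord_reset hA hcs.1 hO, ← hds]
      exact (dist_foldCoord_le _ _).trans (by rw [dist_eq_norm]; exact h3)
    simp only [hθ]
    rw [h2]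
    have h5 := dist_triangle (foldCoord (d τ)) (foldCoord (c.coord (γ s))) (foldCoord (c.coord v))
    have h6 : dist (foldCoord (c.coord (γ s))) (foldCoord (c.coord v)) ≤ ρ / 2 + C * (s - t i) := hθs
    linarith

/-- The form has a positive minimum `δ` on unit vectors over the compact set. The summand `1` in the
bound reduces to vectors of norm at least `1`. -/
theorem exists_norm_le_of_quadratic_le {E : Type*} [NormedAddCommGroup E] [NormedSpace ℝ E]
    [FiniteDimensional ℝ E] {G : E → E →L[ℝ] E →L[ℝ] ℝ} {B : Set E} (hB : IsCompact B)
    (hG : ContinuousOn G B) (hpos : ∀ y ∈ B, ∀ w, w ≠ 0 → 0 < G y w w) (C : ℝ) :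
    ∃ r, ∀ y ∈ B, ∀ w, G y w w ≤ C → ‖w‖ ≤ r := by
  have hcont : ContinuousOn (fun p : E × E => G p.1 p.2 p.2) (B ×ˢ Metric.sphere 0 1) := by
    have h1 : ContinuousOn (fun p : E × E => G p.1) (B ×ˢ Metric.sphere 0 1) :=
      hG.comp continuousOn_fst fun p hp => hp.1
    exact (h1.clm_apply continuousOn_snd).clm_apply continuousOn_snd
  have hδ : ∃ δ > 0, ∀ y ∈ B, ∀ w : E, ‖w‖ = 1 → δ ≤ G y w w := by
    rcases (B ×ˢ Metric.sphere (0 : E) 1).eq_empty_or_nonempty with he | hne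
    · refine ⟨1, one_pos, fun y hy w hw => ?_⟩
      have : (y, w) ∈ B ×ˢ Metric.sphere (0 : E) 1 := ⟨hy, by simpa using hw⟩
      rw [he] at this
      exact absurd this (notMem_empty _)
    · obtain ⟨p, hp, hmin⟩ := (hB.prod (isCompact_sphere (0 : E) 1)).exists_isMinOn hne hcont
      refine ⟨_, hpos p.1 hp.1 p.2 ?_, fun y hy w hw =>
        hmin (show (y, w) ∈ B ×ˢ Metric.sphere (0 : E) 1 from ⟨hy, by simpa using hw⟩)⟩
      intro h0
      have := hp.2
      simp [h0] at this
  obtain ⟨δ, hδ, hmin⟩ := hδ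
  refine ⟨|C| / δ + 1, fun y hy w hC => ?_⟩
  by_contra! hlt
  have hw1 : 1 ≤ ‖w‖ := by linarith [show 0 ≤ |C| / δ by positivity]
  have hw0 : ‖w‖ ≠ 0 := by linarith
  have h1 := hmin y hy (‖w‖⁻¹ • w) (by rw [norm_smul, norm_inv, norm_norm, inv_mul_cancel₀ hw0])
  simp only [map_smul, smul_apply, smul_eq_mul] at h1
  have h2 : δ * (‖w‖ * ‖w‖) ≤ C := by
    have h3 : ‖w‖⁻¹ * (‖w‖⁻¹ * G y w w) * (‖w‖ * ‖w‖) = G y w w := by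
      field_simp
    exact (mul_le_mul_of_nonneg_right h1 (by positivity)).trans (h3.le.trans hC)
  have h4 : |C| < δ * ‖w‖ := by
    have : |C| / δ < ‖w‖ := by linarith
    rwa [div_lt_iff₀' hδ] at this
  have h5 : δ * ‖w‖ ≤ δ * (‖w‖ * ‖w‖) :=
    mul_le_mul_of_nonneg_left (le_mul_of_one_le_left (norm_nonneg _) hw1) hδ.le
  linarith [le_abs_self C]

/-! ### Conservation of energy and compactness. -/

section Energy

namespace ImpactSystem

theorem coordG_tcoord (M : ImpactSystem n m Q) {q₀ : Q} {v : TangentBundle (𝓡 n) Q}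
    (hv : v.proj ∈ (extChartAt (𝓡 n) q₀).source) :
    M.coordG q₀ (tcoord q₀ v).1 (tcoord q₀ v).2 (tcoord q₀ v).2 =
      M.metric.inner v.proj v.snd v.snd :=
  congrArg (fun v : TangentBundle (𝓡 n) Q => M.metric.inner v.proj v.snd v.snd) (ofCoord_tcoord hv)

theorem energy_eq_tcoord (M : ImpactSystem n m Q) {q₀ : Q} {v : TangentBundle (𝓡 n) Q}
    (hv : v.proj ∈ (extChartAt (𝓡 n) q₀).source) :
    M.energy v = M.coordG q₀ (tcoord q₀ v).1 (tcoord q₀ v).2 (tcoord q₀ v).2 / 2 +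
      M.V ((extChartAt (𝓡 n) q₀).symm (tcoord q₀ v).1) := by
  rw [M.coordG_tcoord hv]
  change _ = _ + M.V ((extChartAt (𝓡 n) q₀).symm (extChartAt (𝓡 n) q₀ v.proj))
  rw [(extChartAt (𝓡 n) q₀).left_inv hv]
  rfl

theorem continuous_energy (M : ImpactSystem n m Q) : Continuous M.energy := by
  refine continuous_iff_continuousAt.2 fun v => ?_
  have hv := mem_extChartAt_source (I := 𝓡 n) v.proj
  have hnhds : {w : TangentBundle (𝓡 n) Q | w.proj ∈ (extChartAt (𝓡 n) v.proj).source} ∈ 𝓝 v :=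
    ((isOpen_extChartAt_source v.proj).preimage continuous_proj).mem_nhds hv
  have h1 := (continuousOn_tcoord (n := n) v.proj).continuousAt hnhds
  have h2 : ContinuousAt (fun w => M.coordG v.proj (tcoord v.proj w).1) v :=
    ContinuousAt.comp (g := M.coordG v.proj) ((M.contDiffOn_coordG v.proj).continuousOn.continuousAt
      ((isOpen_extChartAt_target v.proj).mem_nhds ((extChartAt (𝓡 n) v.proj).map_source hv))) h1.fst
  have h3 := ((h2.clm_apply h1.snd).clm_apply h1.snd).div_const 2
  have h4 : ContinuousAt (fun w : TangentBundle (𝓡 n) Q => M.V w.proj) v :=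
    (M.V_smooth.continuous.comp continuous_proj).continuousAt
  refine (h3.add h4).congr ?_
  filter_upwards [hnhds] with w hw
  exact congrArg (fun x => x / 2 + M.V w.proj) (M.coordG_tcoord hw)

/-- The energy is constant along free motions. -/
theorem IsFreeMotionOn.hasDerivAt_energy (hmn : m + 1 ≤ n) {c : ℝ → TangentBundle (𝓡 n) Q}
    {J : Set ℝ} (hc : M.IsFreeMotionOn c J) (hJ : IsOpen J) {t : ℝ} (ht : t ∈ J) :
    HasDerivAt (fun s => M.energy (c s)) 0 t := by
  obtain ⟨k, hk⟩ := exists_stateChart M hmn (c t).proj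
  have hsrc := k.mem_source hk
  set q₀ := k.base
  have htgt : (tcoord q₀ (c t)).1 ∈ (extChartAt (𝓡 n) q₀).target :=
    (extChartAt (𝓡 n) q₀).map_source hsrc
  obtain ⟨hx, hη, p', hp, hp'⟩ := hc.coordinates hJ ht hsrc
  have hev : ∀ᶠ s in 𝓝 t, s ∈ J ∧ (c s).proj ∈ k.O :=
    (hJ.eventually_mem ht).and ((hc t ht).2.1.continuousAt.eventually (k.isOpen_O.mem_nhds hk))
  -- Velocities are differentiable because the state is a smooth function of its adapted
  -- coordinates, which satisfy a differential equation.
  have hpd : DifferentiableAt ℝ (fun s => tcoord q₀ (c s)) t := by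
    have h1 : DifferentiableAt ℝ (fun s => k.C.lift (k.coord (c s))) t :=
      DifferentiableAt.comp (g := k.C.lift) t (k.differentiableAt_lift (k.coord_mem_domain hk))
        (k.hasDerivAt_coord hc hJ ht hk).differentiableAt
    refine h1.congr_of_eventuallyEq ?_
    filter_upwards [hev] with s hs
    exact (k.lift_coord (hc s hs.1).1 hs.2).symm
  obtain ⟨w', hw⟩ : ∃ w', HasDerivAt (fun s => (tcoord q₀ (c s)).2) w' t :=
    ⟨_, hpd.snd.hasDerivAt⟩
  have ho := (isOpen_extChartAt_target (I := 𝓡 n) q₀).mem_nhds htgt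
  have hG := ((((M.contDiffOn_coordG q₀).contDiffAt ho).differentiableAt
    (by simp)).hasFDerivAt).comp_hasDerivAt t hx
  have hV := ((((contDiffOn_chart_symm M.V_smooth q₀).contDiffAt ho).differentiableAt
    (by simp)).hasFDerivAt).comp_hasDerivAt t hx
  have h1 := hG.clm_apply hw
  have h2 := (((hp.clm_apply hw).const_mul (2⁻¹ : ℝ)).add hV)
  -- The derivative of the momentum is computed by the product rule and by the equation of motion;
  -- comparison on the velocity itself, which lies in the distribution, gives conservation of
  -- energy.
  have h3 := congrArg (fun f : Vec n →L[ℝ] ℝ => f (tcoord q₀ (c t)).2) (h1.unique hp)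
  have h4 := hp' _ hη.self_of_nhds
  have hs : M.coordG q₀ (tcoord q₀ (c t)).1 w' (tcoord q₀ (c t)).2 =
    M.coordG q₀ (tcoord q₀ (c t)).1 (tcoord q₀ (c t)).2 w' := M.metric.symm _ _ _
  simp only [Function.comp_apply, add_apply] at h3
  have h5 : 2⁻¹ * (p' (tcoord q₀ (c t)).2 +
      M.coordG q₀ (tcoord q₀ (c t)).1 (tcoord q₀ (c t)).2 w') +
      fderiv ℝ (fun y => M.V ((extChartAt (𝓡 n) q₀).symm y)) (tcoord q₀ (c t)).1
        (tcoord q₀ (c t)).2 = 0 := by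
    rw [← hs]
    linarith
  rw [h5] at h2
  refine h2.congr_of_eventuallyEq ?_
  filter_upwards [hev] with s hs
  rw [M.energy_eq_tcoord (k.mem_source hs.2)]
  simp only [Pi.add_apply, Function.comp_apply]
  ring

theorem IsHybridTrajectory.energy_eq (hmn : m + 1 ≤ n) (hγ : M.IsHybridTrajectory γ T x) {t : ℝ}
    (ht : t ∈ Ico 0 T) : M.energy (γ t) = M.energy x := by
  have key := abs_sub_le_of_right_lipschitz (f := fun s => M.energy (γ s)) (a := 0) (b := t)
    (C := 0) ht.1 ?_ ?_
  · rw [zero_mul, hγ.init] at key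
    exact sub_eq_zero.1 (abs_nonpos_iff.1 key)
  · intro s hs
    exact M.continuous_energy.continuousAt.comp_continuousWithinAt
      (hγ.left_continuous s ⟨hs.1, hs.2.trans_lt ht.2⟩)
  · intro s hs
    obtain ⟨ε, hε, c, hc, hcs, hcγ⟩ := hγ.right_motion s ⟨hs.1, hs.2.trans ht.2⟩
    refine ⟨ε, hε, fun τ hτ hτt => ?_⟩
    have hd : ∀ r ∈ Icc s τ, HasDerivAt (fun s => M.energy (c s)) 0 r := fun r hr =>
      hc.hasDerivAt_energy hmn isOpen_Ioo ⟨by linarith [hr.1], by linarith [hr.2, hτ.2]⟩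
    have h1 := constant_of_has_deriv_right_zero
      (fun r hr => (hd r hr).continuousAt.continuousWithinAt)
      (fun r hr => (hd r ⟨hr.1, hr.2.le⟩).hasDerivWithinAt) τ ⟨hτ.1.le, le_rfl⟩
    rw [hcγ τ hτ (hτt.trans_lt ht.2), h1, hcs, M.energy_reset]
    simp

/-- On a compact manifold, the states with bounded kinetic energy form a bounded set. -/
theorem exists_isCompact_of_inner_le [CompactSpace Q] (M : ImpactSystem n m Q) (C : ℝ) :
    ∃ K : Set (TangentBundle (𝓡 n) Q), IsCompact K ∧
      ∀ v : TangentBundle (𝓡 n) Q, M.metric.inner v.proj v.snd v.snd ≤ C → v ∈ K := by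
  have hloc : ∀ q : Q, ∃ N ∈ 𝓝 q, ∃ K : Set (TangentBundle (𝓡 n) Q), IsCompact K ∧
      ∀ v : TangentBundle (𝓡 n) Q, v.proj ∈ N → M.metric.inner v.proj v.snd v.snd ≤ C → v ∈ K := by
    intro q
    have hsrc := mem_extChartAt_source (I := 𝓡 n) q
    obtain ⟨ρ, hρ, hball⟩ := Metric.nhds_basis_closedBall.mem_iff.1
      ((isOpen_extChartAt_target (I := 𝓡 n) q).mem_nhds (mem_extChartAt_target q))
    set B := Metric.closedBall (extChartAt (𝓡 n) q q) ρ with hB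
    obtain ⟨r, hr⟩ := exists_norm_le_of_quadratic_le (isCompact_closedBall _ ρ)
      ((M.contDiffOn_coordG q).continuousOn.mono hball)
      (fun y hy w hw => M.coordG_pos (hball hy) hw) C
    refine ⟨_, inter_mem ((continuousAt_extChartAt (I := 𝓡 n) q).preimage_mem_nhds
      (Metric.closedBall_mem_nhds _ hρ)) ((isOpen_extChartAt_source q).mem_nhds hsrc),
      ofCoord q '' (B ×ˢ Metric.closedBall 0 r), ?_, ?_⟩
    · exact ((isCompact_closedBall _ ρ).prod (isCompact_closedBall _ _)).image_of_continuousOn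
        ((continuousOn_ofCoord q).mono fun p hp => hball hp.1)
    · intro v hv hC
      refine ⟨tcoord q v, ⟨hv.1, ?_⟩, ofCoord_tcoord hv.2⟩
      rw [← M.coordG_tcoord hv.2] at hC
      exact mem_closedBall_zero_iff.2 (hr _ hv.1 _ hC)
  choose N hN K hK hNK using hloc
  obtain ⟨s, -, hs⟩ := isCompact_univ.elim_nhds_subcover N fun q _ => hN q
  refine ⟨⋃ q ∈ s, K q, s.isCompact_biUnion fun q _ => hK q, fun v hv => ?_⟩
  obtain ⟨q, hq, hvq⟩ := mem_iUnion₂.1 (hs (mem_univ v.proj))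
  exact mem_iUnion₂.2 ⟨q, hq, hNK q v hvq hv⟩

end ImpactSystem

end Energy

/-! ### Zeno trajectories and the conclusion. -/

variable {n m : ℕ} {Q : Type*} [TopologicalSpace Q]
  [ChartedSpace (EuclideanSpace ℝ (Fin n)) Q] [IsManifold (𝓡 n) ∞ Q] {M : ImpactSystem n m Q}
  {γ : ℝ → TangentBundle (𝓡 n) Q} {T : ℝ} {t : ℕ → ℝ} {x : TangentBundle (𝓡 n) Q}

namespace ImpactSystem

theorem IsZenoTrajectory.mem_Ico (hz : M.IsZenoTrajectory γ T t x) (i : ℕ) : t i ∈ Ico 0 T :=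
  ⟨hz.nonneg i, (hz.strictMono (Nat.lt_succ_self i)).trans_le
    (hz.strictMono.monotone.ge_of_tendsto hz.tendsto (i + 1))⟩

/-- Before its end, a regular trajectory stays in one chart and comes arbitrarily close to zero
height and normal velocity. -/
theorem IsZenoTrajectory.exists_singular_end [T2Space Q] (hmn : m + 1 ≤ n)
    (hz : M.IsZenoTrajectory γ T t x)
    (hsteady : ¬ Tendsto (fun i => γ (t i)) atTop (cocompact _)) {ι : Type*}
    {c : ι → StateChart M} (hcov : ∀ q, ∃ i, q ∈ (c i).O) {T' : ℝ}
    (hT' : T' = T ∨ T' < T ∧ M.h (γ T').proj = 0 ∧ M.dh (γ T').proj (γ T').snd = 0) (hT0 : 0 < T') :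
    ∃ i, (c i).IsAdapted ∧ (∃ s ∈ Ico 0 T', ∃ R : ℕ, ∀ r ∈ Ico s T', (c i).Confined (R + 1) (γ r)) ∧
      (∀ s < T', ∀ ε > 0, ∃ r ∈ Ico s T', |M.h (γ r).proj| < ε) ∧
      ∀ s < T', ∀ ε > 0, ∃ r ∈ Ico s T', |M.dh (γ r).proj (γ r).snd| < ε := by
  have hγ := hz.trajectory
  rcases hT' with rfl | ⟨hT'T, hh0, hu0⟩
  -- At the accumulation time a cluster point of the impact states exists by steadiness and lies
  -- over `h = 0`. In the other case below the end is a grazing state, and left continuity suffices.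
  · obtain ⟨S, hS, hfreq⟩ := not_tendsto_iff_exists_frequently_notMem.1 hsteady
    obtain ⟨K, hK, hKS⟩ := mem_cocompact.1 hS
    have hfK : ∃ᶠ i in atTop, γ (t i) ∈ K := hfreq.mono fun i hi => by
      by_contra h; exact hi (hKS h)
    obtain ⟨v, -, hv⟩ := hK.exists_mapClusterPt_of_frequently hfK
    have hv0 : M.h v.proj = 0 := by
      by_contra hne
      have h1 : {w : TangentBundle (𝓡 n) Q | M.h w.proj ≠ 0} ∈ 𝓝 v :=
        (isOpen_ne_fun (M.h_smooth.continuous.comp continuous_proj) continuous_const).mem_nhds hne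
      obtain ⟨i, hi⟩ := ((mapClusterPt_iff_frequently.1 hv) _ h1).exists
      exact hi (hz.impact i).2.1
    obtain ⟨i, hi⟩ := hcov v.proj
    have hA := (c i).isAdapted_of_mem hi hv0
    refine ⟨i, hA, (c i).exists_confined_end hmn hγ hA hi hz.tendsto hz.mem_Ico hv, ?_, ?_⟩
    · intro s hs ε hε
      obtain ⟨j, hj⟩ := (hz.tendsto.eventually_const_lt hs).exists
      exact ⟨t j, ⟨hj.le, (hz.mem_Ico j).2⟩, by rw [(hz.impact j).2.1, abs_zero]; exact hε⟩
    · intro s hs ε hε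
      obtain ⟨j, hj⟩ := (hz.tendsto.eventually_const_lt hs).exists
      obtain ⟨r, hr, hrε⟩ := hγ.exists_abs_dh_lt hmn (hz.mem_Ico j)
        ⟨hz.strictMono (Nat.lt_succ_self j), (hz.mem_Ico (j + 1)).2⟩ (hz.impact j)
        (hz.impact (j + 1)) hε
      exact ⟨r, ⟨hj.le.trans hr.1, hr.2.trans_lt (hz.mem_Ico (j + 1)).2⟩, hrε⟩
  · obtain ⟨i, hi⟩ := hcov (γ T').proj
    have hmem : T' ∈ Ioo 0 T := ⟨hT0, hT'T⟩
    have hsmall : ∀ f : ℝ → ℝ, Tendsto f (𝓝[<] T') (𝓝 0) →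
        ∀ s < T', ∀ ε > 0, ∃ r ∈ Ico s T', |f r| < ε := by
      intro f hf s hs ε hε
      have h1 : ∀ᶠ r in 𝓝[<] T', |f r| < ε :=
        hf.abs.eventually_lt_const (by rw [abs_zero]; exact hε)
      obtain ⟨r, hr, hrs⟩ := (h1.and (Ico_mem_nhdsLT hs)).exists
      exact ⟨r, hrs, hr⟩
    obtain ⟨η, hη, R, hconf⟩ := (c i).exists_confined_window hmn hγ ⟨hT0.le, hT'T⟩ hi
    refine ⟨i, (c i).isAdapted_of_mem hi hh0, ⟨max 0 (T' - η / 2), ⟨le_max_left _ _,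
      max_lt hT0 (by linarith)⟩, R, fun r hr => hconf r ⟨?_, by linarith [hr.2]⟩
        ((le_max_left _ _).trans hr.1) (hr.2.trans hT'T)⟩, hsmall _ ?_, hsmall _ ?_⟩
    · linarith [(le_max_right _ _).trans hr.1]
    · have := hγ.tendsto_h_left hmem
      rwa [hh0] at this
    · have := hγ.tendsto_dh_left hmem
      rwa [hu0] at this

/-- The end is taken at the first grazing after the first impact if there is one, since beyond it
the height may become negative and reflected motions no longer describe the trajectory. -/
theorem IsZenoTrajectory.mem_singularPullback [T2Space Q] (hmn : m + 1 ≤ n)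
    (hz : M.IsZenoTrajectory γ T t x)
    (hsteady : ¬ Tendsto (fun i => γ (t i)) atTop (cocompact _)) {ι : Type*}
    {c : ι → StateChart M} (hcov : ∀ q, ∃ i, q ∈ (c i).O) :
    x ∈ ⋃ k, singularPullback c k := by
  have hγ := hz.trajectory
  obtain ⟨t₀, ht₀, himp, hno⟩ := hγ.exists_first_impact hmn ⟨t 0, hz.mem_Ico 0, hz.impact 0⟩
  obtain ⟨T', ht₀T', hT'T, hreg, hT'⟩ := hγ.exists_regular_end hmn ht₀ himp
  have hT0 : 0 < T' := ht₀.1.trans_lt ht₀T'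
  refine Nonholonomic.mem_singularPullback hmn hγ hcov hT'T hT0
    (hγ.local_modes hmn ht₀ himp hno hT'T hreg) ?_
  obtain ⟨i, hA, ⟨s, hs, R, hconf⟩, hh, hu⟩ := hz.exists_singular_end hmn hsteady hcov hT' hT0
  have hnn := hγ.h_nonneg hmn ht₀ himp hT'T hreg
  refine ⟨max (max s (T' - 1)) t₀, max_lt (max_lt hs.2 (by linarith)) ht₀T', fun r hr => ?_⟩
  have h1 : s < r := ((le_max_left _ _).trans (le_max_left _ _)).trans_lt hr.1
  have h2 : T' - 1 < r := ((le_max_right _ _).trans (le_max_left _ _)).trans_lt hr.1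
  have h3 : t₀ < r := (le_max_right _ _).trans_lt hr.1
  refine mem_iUnion.2 ⟨0, mem_iUnion.2 ⟨i, mem_iUnion.2 ⟨R, ?_⟩⟩⟩
  exact (c i).mem_singular hmn hγ hA (hs.1.trans h1.le) hr.2 (by linarith) hT'T
    (fun τ hτ => hconf τ ⟨h1.le.trans hτ.1, hτ.2⟩) (fun τ hτ => hnn τ ⟨h3.le.trans hτ.1, hτ.2⟩)
    (fun τ hτ => hreg τ ⟨h3.trans_le hτ.1, hτ.2⟩) (fun τ hτ => hh τ hτ.2) fun τ hτ => hu τ hτ.2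

theorem IsZenoTrajectory.add_one_le (hz : M.IsZenoTrajectory γ T t x) : m + 1 ≤ n :=
  M.add_one_le_of_h_eq_zero (hz.impact 0).2.1

theorem isNull_steadyZenoStates [T2Space Q] [SecondCountableTopology Q] (M : ImpactSystem n m Q) :
    M.IsNull M.steadyZenoStates := by
  by_cases hmn : m + 1 ≤ n
  · choose C hC using exists_stateChart M hmn
    -- Second countability gives countably many charts, chosen independently of the trajectory.
    obtain ⟨s, hs, hcov⟩ := TopologicalSpace.countable_cover_nhds fun q =>
      (C q).isOpen_O.mem_nhds (hC q)
    have := hs.to_subtype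
    let c : s → StateChart M := fun q => C q
    have hcov' : ∀ q, ∃ i, q ∈ (c i).O := fun q => by
      obtain ⟨i, hi, hq⟩ := mem_iUnion₂.1 (hcov.symm ▸ mem_univ q : q ∈ ⋃ x ∈ s, (C x).O)
      exact ⟨⟨i, hi⟩, hq⟩
    refine ((ChartNull.iUnion (chartNull_singularPullback c)).mono ?_).isNull hmn
    rintro x ⟨γ, T, t, hz, hst⟩
    exact hz.mem_singularPullback hmn hst hcov'
  · have hempty : M.steadyZenoStates = ∅ := by
      refine eq_empty_of_forall_notMem ?_
      rintro x ⟨γ, T, t, hz, -⟩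
      exact hmn hz.add_one_le
    intro q₀ U _ _ e _ _ _
    simp [hempty]

/-- On a compact manifold, conservation of energy makes all Zeno states steady. -/
theorem zenoStates_subset_steadyZenoStates [CompactSpace Q] (M : ImpactSystem n m Q) :
    M.zenoStates ⊆ M.steadyZenoStates := by
  rintro x ⟨γ, T, t, hz⟩
  refine ⟨γ, T, t, hz, fun htend => ?_⟩
  obtain ⟨b, hb⟩ := (isCompact_range M.V_smooth.continuous).bddBelow
  -- With energy conserved and the potential at least `b`, this bounds `g(v, v)` along the
  -- trajectory.
  obtain ⟨K, hK, hKv⟩ := M.exists_isCompact_of_inner_le (2 * (M.energy x - b))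
  have hmem : ∀ i, γ (t i) ∈ K := fun i => by
    refine hKv _ ?_
    have h1 := hz.trajectory.energy_eq hz.add_one_le (hz.mem_Ico i)
    have h2 := hb (mem_range_self (γ (t i)).proj)
    unfold energy at h1 ⊢
    linarith
  obtain ⟨i, hi⟩ := (htend.eventually hK.compl_mem_cocompact).exists
  exact hi (hmem i)

end ImpactSystem

end Nonholonomic

end

theorem mainTheorem11 {n m : ℕ} {Q : Type*} [TopologicalSpace Q]
    [ChartedSpace (EuclideanSpace ℝ (Fin n)) Q] [IsManifold (𝓡 n) ∞ Q]
    [T2Space Q] [SecondCountableTopology Q]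
    (M : Nonholonomic.ImpactSystem n m Q) :
    M.IsNull M.steadyZenoStates ∧ (CompactSpace Q → M.IsNull M.zenoStates) := by
  refine ⟨M.isNull_steadyZenoStates, fun _ q₀ U hU hUt e he hli hη => ?_⟩
  refine measure_mono_null ?_ (M.isNull_steadyZenoStates q₀ U hU hUt e he hli hη)
  rintro p ⟨hpU, hp⟩
  exact ⟨hpU, M.zenoStates_subset_steadyZenoStates hp⟩
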